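/- Let $G$ be a second countable locally compact Hausdorff groupoid with Haar system $\{\lambda^u\}_{u\in G^{(0)}}$, let $\lambda_u$ be the image of $\lambda^u$ under inversion, and let $q:\mathscr B\to G$ be a separable (saturated, upper semicontinuous) Fell bundle; separable means that $\Gamma_0(G;\mathscr B)$ is separable in the supremum norm. Let $A=\Gamma_0(G^{(0)};\mathscr B)$ be the C*-algebra of continuous sections over the unit space that vanish at infinity, and let $\Gamma_c(G;\mathscr B)$ be the $*$-algebra of continuous compactly supported sections with $(f*g)(z)=\int_G f(y)g(y^{-1}z)\,d\lambda^{r(z)}(y)$ and $f^*(x)=f(x^{-1})^*$. Let $C^*(G;\mathscr B)$ be the completion of $\Gamma_c(G;\mathscr B)$ in the universal norm $\sup_L\|L(f)\|$, where $L$ runs over the $*$-representations of $\Gamma_c(G;\mathscr B)$ on Hilbert spaces with $\|L(f)\|\le\|f\|_I$ for all $f$, and $\|f\|_I=\sup_{u\in G^{(0)}}\max\bigl(\int\|f\|\,d\lambda^u,\int\|f\|\,d\lambda_u\bigr)$. Let $\mathsf X=\mathsf X^G_{G^{(0)}}$ be the right Hilbert $A$-module obtained by completing $\Gamma_c(G;\mathscr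 B)$ with respect to $$(\varphi\cdot a)(z)=\varphi(z)\,a(s(z)),\qquad \langle\varphi,\psi\rangle_A(u)=\int_G\varphi(y)^*\psi(y)\,d\lambda_u(y),$$ and let $\mathcal L(\mathsf X)$ be the C*-algebra of adjointable operators on $\mathsf X$. Then there is a unique $*$-homomorphism $V:C^*(G;\mathscr B)\to\mathcal L(\mathsf X)$ such that $V(f)\varphi=f*\varphi$ for all $f,\varphi\in\Gamma_c(G;\mathscr B)$. For a representation $\pi$ of $A$ on a Hilbert space $H_\pi$, let $\operatorname{Ind}\pi$ be the representation of $C^*(G;\mathscr B)$ on the completion $\mathsf X\otimes_\pi H_\pi$ of $\mathsf X\odot H_\pi$ for the inner product (linear in the first variable) $(x\otimes h\mid y\otimes k)=(\pi(\langle y,x\rangle_A)h\mid k)$, given by $(\operatorname{Ind}\pi)(a)(x\otimes h)=V(a)x\otimes h$. Put $$\|a\|_r=\sup\{\|(\operatorname{Ind}\pi)(a)\| : \pi\text{ a representation of }A\},\qquad I_r=\{a\in C^*(G;\mathscr B):\|a\|_r=0\},$$ and $C^*_r(G;\mathscr B)=C^*(G;\mathscr B)/I_r$. Then $\ker V=I_r$;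 $V$ factors through the quotient map as an injective $*$-homomorphism $C^*_r(G;\mathscr B)\to\mathcal L(\mathsf X)$; and $\|V(a)\|=\|a\|_r$ for every $a\in C^*(G;\mathscr B)$, in particular for every $a = f\in\Gamma_c(G;\mathscr B)$. -/

import Mathlib

open Filter Topology MeasureTheory
open scoped ENNReal

namespace FellBundles

universe u v

set_option linter.unusedSectionVars false

/-- A topological groupoid on the arrow space `G`. Units are identified with identity arrows, so the
range and source maps take values in `G`. The product `gmul x y` is meaningful only when
`sr x = rg y`; no law says anything about its value otherwise. -/
class TopGroupoid (G : Type u) [TopologicalSpace G] where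
  /-- range -/
  rg : G → G
  /-- source -/
  sr : G → G
  /-- product of composable arrows -/
  gmul : G → G → G
  /-- inverse -/
  ginv : G → G
  rg_sr : ∀ x, rg (sr x) = sr x
  sr_rg : ∀ x, sr (rg x) = rg x
  rg_gmul : ∀ x y, sr x = rg y → rg (gmul x y) = rg x
  sr_gmul : ∀ x y, sr x = rg y → sr (gmul x y) = sr y
  gmul_assoc : ∀ x y z, sr x = rg y → sr y = rg z → gmul (gmul x y) z = gmul x (gmul y z)
  rg_gmul_self : ∀ x, gmul (rg x) x = x
  gmul_sr_self : ∀ x, gmul x (sr x) = x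
  rg_ginv : ∀ x, rg (ginv x) = sr x
  sr_ginv : ∀ x, sr (ginv x) = rg x
  gmul_ginv : ∀ x, gmul x (ginv x) = rg x
  ginv_gmul : ∀ x, gmul (ginv x) x = sr x
  continuousOn_gmul : ContinuousOn (fun p : G × G => gmul p.1 p.2) {p | sr p.1 = rg p.2}
  continuous_ginv : Continuous ginv

open TopGroupoid

section Groupoid

variable {G : Type u} [TopologicalSpace G] [TopGroupoid G]

/-- `x` and `y` are composable with product `z`. -/
def IsMul (x y z : G) : Prop := sr x = rg y ∧ gmul x y = z

theorem rg_rg (x : G) : rg (rg x) = rg x := by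
  have := rg_sr (rg x); rwa [sr_rg] at this

variable (G) in
/-- The unit space `G⁰`. -/
abbrev UnitSpace : Type u := {w : G // rg w = w}

theorem sr_unit (w : UnitSpace G) : sr w.1 = w.1 := by
  have := sr_rg w.1; rwa [w.2] at this

/-- The range of an arrow as a point of the unit space. -/
def rgU (x : G) : UnitSpace G := ⟨rg x, rg_rg x⟩

/-- The source of an arrow as a point of the unit space. -/
def srU (x : G) : UnitSpace G := ⟨sr x, rg_sr x⟩

theorem ginv_ginv (x : G) : ginv (ginv x) = x := by
  have h1 : gmul (ginv (ginv x)) (gmul (ginv x) x) = gmul (gmul (ginv (ginv x)) (ginv x)) x :=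
    (gmul_assoc _ _ _ (by rw [sr_ginv]) (by rw [sr_ginv])).symm
  rw [ginv_gmul, ginv_gmul, sr_ginv, rg_gmul_self] at h1
  rwa [show sr x = sr (ginv (ginv x)) by rw [sr_ginv, rg_ginv], gmul_sr_self] at h1

theorem IsMul.mk' {x y : G} (h : sr x = rg y) : IsMul x y (gmul x y) := ⟨h, rfl⟩

theorem isMul_ginv_gmul {y z : G} (h : rg y = rg z) : IsMul y (gmul (ginv y) z) z := by
  have h1 : sr (ginv y) = rg z := by rw [sr_ginv, h]
  refine ⟨by rw [rg_gmul _ _ h1, rg_ginv], ?_⟩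
  rw [← gmul_assoc _ _ _ (by rw [rg_ginv]) h1, gmul_ginv, h, rg_gmul_self]

theorem isMul_ginv_self (y : G) : IsMul (ginv y) y (sr y) := ⟨sr_ginv y, ginv_gmul y⟩

theorem isMul_self_sr (y : G) : IsMul y (sr y) y := ⟨(rg_sr y).symm, gmul_sr_self y⟩

theorem isMul_unit (w : UnitSpace G) : IsMul w.1 w.1 w.1 := by
  refine ⟨by rw [sr_unit w, w.2], ?_⟩
  have := rg_gmul_self w.1
  rwa [w.2] at this

theorem ginv_unit (w : UnitSpace G) : ginv w.1 = w.1 := by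
  have h1 : gmul (ginv w.1) w.1 = ginv w.1 := by
    conv_lhs => rw [show w.1 = sr (ginv w.1) by rw [sr_ginv, w.2]]
    rw [show ginv (sr (ginv w.1)) = ginv w.1 by rw [sr_ginv, w.2], gmul_sr_self]
  rw [← h1, ginv_gmul, sr_unit w]

theorem continuous_rg : Continuous (rg : G → G) := by
  have h : (rg : G → G) = fun x => gmul x (ginv x) := by ext x; rw [gmul_ginv]
  rw [h]
  exact continuousOn_gmul.comp_continuous (f := fun x : G => (x, ginv x))
    (continuous_id.prodMk continuous_ginv) (fun x => (rg_ginv x).symm)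

theorem continuous_sr : Continuous (sr : G → G) := by
  have h : (sr : G → G) = fun x => rg (ginv x) := by ext x; rw [rg_ginv]
  rw [h]; exact continuous_rg.comp continuous_ginv

theorem continuous_rgU : Continuous (rgU : G → UnitSpace G) :=
  continuous_rg.subtype_mk _

end Groupoid

/-- A (left) Haar system: Radon measures `lam w` with support `r⁻¹(w)`, depending continuously on
`w` in the unit space, and left invariant. (On a second countable locally compact Hausdorff space
every Borel measure that is finite on compact sets is Radon.) -/
structure HaarSystem (G : Type u) [TopologicalSpace G] [TopGroupoid G] [MeasurableSpace G] where
  /-- the measures -/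
  lam : UnitSpace G → Measure G
  lt_top_of_isCompact : ∀ w K, IsCompact K → lam w K < ∞
  support_eq : ∀ w, (lam w).support = {x | rg x = w.1}
  continuous_integral : ∀ h : G → ℝ, Continuous h → HasCompactSupport h →
    Continuous fun w => ∫ x, h x ∂(lam w)
  left_invariant : ∀ (x : G) (E : Set G), MeasurableSet E →
    lam (srU x) {y | rg y = sr x ∧ gmul x y ∈ E} = lam (rgU x) E

/-- The measures `λ_w` on `s⁻¹(w)`, images of `λ^w` under inversion. -/
noncomputable def HaarSystem.lamInv {G : Type u} [TopologicalSpace G] [TopGroupoid G]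
    [MeasurableSpace G] (hs : HaarSystem G) (w : UnitSpace G) : Measure G :=
  (hs.lam w).map ginv

/-- The total space `⨆ₓ B x` of a family of fibres. -/
structure Tot {X : Type u} (B : X → Type v) where
  /-- the base point -/
  base : X
  /-- the point of the fibre -/
  vec : B base

/-- Upper semicontinuous Banach bundles: the family of fibres `B`, with a topology on the total
space. (The projection is onto since every fibre contains `0`.) -/
class UscBanachBundle {X : Type u} [TopologicalSpace X] (B : X → Type v)
    [∀ x, NormedAddCommGroup (B x)] [∀ x, NormedSpace ℂ (B x)] [TopologicalSpace (Tot B)] :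
    Prop where
  complete : ∀ x, CompleteSpace (B x)
  continuous_base : Continuous (Tot.base : Tot B → X)
  isOpenMap_base : IsOpenMap (Tot.base : Tot B → X)
  usc_norm : UpperSemicontinuous fun b : Tot B => ‖b.vec‖
  /-- Addition is continuous on the fibred product, which carries the topology induced from
  `Tot B × Tot B`. -/
  continuous_add : Continuous[TopologicalSpace.induced
      (fun p : Tot (fun x => B x × B x) => ((⟨p.base, p.vec.1⟩, ⟨p.base, p.vec.2⟩) : Tot B × Tot B))
      inferInstance, inferInstance]
      (fun p : Tot (fun x => B x × B x) => (⟨p.base, p.vec.1 + p.vec.2⟩ : Tot B))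
  continuous_smul : Continuous fun p : ℂ × Tot B => (⟨p.2.base, p.1 • p.2.vec⟩ : Tot B)
  /-- If `‖bᵢ‖ → 0` and `q(bᵢ) → x`, then `bᵢ → 0ₓ`. -/
  tendsto_zero : ∀ x : X,
    comap Tot.base (𝓝 x) ⊓ comap (fun b : Tot B => ‖b.vec‖) (𝓝 0) ≤ 𝓝 ⟨x, 0⟩

/-- Fell bundles over a groupoid. The product of `a ∈ B x` and `b ∈ B y` for composable `x`, `y` is
indexed by its base point `z = xy`, and the adjoint of `a ∈ B x` by `y = x⁻¹`; this is a device
to have `q(ab) = q(a)q(b)` and `q(a*) = q(a)⁻¹` built in. The last group of axioms says that the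
fibres over units are C⋆-algebras and that each `B x` is an imprimitivity bimodule with inner
products `a* b` and `a b*`. -/
class FellBundle {G : Type u} [TopologicalSpace G] [TopGroupoid G] (B : G → Type v)
    [∀ x, NormedAddCommGroup (B x)] [∀ x, NormedSpace ℂ (B x)] [TopologicalSpace (Tot B)]
    extends UscBanachBundle B where
  /-- multiplication -/
  bmul : ∀ {x y z : G}, IsMul x y z → B x →ₗ[ℂ] B y →ₗ[ℂ] B z
  /-- involution -/
  bstar : ∀ {x y : G}, y = ginv x → B x →ₗ⋆[ℂ] B y
  continuous_bmul : Continuous fun p : {p : Tot B × Tot B // sr p.1.base = rg p.2.base} =>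
    (⟨gmul p.1.1.base p.1.2.base, bmul ⟨p.2, rfl⟩ p.1.1.vec p.1.2.vec⟩ : Tot B)
  continuous_bstar : Continuous fun b : Tot B => (⟨ginv b.base, bstar rfl b.vec⟩ : Tot B)
  bmul_assoc : ∀ {x y z xy yz w : G} (h₁ : IsMul x y xy) (h₂ : IsMul xy z w) (h₃ : IsMul y z yz)
    (h₄ : IsMul x yz w) (a : B x) (b : B y) (c : B z),
    bmul h₂ (bmul h₁ a b) c = bmul h₄ a (bmul h₃ b c)
  bstar_bstar : ∀ {x y : G} (h₁ : y = ginv x) (h₂ : x = ginv y) (a : B x),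
    bstar h₂ (bstar h₁ a) = a
  bstar_bmul : ∀ {x y z x' y' z' : G} (h : IsMul x y z) (hx : x' = ginv x) (hy : y' = ginv y)
    (hz : z' = ginv z) (h' : IsMul y' x' z') (a : B x) (b : B y),
    bstar hz (bmul h a b) = bmul h' (bstar hy b) (bstar hx a)
  norm_bmul_le : ∀ {x y z : G} (h : IsMul x y z) (a : B x) (b : B y), ‖bmul h a b‖ ≤ ‖a‖ * ‖b‖
  /-- For a unit `x` this is the C⋆-identity; in general it says that the norm of `B x` is the norm
  of the Hilbert module `B x`. -/
  norm_bstar_bmul_self : ∀ (x : G) (a : B x),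
    ‖bmul (isMul_ginv_self x) (bstar rfl a) a‖ = ‖a‖ ^ 2
  /-- `a* a` is a positive element of the C⋆-algebra `B (s x)`. -/
  bstar_bmul_self_pos : ∀ (x : G) (a : B x), ∃ c : B (sr x),
    bmul (isMul_ginv_self x) (bstar rfl a) a =
      bmul (isMul_unit (srU x)) (bstar (ginv_unit (srU x)).symm c) c
  /-- The inner product `a* b` on `B x` is full. For `B x⁻¹ = (B x)*` this says that the inner
  product `a b*` on `B x` is full. -/
  full : ∀ x : G, closure (Submodule.span ℂ
    {c : B (sr x) | ∃ a b : B x, c = bmul (isMul_ginv_self x) (bstar rfl a) b} : Set (B (sr x)))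
      = Set.univ

open UscBanachBundle FellBundle

section Bundle

variable {X : Type u} [TopologicalSpace X] {B : X → Type v}
    [∀ x, NormedAddCommGroup (B x)] [∀ x, NormedSpace ℂ (B x)] [TopologicalSpace (Tot B)]
    [UscBanachBundle B]

/-- A section, as a map into the total space. -/
def secMap (f : ∀ x, B x) (x : X) : Tot B := ⟨x, f x⟩

theorem tendsto_add' {Ω : Type*} {l : Filter Ω} {p : Ω → X} {a b : ∀ ω, B (p ω)} {x : X}
    {a₀ b₀ : B x}
    (ha : Tendsto (fun ω => (⟨p ω, a ω⟩ : Tot B)) l (𝓝 ⟨x, a₀⟩))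
    (hb : Tendsto (fun ω => (⟨p ω, b ω⟩ : Tot B)) l (𝓝 ⟨x, b₀⟩)) :
    Tendsto (fun ω => (⟨p ω, a ω + b ω⟩ : Tot B)) l (𝓝 ⟨x, a₀ + b₀⟩) := by
  let _ : TopologicalSpace (Tot (fun x => B x × B x)) := TopologicalSpace.induced
      (fun p : Tot (fun x => B x × B x) => ((⟨p.base, p.vec.1⟩, ⟨p.base, p.vec.2⟩) : Tot B × Tot B))
      inferInstance
  have h := (continuous_add (B := B)).tendsto (⟨x, (a₀, b₀)⟩ : Tot (fun x => B x × B x))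
  refine h.comp (f := fun ω => (⟨p ω, (a ω, b ω)⟩ : Tot (fun x => B x × B x))) ?_
  rw [nhds_induced, tendsto_comap_iff]
  exact ha.prodMk_nhds hb

theorem tendsto_smul' {Ω : Type*} {l : Filter Ω} {p : Ω → X} {c : Ω → ℂ} {a : ∀ ω, B (p ω)} {x : X}
    {c₀ : ℂ} {a₀ : B x} (hc : Tendsto c l (𝓝 c₀))
    (ha : Tendsto (fun ω => (⟨p ω, a ω⟩ : Tot B)) l (𝓝 ⟨x, a₀⟩)) :
    Tendsto (fun ω => (⟨p ω, c ω • a ω⟩ : Tot B)) l (𝓝 ⟨x, c₀ • a₀⟩) :=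
  ((continuous_smul (B := B)).tendsto (c₀, (⟨x, a₀⟩ : Tot B))).comp (hc.prodMk_nhds ha)

theorem tendsto_sub' {Ω : Type*} {l : Filter Ω} {p : Ω → X} {a b : ∀ ω, B (p ω)} {x : X}
    {a₀ b₀ : B x}
    (ha : Tendsto (fun ω => (⟨p ω, a ω⟩ : Tot B)) l (𝓝 ⟨x, a₀⟩))
    (hb : Tendsto (fun ω => (⟨p ω, b ω⟩ : Tot B)) l (𝓝 ⟨x, b₀⟩)) :
    Tendsto (fun ω => (⟨p ω, a ω - b ω⟩ : Tot B)) l (𝓝 ⟨x, a₀ - b₀⟩) := by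
  have := tendsto_add' ha (tendsto_smul' (c := fun _ => -1) (c₀ := -1) tendsto_const_nhds hb)
  simpa [sub_eq_add_neg] using this

theorem tendsto_zero' {Ω : Type*} {l : Filter Ω} {p : Ω → X} {a : ∀ ω, B (p ω)} {x : X}
    (hp : Tendsto p l (𝓝 x)) (ha : Tendsto (fun ω => ‖a ω‖) l (𝓝 0)) :
    Tendsto (fun ω => (⟨p ω, a ω⟩ : Tot B)) l (𝓝 ⟨x, 0⟩) := by
  refine Tendsto.mono_right ?_ (tendsto_zero (B := B) x)
  rw [tendsto_inf, tendsto_comap_iff, tendsto_comap_iff]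
  exact ⟨hp, ha⟩

theorem tendsto_sum' {Ω ι : Type*} {l : Filter Ω} {p : Ω → X} (s : Finset ι)
    {a : ι → ∀ ω, B (p ω)} {x : X} {a₀ : ι → B x} (hp : Tendsto p l (𝓝 x))
    (ha : ∀ i ∈ s, Tendsto (fun ω => (⟨p ω, a i ω⟩ : Tot B)) l (𝓝 ⟨x, a₀ i⟩)) :
    Tendsto (fun ω => (⟨p ω, ∑ i ∈ s, a i ω⟩ : Tot B)) l (𝓝 ⟨x, ∑ i ∈ s, a₀ i⟩) := by
  classical
  induction s using Finset.induction_on with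
  | empty => simpa using tendsto_zero' (B := B) (a := fun ω => 0) hp (by simp [tendsto_const_nhds])
  | insert i s hi ih =>
    simp only [Finset.sum_insert hi]
    exact tendsto_add' (ha i (by simp)) (ih fun j hj => ha j (by simp [hj]))

theorem eventually_norm_lt {Ω : Type*} {l : Filter Ω} {p : Ω → X} {a : ∀ ω, B (p ω)} {x : X}
    {a₀ : B x} (ha : Tendsto (fun ω => (⟨p ω, a ω⟩ : Tot B)) l (𝓝 ⟨x, a₀⟩)) {c : ℝ}
    (hc : ‖a₀‖ < c) : ∀ᶠ ω in l, ‖a ω‖ < c :=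
  ha.eventually (usc_norm (B := B) ⟨x, a₀⟩ c hc)

/-- Criterion for convergence in the total space by approximation. -/
theorem tendsto_of_approx {Ω : Type u} {l : Filter Ω} {p : Ω → X} {f : ∀ ω, B (p ω)} {x₀ : X}
    {f₀ : B x₀} (hp : Tendsto p l (𝓝 x₀))
    (H : ∀ ε > 0, ∃ (Ω' : Type u) (l' : Filter Ω') (k : Ω' → Ω) (e : ∀ ω, B (p (k ω))) (d : B x₀),
      l ≤ map k l' ∧ ‖f₀ - d‖ < ε ∧
      Tendsto (fun ω => (⟨p (k ω), e ω⟩ : Tot B)) l' (𝓝 ⟨x₀, d⟩) ∧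
      ∀ᶠ ω in l', ‖f (k ω) - e ω‖ < ε) :
    Tendsto (fun ω => (⟨p ω, f ω⟩ : Tot B)) l (𝓝 ⟨x₀, f₀⟩) := by
  set b₀ : Tot B := ⟨x₀, f₀⟩ with hb₀
  let τ : Tot (fun ω => B (p ω)) → Tot B := fun b => ⟨p b.base, b.vec⟩
  let g : Filter (Tot fun ω => B (p ω)) := comap Tot.base l ⊓ comap τ (𝓝 b₀)
  have hgl : Tendsto Tot.base g l := tendsto_comap.mono_left inf_le_left
  have hgb : Tendsto τ g (𝓝 b₀) := tendsto_comap.mono_left inf_le_right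
  have hlg : l ≤ map Tot.base g := by
    intro S hS
    obtain ⟨S₁, ⟨L, hL, hLS⟩, S₂, ⟨N, hN, hNS⟩, hSS⟩ := mem_inf_iff.1 (mem_map.1 hS)
    have h1 : Tot.base '' N ∈ 𝓝 x₀ := isOpenMap_base.image_mem_nhds hN
    filter_upwards [hL, hp h1] with ω h2 h3
    obtain ⟨⟨y, c⟩, hc, hy⟩ := h3
    simp only at hy
    subst hy
    have : (⟨ω, c⟩ : Tot fun ω => B (p ω)) ∈ S₁ ∩ S₂ := ⟨hLS h2, hNS hc⟩
    rw [← hSS] at this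
    exact this
  have key : Tendsto (fun b : Tot (fun ω => B (p ω)) => ‖f b.base - b.vec‖) g (𝓝 0) := by
    rw [Metric.tendsto_nhds]
    intro ε hε
    obtain ⟨Ω', l', k, e, d, hpl, hd, he, hfe⟩ := H (ε / 2) (by positivity)
    let _ : TopologicalSpace (Tot (fun x => B x × B x)) := TopologicalSpace.induced
      (fun p : Tot (fun x => B x × B x) => ((⟨p.base, p.vec.1⟩, ⟨p.base, p.vec.2⟩) : Tot B × Tot B))
      inferInstance
    have h1 : ∀ᶠ q : Tot (fun x => B x × B x) in 𝓝 ⟨x₀, (f₀, d)⟩, ‖q.vec.1 - q.vec.2‖ < ε / 2 := by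
      refine eventually_norm_lt (p := fun q : Tot (fun x => B x × B x) => q.base)
        (a := fun q => q.vec.1 - q.vec.2) (x := x₀) (a₀ := f₀ - d) ?_ hd
      have hid : Tendsto (fun q : Tot (fun x => B x × B x) =>
          ((⟨q.base, q.vec.1⟩, ⟨q.base, q.vec.2⟩) : Tot B × Tot B)) (𝓝 ⟨x₀, (f₀, d)⟩)
          (𝓝 ((⟨x₀, f₀⟩, ⟨x₀, d⟩) : Tot B × Tot B)) := by
        rw [nhds_induced]; exact tendsto_comap
      exact tendsto_sub' ((continuous_fst.tendsto _).comp hid) ((continuous_snd.tendsto _).comp hid)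
    rw [nhds_induced, nhds_prod_eq] at h1
    obtain ⟨S, hS, hS'⟩ := h1
    obtain ⟨N₁, hN₁, N₂, hN₂, hN⟩ := mem_prod_iff.1 hS
    have h2 : ∀ᶠ ω in l, ∃ ω', k ω' = ω ∧ (⟨p (k ω'), e ω'⟩ : Tot B) ∈ N₂ ∧
        ‖f (k ω') - e ω'‖ < ε / 2 := by
      have h3 : {ω | (⟨p (k ω), e ω⟩ : Tot B) ∈ N₂ ∧ ‖f (k ω) - e ω‖ < ε / 2} ∈ l' :=
        (he.eventually hN₂).and hfe
      filter_upwards [hpl (image_mem_map h3)] with x hx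
      obtain ⟨ω, hω, rfl⟩ := hx
      exact ⟨ω, rfl, hω⟩
    filter_upwards [hgl.eventually h2, hgb.eventually hN₁] with b hb hbN
    obtain ⟨ω', hω, hω2, hω3⟩ := hb
    obtain ⟨ω, c⟩ := b
    simp only at hω
    subst hω
    have h4 : ‖c - e ω'‖ < ε / 2 :=
      hS' (show (⟨p (k ω'), (c, e ω')⟩ : Tot (fun x => B x × B x)) ∈ _ from hN ⟨hbN, hω2⟩)
    simp only [Real.dist_eq, sub_zero, abs_norm]
    calc ‖f (k ω') - c‖ = ‖(f (k ω') - e ω') - (c - e ω')‖ := by congr 1; abel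
      _ ≤ ‖f (k ω') - e ω'‖ + ‖c - e ω'‖ := norm_sub_le _ _
      _ < ε := by linarith
  have h5 := tendsto_zero' (B := B) (p := fun b : Tot (fun ω => B (p ω)) => p b.base)
    (a := fun b => f b.base - b.vec) (hp.comp hgl) key
  have h6 := tendsto_add' (p := fun b : Tot (fun ω => B (p ω)) => p b.base)
    (a := fun b => f b.base - b.vec) (b := fun b => b.vec) (x := x₀) (a₀ := 0) (b₀ := f₀) h5 hgb
  simp only [sub_add_cancel, zero_add] at h6
  exact Tendsto.mono_left (tendsto_map'_iff.2 h6) hlg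

/-- Inside one fibre, the topology of the total space is the norm topology. -/
theorem tendsto_fibre {Ω : Type*} {l : Filter Ω} {x : X} {a : Ω → B x} {a₀ : B x} :
    Tendsto (fun ω => (⟨x, a ω⟩ : Tot B)) l (𝓝 ⟨x, a₀⟩) ↔ Tendsto a l (𝓝 a₀) := by
  constructor
  · intro h
    rw [tendsto_iff_norm_sub_tendsto_zero, Metric.tendsto_nhds]
    intro ε hε
    have h1 := tendsto_sub' (p := fun _ : Ω => x) (b := fun _ => a₀) (b₀ := a₀) h tendsto_const_nhds
    have := eventually_norm_lt h1 (c := ε) (by simpa using hε)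
    simpa using this
  · intro h
    rw [tendsto_iff_norm_sub_tendsto_zero] at h
    have h1 := tendsto_zero' (B := B) (p := fun _ : Ω => x) (a := fun ω => a ω - a₀)
      tendsto_const_nhds h
    have h2 := tendsto_add' (p := fun _ : Ω => x) (b := fun _ => a₀) (b₀ := a₀) h1 tendsto_const_nhds
    simpa using h2

end Bundle

section Haar

variable {G : Type u} [TopologicalSpace G] [TopGroupoid G] [T2Space G] [LocallyCompactSpace G]
  [SecondCountableTopology G] [MeasurableSpace G] [BorelSpace G] (hs : HaarSystem G)

theorem isClosed_rgFibre (w : UnitSpace G) : IsClosed {x : G | rg x = w.1} :=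
  isClosed_eq continuous_rg continuous_const

theorem HaarSystem.ae_rg (w : UnitSpace G) : ∀ᵐ x ∂(hs.lam w), rg x = w.1 := by
  have := (Measure.support_mem_ae (μ := hs.lam w))
  rwa [hs.support_eq] at this

theorem HaarSystem.isFiniteMeasureOnCompacts (w : UnitSpace G) :
    IsFiniteMeasureOnCompacts (hs.lam w) := ⟨fun K hK => hs.lt_top_of_isCompact w K hK⟩

/-- The existence of a Haar system forces the range map to be open. -/
theorem HaarSystem.rgU_nhds (hs : HaarSystem G) (x₀ : G) {U : Set G} (hU : U ∈ 𝓝 x₀) : rgU '' U ∈ 𝓝 (rgU x₀) := by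
  obtain ⟨V, hVU, hV, hxV⟩ := mem_nhds_iff.1 hU
  obtain ⟨h, h1, h0, hc, hI⟩ := exists_continuous_one_zero_of_isCompact
    (isCompact_singleton (x := x₀)) hV.isClosed_compl
    (by simpa using hxV)
  have := hs.isFiniteMeasureOnCompacts
  have hcont := hs.continuous_integral h h.continuous hc
  have hpos : 0 < ∫ x, h x ∂(hs.lam (rgU x₀)) := by
    rw [integral_pos_iff_support_of_nonneg (fun x => (hI x).1)
      (h.continuous.integrable_of_hasCompactSupport hc)]
    have hx : x₀ ∈ (hs.lam (rgU x₀)).support := by rw [hs.support_eq]; rfl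
    rw [Measure.mem_support_iff_forall] at hx
    refine hx _ ((h.continuous.isOpen_support).mem_nhds ?_)
    have := h1 (Set.mem_singleton x₀)
    simp [this]
  filter_upwards [(hcont.tendsto (rgU x₀)).eventually (lt_mem_nhds hpos)] with w hw
  by_contra hcon
  have h2 : ∫ x, h x ∂(hs.lam w) = 0 := by
    refine integral_eq_zero_of_ae ?_
    filter_upwards [hs.ae_rg w] with x hx
    refine h0 (fun hxV' => hcon ⟨x, hVU hxV', Subtype.ext hx⟩)
  linarith

theorem HaarSystem.exists_bound (K : Set G) (hK : IsCompact K) :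
    ∃ C : ℝ≥0∞, C < ∞ ∧ ∀ w, hs.lam w K ≤ C := by
  obtain ⟨h, h1, -, hc, hI⟩ := exists_continuous_one_zero_of_isCompact
    hK (isClosed_empty (X := G)) (by simp)
  have := hs.isFiniteMeasureOnCompacts
  have hcont := hs.continuous_integral h h.continuous hc
  have hR : IsCompact (rgU '' tsupport h) := IsCompact.image hc continuous_rgU
  obtain ⟨C, hC⟩ := (hR.image hcont).bddAbove
  refine ⟨ENNReal.ofReal (max C 0), ENNReal.ofReal_lt_top, fun w => ?_⟩
  have h2 : hs.lam w K ≤ ENNReal.ofReal (∫ x, h x ∂(hs.lam w)) := by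
    rw [ofReal_integral_eq_lintegral_ofReal (h.continuous.integrable_of_hasCompactSupport hc)
      (ae_of_all _ fun x => (hI x).1), ← setLIntegral_one]
    refine (setLIntegral_mono' hK.measurableSet fun x hx => ?_).trans (setLIntegral_le_lintegral K _)
    simp [h1 hx]
  refine h2.trans (ENNReal.ofReal_le_ofReal ?_)
  by_cases hw : w ∈ rgU '' tsupport h
  · exact (hC ⟨w, hw, rfl⟩).trans (le_max_left _ _)
  · have h3 : ∫ x, h x ∂(hs.lam w) = 0 := by
      refine integral_eq_zero_of_ae ?_
      filter_upwards [hs.ae_rg w] with x hx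
      by_contra hne
      exact hw ⟨x, subset_tsupport _ hne, Subtype.ext hx⟩
    rw [h3]; exact le_max_right _ _

variable {B : G → Type v} [∀ x, NormedAddCommGroup (B x)] [∀ x, NormedSpace ℂ (B x)]
  [TopologicalSpace (Tot B)] [UscBanachBundle B]

/-- A field `F y z ∈ B z` with continuity on `{r y = r z}` and compact support in `y`. -/
structure IsCcField (F : ∀ _y z : G, B z) (K : Set G) : Prop where
  isCompact : IsCompact K
  zero_of_ne : ∀ y z, rg y ≠ rg z → F y z = 0
  zero_of_notMem : ∀ y z, y ∉ K → F y z = 0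
  cont : ∀ y₀ z₀, rg y₀ = rg z₀ → Tendsto (fun p : G × G => (⟨p.2, F p.1 p.2⟩ : Tot B))
    (𝓝 (y₀, z₀) ⊓ 𝓟 {p | rg p.1 = rg p.2}) (𝓝 ⟨z₀, F y₀ z₀⟩)

variable {F : ∀ _y z : G, B z} {K : Set G}

theorem IsCcField.continuousOn (hF : IsCcField F K) (z : G) :
    ContinuousOn (fun y => F y z) {y | rg y = rg z} := by
  intro y₀ hy₀
  rw [ContinuousWithinAt, ← tendsto_fibre (B := B)]
  refine (hF.cont y₀ z hy₀).comp (f := fun y => (y, z)) ?_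
  rw [tendsto_inf, tendsto_principal]
  refine ⟨?_, ?_⟩
  · exact (tendsto_nhdsWithin_of_tendsto_nhds tendsto_id).prodMk_nhds tendsto_const_nhds
  · exact eventually_mem_nhdsWithin

theorem IsCcField.integrable (hF : IsCcField F K) (z : G) :
    Integrable (fun y => F y z) (hs.lam (rgU z)) := by
  have := hs.isFiniteMeasureOnCompacts (rgU z)
  have hcl : IsClosed {y : G | rg y = rg z} := isClosed_rgFibre (rgU z)
  have hcomp : IsCompact (K ∩ {y : G | rg y = rg z}) := hF.isCompact.inter_right hcl
  have h1 : IntegrableOn (fun y => F y z) (K ∩ {y : G | rg y = rg z}) (hs.lam (rgU z)) :=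
    ((hF.continuousOn z).mono Set.inter_subset_right).integrableOn_compact hcomp
  refine (integrableOn_iff_integrable_of_support_subset ?_).1 h1
  intro y hy
  by_contra hcon
  rw [Set.mem_inter_iff, not_and_or] at hcon
  rcases hcon with h | h
  · exact hy (hF.zero_of_notMem _ _ h)
  · exact hy (hF.zero_of_ne _ _ h)

/-- Integrating such a field over the Haar system gives a continuous section. -/
theorem IsCcField.continuous_integral (hF : IsCcField F K) :
    Continuous (secMap fun z => ∫ y, F y z ∂(hs.lam (rgU z))) := by
  classical
  have hcomplete := fun z => UscBanachBundle.complete (B := B) z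
  rw [continuous_iff_continuousAt]
  intro z₀
  refine tendsto_of_approx (p := fun z : G => z) tendsto_id fun ε hε => ?_
  have hfin := hs.isFiniteMeasureOnCompacts
  obtain ⟨ψ, hψ1, -, hψc, hψI⟩ := exists_continuous_one_zero_of_isCompact
    hF.isCompact (isClosed_empty (X := G)) (by simp)
  have hψcont := hs.continuous_integral ψ ψ.continuous hψc
  have hψint : ∀ w, Integrable ψ (hs.lam w) := fun w =>
    ψ.continuous.integrable_of_hasCompactSupport hψc
  set M : ℝ := ∫ y, ψ y ∂(hs.lam (rgU z₀)) + 1 with hM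
  have hM0 : 0 < M := by
    have : 0 ≤ ∫ y, ψ y ∂(hs.lam (rgU z₀)) := integral_nonneg fun y => (hψI y).1
    linarith
  set δ : ℝ := ε / (2 * M) with hδ
  have hδ0 : 0 < δ := by positivity
  -- local estimates
  have hloc : ∀ y : G, ∃ U : Set G, IsOpen U ∧ y ∈ U ∧ ∃ N ∈ 𝓝 z₀,
      ((rg y ≠ rg z₀ → ∀ y₁ ∈ U, ∀ z ∈ N, rg y₁ ≠ rg z) ∧
      (rg y = rg z₀ → ∀ y₁ ∈ U, ∀ y₂ ∈ U, ∀ z ∈ N, rg y₁ = rg z → rg y₂ = rg z →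
        ‖F y₁ z - F y₂ z‖ < δ)) := by
    intro y
    by_cases hy : rg y = rg z₀
    · have h1 : Tendsto (fun p : (G × G) × G => (⟨p.2, F p.1.1 p.2 - F p.1.2 p.2⟩ : Tot B))
          (𝓝 ((y, y), z₀) ⊓ 𝓟 {p | rg p.1.1 = rg p.2 ∧ rg p.1.2 = rg p.2})
          (𝓝 ⟨z₀, F y z₀ - F y z₀⟩) := by
        refine tendsto_sub' (p := fun p : (G × G) × G => p.2) ?_ ?_
        · refine (hF.cont y z₀ hy).comp (f := fun p : (G × G) × G => (p.1.1, p.2)) ?_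
          refine tendsto_inf.2 ⟨?_, ?_⟩
          · exact ((Continuous.tendsto (by fun_prop) ((y, y), z₀))).mono_left inf_le_left
          · exact tendsto_principal.2 (mem_inf_of_right fun p hp => hp.1)
        · refine (hF.cont y z₀ hy).comp (f := fun p : (G × G) × G => (p.1.2, p.2)) ?_
          refine tendsto_inf.2 ⟨?_, ?_⟩
          · exact ((Continuous.tendsto (by fun_prop) ((y, y), z₀))).mono_left inf_le_left
          · exact tendsto_principal.2 (mem_inf_of_right fun p hp => hp.2)
      have h2 := eventually_norm_lt h1 (c := δ) (by simpa using hδ0)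
      rw [eventually_inf_principal, nhds_prod_eq, nhds_prod_eq] at h2
      obtain ⟨S, hS, N, hN, hSN⟩ := mem_prod_iff.1 h2
      obtain ⟨U₁, hU₁, U₂, hU₂, hU⟩ := mem_prod_iff.1 hS
      obtain ⟨U, hUs, hUo, hyU⟩ := mem_nhds_iff.1 (inter_mem hU₁ hU₂)
      refine ⟨U, hUo, hyU, N, hN, fun h => absurd hy h, fun _ y₁ hy₁ y₂ hy₂ z hz hr₁ hr₂ => ?_⟩
      exact hSN (show ((y₁, y₂), z) ∈ S ×ˢ N from ⟨hU ⟨(hUs hy₁).1, (hUs hy₂).2⟩, hz⟩) ⟨hr₁, hr₂⟩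
    · have h1 : ∀ᶠ p : G × G in 𝓝 (y, z₀), rg p.1 ≠ rg p.2 :=
        (isOpen_ne_fun (continuous_rg.comp continuous_fst)
          (continuous_rg.comp continuous_snd)).mem_nhds hy
      rw [nhds_prod_eq] at h1
      obtain ⟨U₁, hU₁, N, hN, hUN⟩ := mem_prod_iff.1 h1
      obtain ⟨U, hUs, hUo, hyU⟩ := mem_nhds_iff.1 hU₁
      refine ⟨U, hUo, hyU, N, hN, fun _ y₁ hy₁ z hz => ?_, fun h => absurd h hy⟩
      exact hUN (show (y₁, z) ∈ U₁ ×ˢ N from ⟨hUs hy₁, hz⟩)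
  choose U hUo hyU N hN hbad hgood using hloc
  obtain ⟨t, ht⟩ := (show IsCompact (tsupport ψ) from hψc).elim_finite_subcover U hUo
    (fun y _ => Set.mem_iUnion.2 ⟨y, hyU y⟩)
  set n := t.card
  let c : Fin n → G := fun i => (t.equivFin.symm i).1
  have hcov : tsupport ψ ⊆ ⋃ i, U (c i) := by
    intro y hy
    obtain ⟨j, hj⟩ := Set.mem_iUnion.1 (ht hy)
    obtain ⟨hjt, hj⟩ := Set.mem_iUnion.1 hj
    exact Set.mem_iUnion.2 ⟨t.equivFin ⟨j, hjt⟩, by simpa [c] using hj⟩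
  obtain ⟨h, hsub, hsum, hI, -⟩ := exists_continuous_sum_one_of_isOpen_isCompact
    (fun i => hUo (c i)) hψc hcov
  let I : Finset (Fin n) := Finset.univ.filter fun i => rg (c i) = rg z₀
  -- the weights
  let k : Fin n → G → ℝ := fun i y => h i y * ψ y
  have hkcont : ∀ i, Continuous (k i) := fun i => (h i).continuous.mul ψ.continuous
  have hkc : ∀ i, HasCompactSupport (k i) := fun i => hψc.mul_left
  have hkint : ∀ i w, Integrable (k i) (hs.lam w) := fun i w =>
    (hkcont i).integrable_of_hasCompactSupport (hkc i)
  have hk0 : ∀ i y, 0 ≤ k i y := fun i y => mul_nonneg (hI i y).1 (hψI y).1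
  have hksum : ∀ y, ∑ i, k i y = ψ y := by
    intro y
    by_cases hy : y ∈ tsupport ψ
    · have := hsum hy
      simp only [Finset.sum_apply, Pi.one_apply] at this
      simp only [k, ← Finset.sum_mul]
      rw [this, one_mul]
    · have : ψ y = 0 := image_eq_zero_of_notMem_tsupport hy
      simp [k, this]
  have hkU : ∀ i y, k i y ≠ 0 → y ∈ U (c i) := fun i y hy =>
    hsub i (subset_tsupport _ (left_ne_zero_of_mul hy))
  have hψF : ∀ y z, F y z = (ψ y) • F y z := by
    intro y z
    by_cases hy : y ∈ K
    · have := hψ1 hy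
      simp only [Pi.one_apply] at this
      rw [this, one_smul]
    · rw [hF.zero_of_notMem y z hy, smul_zero]
  -- the main estimate
  have main : ∀ (z : G) (y' : Fin n → G), (∀ i, z ∈ N (c i)) → (∀ i ∈ I, y' i ∈ U (c i)) →
      (∀ i ∈ I, rg (y' i) = rg z) → (∫ y, ψ y ∂(hs.lam (rgU z)) < M) →
      ‖(∫ y, F y z ∂(hs.lam (rgU z))) -
        ∑ i ∈ I, (((∫ y, k i y ∂(hs.lam (rgU z)) : ℝ) : ℂ)) • F (y' i) z‖ < ε := by
    intro z y' hzN hy'U hy'r hzM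
    have e1 : ∑ i ∈ I, (((∫ y, k i y ∂(hs.lam (rgU z)) : ℝ) : ℂ)) • F (y' i) z
        = ∫ y, ∑ i ∈ I, k i y • F (y' i) z ∂(hs.lam (rgU z)) := by
      rw [integral_finsetSum _ (fun i _ => (hkint i _).smul_const _)]
      refine Finset.sum_congr rfl fun i _ => ?_
      rw [integral_smul_const, Complex.coe_smul]
    have hint2 : Integrable (fun y => ∑ i ∈ I, k i y • F (y' i) z) (hs.lam (rgU z)) :=
      integrable_finsetSum _ (fun i _ => (hkint i _).smul_const _)
    rw [e1, ← integral_sub (hF.integrable hs z) hint2]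
    have bound : ∀ᵐ y ∂(hs.lam (rgU z)), ‖F y z - ∑ i ∈ I, k i y • F (y' i) z‖ ≤ δ * ψ y := by
      filter_upwards [hs.ae_rg (rgU z)] with y hy
      have hy : rg y = rg z := hy
      have e2 : F y z = ∑ i ∈ I, k i y • F y z := by
        conv_lhs => rw [hψF y z, ← hksum y, Finset.sum_smul]
        symm
        refine Finset.sum_subset (Finset.subset_univ _) fun i _ hi => ?_
        have : rg (c i) ≠ rg z₀ := fun h => hi (by simp [I, h])
        by_cases hki : k i y = 0
        · rw [hki, zero_smul]
        · exact absurd hy (hbad (c i) this y (hkU i y hki) z (hzN i))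
      conv_lhs => rw [e2, ← Finset.sum_sub_distrib]
      calc ‖∑ i ∈ I, (k i y • F y z - k i y • F (y' i) z)‖
          ≤ ∑ i ∈ I, ‖k i y • F y z - k i y • F (y' i) z‖ := norm_sum_le _ _
        _ ≤ ∑ i ∈ I, k i y * δ := by
            refine Finset.sum_le_sum fun i hi => ?_
            rw [← smul_sub, norm_smul, Real.norm_of_nonneg (hk0 i y)]
            by_cases hki : k i y = 0
            · rw [hki, zero_mul, zero_mul]
            · refine mul_le_mul_of_nonneg_left (le_of_lt ?_) (hk0 i y)
              exact hgood (c i) (by simpa [I] using hi) y (hkU i y hki) (y' i) (hy'U i hi) z (hzN i)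
                hy (hy'r i hi)
        _ ≤ ∑ i, k i y * δ := Finset.sum_le_sum_of_subset_of_nonneg (Finset.subset_univ _)
            fun i _ _ => mul_nonneg (hk0 i y) hδ0.le
        _ = δ * ψ y := by rw [← Finset.sum_mul, hksum, mul_comm]
    calc _ ≤ ∫ y, δ * ψ y ∂(hs.lam (rgU z)) :=
          norm_integral_le_of_norm_le ((hψint _).const_mul _) bound
      _ = δ * ∫ y, ψ y ∂(hs.lam (rgU z)) := integral_const_mul _ _
      _ ≤ δ * M := by gcongr
      _ = ε / 2 := by rw [hδ]; field_simp
      _ < ε := by linarith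
  -- the comparison filter
  let D : Set (G × (Fin n → G)) := {q | ∀ i ∈ I, rg (q.2 i) = rg q.1}
  let l : Filter (G × (Fin n → G)) := 𝓝 (z₀, c) ⊓ 𝓟 D
  have hIr : ∀ i ∈ I, rg (c i) = rg z₀ := fun i hi => by simpa [I] using hi
  have hl1 : Tendsto (fun q : G × (Fin n → G) => q.1) l (𝓝 z₀) :=
    (continuous_fst.tendsto (z₀, c)).mono_left inf_le_left
  have hl2 : ∀ i, Tendsto (fun q : G × (Fin n → G) => q.2 i) l (𝓝 (c i)) := fun i =>
    (((continuous_apply i).comp continuous_snd).tendsto (z₀, c)).mono_left inf_le_left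
  have hlD : ∀ᶠ q in l, q ∈ D := mem_inf_of_right (mem_principal_self D)
  have hrz : Tendsto (fun z : G => ∫ y, ψ y ∂(hs.lam (rgU z))) (𝓝 z₀)
      (𝓝 (∫ y, ψ y ∂(hs.lam (rgU z₀)))) := (hψcont.comp continuous_rgU).tendsto z₀
  refine ⟨G × (Fin n → G), l, fun q => q.1,
    fun q => ∑ i ∈ I, (((∫ y, k i y ∂(hs.lam (rgU q.1)) : ℝ) : ℂ)) • F (q.2 i) q.1,
    ∑ i ∈ I, (((∫ y, k i y ∂(hs.lam (rgU z₀)) : ℝ) : ℂ)) • F (c i) z₀, ?_, ?_, ?_, ?_⟩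
  · intro S hS
    rw [mem_map, mem_inf_principal, nhds_prod_eq] at hS
    obtain ⟨S₁, hS₁, S₂, hS₂, hS12⟩ := mem_prod_iff.1 hS
    rw [nhds_pi] at hS₂
    obtain ⟨J, hJ, T, hT, hTS⟩ := Filter.mem_pi.1 hS₂
    have h1 : ∀ᶠ z in 𝓝 z₀, ∀ i ∈ I, rgU z ∈ rgU '' (T i) := by
      rw [Filter.eventually_all_finset]
      intro i hi
      have : rgU (c i) = rgU z₀ := Subtype.ext (hIr i hi)
      refine continuous_rgU.continuousAt.eventually ?_
      rw [← this]
      exact hs.rgU_nhds (c i) (hT i)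
    filter_upwards [hS₁, h1] with z hz1 hz2
    have : Nonempty G := ⟨z⟩
    choose! y' hy' using hz2
    let y'' : Fin n → G := fun i => if i ∈ I then y' i else c i
    have hmem : (z, y'') ∈ S₁ ×ˢ S₂ := by
      refine ⟨hz1, hTS fun i _ => ?_⟩
      by_cases hi : i ∈ I
      · simpa [y'', hi] using (hy' i hi).1
      · simpa [y'', hi] using mem_of_mem_nhds (hT i)
    refine hS12 hmem (fun i hi => ?_)
    have h5 : rg (y' i) = rg z := congrArg Subtype.val (hy' i hi).2
    simpa [y'', hi] using h5
  · exact main z₀ c (fun i => mem_of_mem_nhds (hN _)) (fun i _ => hyU _) hIr (by rw [hM]; linarith)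
  · refine tendsto_sum' I (p := fun q : G × (Fin n → G) => q.1) hl1 fun i hi => ?_
    refine tendsto_smul' (p := fun q : G × (Fin n → G) => q.1) ?_ ?_
    · refine (Complex.continuous_ofReal.tendsto _).comp ?_
      exact (((hs.continuous_integral (k i) (hkcont i) (hkc i)).comp continuous_rgU).tendsto
        z₀).comp hl1
    · refine (hF.cont (c i) z₀ (hIr i hi)).comp (f := fun q : G × (Fin n → G) => (q.2 i, q.1)) ?_
      refine tendsto_inf.2 ⟨(hl2 i).prodMk_nhds hl1, tendsto_principal.2 ?_⟩
      filter_upwards [hlD] with q hq using hq i hi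
  · have a1 : ∀ᶠ q in l, ∀ i, q.1 ∈ N (c i) :=
      eventually_all.2 fun i => hl1.eventually (hN (c i))
    have a2 : ∀ᶠ q in l, ∀ i, q.2 i ∈ U (c i) :=
      eventually_all.2 fun i => (hl2 i).eventually ((hUo (c i)).mem_nhds (hyU _))
    have a3 : ∀ᶠ q in l, ∫ y, ψ y ∂(hs.lam (rgU q.1)) < M :=
      (hrz.comp hl1).eventually (gt_mem_nhds (by rw [hM]; linarith))
    filter_upwards [a1, a2, a3, hlD] with q b1 b2 b3 b4
    exact main q.1 q.2 b1 (fun i _ => b2 i) b4 b3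

end Haar

section Sections

variable {X : Type u} [TopologicalSpace X] (B : X → Type v)
    [∀ x, NormedAddCommGroup (B x)] [∀ x, NormedSpace ℂ (B x)] [TopologicalSpace (Tot B)]
    [UscBanachBundle B]

/-- The space of continuous compactly supported sections, inside the space of all sections. -/
def gcSubmodule : Submodule ℂ (∀ x, B x) where
  carrier := {f | Continuous (secMap f) ∧ ∃ K, IsCompact K ∧ ∀ x, x ∉ K → f x = 0}
  zero_mem' := by
    refine ⟨continuous_iff_continuousAt.2 fun x => ?_, ∅, isCompact_empty, fun _ _ => rfl⟩
    exact tendsto_zero' (B := B) (p := fun x => x) (a := fun x => 0) tendsto_id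
      (by simp)
  add_mem' := by
    rintro f g ⟨hf, K, hK, hfK⟩ ⟨hg, L, hL, hgL⟩
    refine ⟨continuous_iff_continuousAt.2 fun x => ?_, K ∪ L, hK.union hL, fun x hx => ?_⟩
    · exact tendsto_add' (p := fun x => x) (a := f) (b := g) (hf.tendsto x) (hg.tendsto x)
    · rw [Set.mem_union, not_or] at hx
      simp [hfK x hx.1, hgL x hx.2]
  smul_mem' := by
    rintro c f ⟨hf, K, hK, hfK⟩
    refine ⟨continuous_iff_continuousAt.2 fun x => ?_, K, hK, fun x hx => ?_⟩
    · exact tendsto_smul' (p := fun x => x) (c := fun _ => c) (a := f) tendsto_const_nhds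
        (hf.tendsto x)
    · simp [hfK x hx]

/-- `Γ_c(X; B)`, the vector space of continuous compactly supported sections (without topology). -/
def Gc : Type (max u v) := ↥(gcSubmodule B)

noncomputable instance : AddCommGroup (Gc B) := inferInstanceAs (AddCommGroup ↥(gcSubmodule B))
noncomputable instance : Module ℂ (Gc B) := inferInstanceAs (Module ℂ ↥(gcSubmodule B))
instance : CoeFun (Gc B) (fun _ => ∀ x, B x) := ⟨fun f => f.1⟩

/-- `f` is a continuous section vanishing at infinity. -/
def IsC0Section (f : ∀ x, B x) : Prop :=
  Continuous (secMap f) ∧ Tendsto (fun x => ‖f x‖) (cocompact X) (𝓝 0)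

/-- The Banach space `Γ₀(X; B)` is separable in the supremum norm. -/
def IsSeparableBundle : Prop :=
  ∃ e : ℕ → ∀ x, B x, (∀ n, IsC0Section B (e n)) ∧
    ∀ f : ∀ x, B x, IsC0Section B f → ∀ ε > 0, ∃ n, ∀ x, ‖f x - e n x‖ ≤ ε

variable {B}

@[ext] theorem Gc.ext {f g : Gc B} (h : ∀ x, f x = g x) : f = g := Subtype.ext (funext h)
@[simp] theorem Gc.add_apply (f g : Gc B) (x : X) : (f + g) x = f x + g x := rfl
@[simp] theorem Gc.smul_apply (c : ℂ) (f : Gc B) (x : X) : (c • f) x = c • f x := rfl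
@[simp] theorem Gc.zero_apply (x : X) : (0 : Gc B) x = 0 := rfl

theorem Gc.exists_bound (f : Gc B) : ∃ C : ℝ, 0 ≤ C ∧ ∀ x, ‖f x‖ ≤ C := by
  obtain ⟨f, hf, K, hK, hfK⟩ := f
  have husc : UpperSemicontinuousOn (fun x => ‖f x‖) K :=
    (UpperSemicontinuous.comp (usc_norm (B := B)) hf).upperSemicontinuousOn K
  obtain ⟨C, hC⟩ := husc.bddAbove_of_isCompact hK
  refine ⟨max C 0, le_max_right _ _, fun x => ?_⟩
  by_cases hx : x ∈ K
  · exact (hC ⟨x, hx, rfl⟩).trans (le_max_left _ _)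
  · simp [hfK x hx]

end Sections

section Fell

variable {G : Type u} [TopologicalSpace G] [TopGroupoid G]
variable {B : G → Type v} [∀ x, NormedAddCommGroup (B x)] [∀ x, NormedSpace ℂ (B x)]
  [TopologicalSpace (Tot B)] [FellBundle B]

theorem tot_bmul {x y z : G} (h : IsMul x y z) (a : B x) (b : B y) :
    (⟨z, bmul h a b⟩ : Tot B) = ⟨gmul x y, bmul ⟨h.1, rfl⟩ a b⟩ := by
  obtain ⟨h1, rfl⟩ := h; rfl

theorem tot_bstar {x y : G} (h : y = ginv x) (a : B x) :
    (⟨y, bstar h a⟩ : Tot B) = ⟨ginv x, bstar rfl a⟩ := by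
  subst h; rfl

theorem bmul_congr {x y z y' : G} (h : IsMul x y z) (h' : IsMul x y' z) (a : B x) (f : ∀ x, B x)
    (e : y = y') : bmul h a (f y) = bmul h' a (f y') := by subst e; rfl

theorem tendsto_bmul {Ω : Type*} {l : Filter Ω} {p q m : Ω → G} {a : ∀ ω, B (p ω)}
    {b : ∀ ω, B (q ω)} {x y z : G} {a₀ : B x} {b₀ : B y}
    (ha : Tendsto (fun ω => (⟨p ω, a ω⟩ : Tot B)) l (𝓝 ⟨x, a₀⟩))
    (hb : Tendsto (fun ω => (⟨q ω, b ω⟩ : Tot B)) l (𝓝 ⟨y, b₀⟩))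
    (h : ∀ ω, IsMul (p ω) (q ω) (m ω)) (h₀ : IsMul x y z) :
    Tendsto (fun ω => (⟨m ω, bmul (h ω) (a ω) (b ω)⟩ : Tot B)) l (𝓝 ⟨z, bmul h₀ a₀ b₀⟩) := by
  simp only [tot_bmul]
  let P := {p : Tot B × Tot B // sr p.1.base = rg p.2.base}
  refine ((continuous_bmul (B := B)).tendsto (⟨(⟨x, a₀⟩, ⟨y, b₀⟩), h₀.1⟩ : P)).comp
    (f := fun ω => (⟨(⟨p ω, a ω⟩, ⟨q ω, b ω⟩), (h ω).1⟩ : P)) ?_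
  exact tendsto_subtype_rng.2 (ha.prodMk_nhds hb)

theorem tendsto_bstar {Ω : Type*} {l : Filter Ω} {p q : Ω → G} {a : ∀ ω, B (p ω)} {x y : G}
    {a₀ : B x} (ha : Tendsto (fun ω => (⟨p ω, a ω⟩ : Tot B)) l (𝓝 ⟨x, a₀⟩))
    (h : ∀ ω, q ω = ginv (p ω)) (h₀ : y = ginv x) :
    Tendsto (fun ω => (⟨q ω, bstar (h ω) (a ω)⟩ : Tot B)) l (𝓝 ⟨y, bstar h₀ a₀⟩) := by
  simp only [tot_bstar]
  exact ((continuous_bstar (B := B)).tendsto (⟨x, a₀⟩ : Tot B)).comp ha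

/-- The involution `f*(x) = f(x⁻¹)*` on `Γ_c(G; B)`. -/
noncomputable def Gc.adj (f : Gc B) : Gc B :=
  ⟨fun x => bstar (ginv_ginv x).symm (f (ginv x)), by
    obtain ⟨f, hf, K, hK, hfK⟩ := f
    refine ⟨continuous_iff_continuousAt.2 fun x => ?_, ginv '' K, hK.image continuous_ginv,
      fun x hx => ?_⟩
    · exact tendsto_bstar (p := fun x => ginv x) (a := fun x => f (ginv x))
        ((hf.comp continuous_ginv).tendsto x) _ _
    · have : f (ginv x) = 0 := hfK _ fun h => hx ⟨_, h, ginv_ginv x⟩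
      simp [this]⟩

variable [T2Space G] [LocallyCompactSpace G]
  [SecondCountableTopology G] [MeasurableSpace G] [BorelSpace G] (hs : HaarSystem G)

open Classical in
/-- The integrand `y ↦ f(y) g(y⁻¹z)` of the convolution product; it is only defined for
`r(y) = r(z)`, and extended by `0`. -/
noncomputable def convField (f g : ∀ x, B x) (y z : G) : B z :=
  if h : rg y = rg z then bmul (isMul_ginv_gmul h) (f y) (g (gmul (ginv y) z)) else 0

theorem Gc.isCcField (f g : Gc B) : ∃ K, IsCcField (B := B) (convField f.1 g.1) K := by
  classical
  obtain ⟨f, hf, K, hK, hfK⟩ := f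
  obtain ⟨g, hg, L, hL, hgL⟩ := g
  refine ⟨K, hK, fun y z h => by simp [convField, h], fun y z hy => ?_, fun y₀ z₀ h₀ => ?_⟩
  · by_cases h : rg y = rg z
    · simp [convField, h, hfK y hy]
    · simp [convField, h]
  · rw [← nhdsWithin, tendsto_nhdsWithin_iff_subtype
      (show (y₀, z₀) ∈ {p : G × G | rg p.1 = rg p.2} from h₀)]
    have hD : ∀ ω : {p : G × G | rg p.1 = rg p.2}, rg ω.1.1 = rg ω.1.2 := fun ω => ω.2
    have e : ({p : G × G | rg p.1 = rg p.2}.domRestrict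
        fun p : G × G => (⟨p.2, convField f g p.1 p.2⟩ : Tot B)) = fun ω =>
        ⟨ω.1.2, bmul (isMul_ginv_gmul (hD ω)) (f ω.1.1) (g (gmul (ginv ω.1.1) ω.1.2))⟩ := by
      funext ω
      simp only [Set.domRestrict_apply, convField, dif_pos (hD ω)]
    have e₀ : convField f g y₀ z₀ = bmul (isMul_ginv_gmul h₀) (f y₀) (g (gmul (ginv y₀) z₀)) := by
      simp only [convField, dif_pos h₀]
    rw [e, e₀]
    have hc : Continuous fun ω : {p : G × G | rg p.1 = rg p.2} => gmul (ginv ω.1.1) ω.1.2 :=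
      continuousOn_gmul.comp_continuous
        (f := fun ω : {p : G × G | rg p.1 = rg p.2} => (ginv ω.1.1, ω.1.2))
        ((continuous_ginv.comp (continuous_fst.comp continuous_subtype_val)).prodMk
          (continuous_snd.comp continuous_subtype_val))
        (fun ω => by simp [sr_ginv, hD ω])
    refine tendsto_bmul
      (p := fun ω : {p : G × G | rg p.1 = rg p.2} => ω.1.1)
      (q := fun ω : {p : G × G | rg p.1 = rg p.2} => gmul (ginv ω.1.1) ω.1.2)
      (m := fun ω : {p : G × G | rg p.1 = rg p.2} => ω.1.2) ?_ ?_ _ _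
    · exact (hf.comp (continuous_fst.comp continuous_subtype_val)).tendsto
        (⟨(y₀, z₀), h₀⟩ : {p : G × G | rg p.1 = rg p.2})
    · exact (hg.comp hc).tendsto (⟨(y₀, z₀), h₀⟩ : {p : G × G | rg p.1 = rg p.2})

/-- The convolution product `(f * g)(z) = ∫ f(y) g(y⁻¹z) dλ^{r(z)}(y)` on `Γ_c(G; B)`. -/
noncomputable def Gc.conv (f g : Gc B) : Gc B :=
  ⟨fun z => ∫ y, convField f.1 g.1 y z ∂(hs.lam (rgU z)), by
    obtain ⟨K', hF⟩ := Gc.isCcField f g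
    refine ⟨hF.continuous_integral hs, ?_⟩
    obtain ⟨f, hf, K, hK, hfK⟩ := f
    obtain ⟨g, hg, L, hL, hgL⟩ := g
    refine ⟨(fun p : G × G => gmul p.1 p.2) '' ((K ×ˢ L) ∩ {p | sr p.1 = rg p.2}), ?_, ?_⟩
    · refine IsCompact.image_of_continuousOn ((hK.prod hL).inter_right ?_)
        (continuousOn_gmul.mono Set.inter_subset_right)
      exact isClosed_eq (continuous_sr.comp continuous_fst) (continuous_rg.comp continuous_snd)
    · intro z hz
      refine integral_eq_zero_of_ae (ae_of_all _ fun y => ?_)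
      by_cases h : rg y = rg z
      · simp only [convField, dif_pos h, Pi.zero_apply]
        have hm := isMul_ginv_gmul h
        by_cases hy : y ∈ K
        · have : g (gmul (ginv y) z) = 0 := by
            refine hgL _ fun hcon => hz ⟨(y, gmul (ginv y) z), ⟨⟨hy, hcon⟩, hm.1⟩, hm.2⟩
          simp [this]
        · simp [hfK y hy]
      · simp [convField, h]⟩

end Fell

section Units

variable {G : Type u} [TopologicalSpace G] [TopGroupoid G]
variable {B : G → Type v} [∀ x, NormedAddCommGroup (B x)] [∀ x, NormedSpace ℂ (B x)]
  [TopologicalSpace (Tot B)] [FellBundle B]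

variable (B) in
/-- The fibre `A_w = B w` over a unit, as a C⋆-algebra. -/
def UFib (w : UnitSpace G) : Type v := B w.1

section UFibInstance

/-- The vector space structure and the norm of `A_w`. -/
@[reducible] def UFib.normedGroup (w : UnitSpace G) : NormedAddCommGroup (UFib B w) :=
  inferInstanceAs (NormedAddCommGroup (B w.1))

attribute [local instance] UFib.normedGroup

/-- The scalar multiplication of `A_w`. -/
@[reducible] def UFib.normedSpace (w : UnitSpace G) : NormedSpace ℂ (UFib B w) :=
  inferInstanceAs (NormedSpace ℂ (B w.1))

attribute [local instance] UFib.normedSpace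

noncomputable instance (w : UnitSpace G) : Mul (UFib B w) := ⟨fun a b => bmul (isMul_unit w) a b⟩
noncomputable instance (w : UnitSpace G) : Star (UFib B w) :=
  ⟨fun a => bstar (ginv_unit w).symm a⟩

theorem UFib.mul_def {w : UnitSpace G} (a b : UFib B w) : a * b = bmul (isMul_unit w) a b := rfl
theorem UFib.star_def {w : UnitSpace G} (a : UFib B w) : star a = bstar (ginv_unit w).symm a := rfl

theorem norm_bstar_bmul {x y z : G} (h : IsMul y x z) (h' : y = ginv x) (a : B x) :
    ‖bmul h (bstar h' a) a‖ = ‖a‖ ^ 2 := by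
  subst h'
  have hz : z = sr x := by rw [← h.2, ginv_gmul]
  subst hz
  exact norm_bstar_bmul_self x a

noncomputable instance (w : UnitSpace G) : NonUnitalCStarAlgebra (UFib B w) where
  __ := UFib.normedGroup w
  __ := UFib.normedSpace w
  mul := (· * ·)
  left_distrib a b c := by
    simp only [UFib.mul_def]; exact map_add (bmul (isMul_unit w) (a : B w.1)) (b : B w.1) c
  right_distrib a b c := by
    simp only [UFib.mul_def]
    exact LinearMap.map_add₂ (bmul (B := B) (isMul_unit w)) a b c
  zero_mul a := LinearMap.map_zero₂ (bmul (B := B) (isMul_unit w)) a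
  mul_zero a := map_zero (bmul (B := B) (isMul_unit w) a)
  mul_assoc a b c := bmul_assoc (B := B) _ _ _ _ a b c
  norm_mul_le a b := norm_bmul_le (B := B) _ a b
  dist_eq := dist_eq_norm_neg_add
  star := star
  star_involutive a := bstar_bstar (B := B) _ _ a
  star_mul a b := bstar_bmul (B := B) _ _ _ _ _ a b
  star_add a b := map_add (bstar (B := B) (ginv_unit w).symm) a b
  complete := (UscBanachBundle.complete (B := B) w.1).complete
  norm_mul_self_le a := by
    rw [← sq]; exact (norm_bstar_bmul (B := B) (isMul_unit w) (ginv_unit w).symm a).ge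
  smul_assoc c a b := LinearMap.map_smul₂ (bmul (B := B) (isMul_unit w)) c a b
  smul_comm c a b := (map_smul (bmul (B := B) (isMul_unit w) a) c b).symm
  star_smul c a := LinearMap.map_smulₛₗ (bstar (B := B) (ginv_unit w).symm) c a

end UFibInstance

end Units

section Fell

variable {G : Type u} [TopologicalSpace G] [TopGroupoid G]
variable {B : G → Type v} [∀ x, NormedAddCommGroup (B x)] [∀ x, NormedSpace ℂ (B x)]
  [TopologicalSpace (Tot B)] [FellBundle B]

variable (B) in
/-- The C⋆-algebra `A = Γ₀(G⁰; B)` of sections over the unit space that vanish at infinity, inside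
the C⋆-algebra of all bounded families `(a w)`. -/
noncomputable def unitSubalgebra :
    NonUnitalStarSubalgebra ℂ (lp (fun w : UnitSpace G => UFib B w) ∞) where
  carrier := {a | Continuous (fun w : UnitSpace G => (⟨w.1, a w⟩ : Tot B)) ∧
    Tendsto (fun w => ‖a w‖) (cocompact (UnitSpace G)) (𝓝 0)}
  zero_mem' := by
    refine ⟨continuous_iff_continuousAt.2 fun w => ?_, ?_⟩
    · exact tendsto_zero' (B := B) (p := fun w : UnitSpace G => w.1) (a := fun w => 0)
        (continuous_subtype_val.tendsto w) (by simp)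
    · simpa using tendsto_const_nhds
  add_mem' := by
    rintro a b ⟨ha, ha'⟩ ⟨hb, hb'⟩
    refine ⟨continuous_iff_continuousAt.2 fun w => ?_, ?_⟩
    · exact tendsto_add' (p := fun w : UnitSpace G => w.1) (a := a) (b := b)
        (ha.tendsto w) (hb.tendsto w)
    · exact squeeze_zero (fun w => norm_nonneg _) (fun w => norm_add_le _ _)
        (by simpa using ha'.add hb')
  smul_mem' := by
    rintro c a ⟨ha, ha'⟩
    refine ⟨continuous_iff_continuousAt.2 fun w => ?_, ?_⟩
    · exact tendsto_smul' (p := fun w : UnitSpace G => w.1) (c := fun _ => c) (a := a)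
        tendsto_const_nhds (ha.tendsto w)
    · simpa [norm_smul] using ha'.const_mul ‖c‖
  mul_mem' := by
    rintro a b ⟨ha, ha'⟩ ⟨hb, hb'⟩
    refine ⟨continuous_iff_continuousAt.2 fun w => ?_, ?_⟩
    · exact tendsto_bmul (p := fun w : UnitSpace G => w.1) (q := fun w : UnitSpace G => w.1)
        (a := a) (b := b) (ha.tendsto w) (hb.tendsto w) (fun w => isMul_unit w) (isMul_unit w)
    · exact squeeze_zero (fun w => norm_nonneg _) (fun w => norm_mul_le _ _)
        (by simpa using ha'.mul hb')
  star_mem' := by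
    rintro a ⟨ha, ha'⟩
    refine ⟨continuous_iff_continuousAt.2 fun w => ?_, ?_⟩
    · exact tendsto_bstar (p := fun w : UnitSpace G => w.1)
        (a := a) (ha.tendsto w) (fun w => (ginv_unit w).symm) (ginv_unit w).symm
    · simpa using ha'

theorem isClosed_unitSubalgebra : IsClosed (unitSubalgebra B : Set (lp (UFib B) ∞)) := by
  refine isClosed_of_closure_subset fun a ha => ?_
  rw [Metric.mem_closure_iff] at ha
  have happrox : ∀ ε > 0, ∃ b ∈ unitSubalgebra B, ∀ w, ‖a w - b w‖ < ε := by
    intro ε hε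
    obtain ⟨b, hb, hab⟩ := ha ε hε
    refine ⟨b, hb, fun w => lt_of_le_of_lt ?_ hab⟩
    rw [dist_eq_norm]
    exact lp.norm_apply_le_norm ENNReal.top_ne_zero (a - b) w
  refine ⟨continuous_iff_continuousAt.2 fun w₀ => ?_, ?_⟩
  · refine tendsto_of_approx (p := fun w : UnitSpace G => w.1) (f := a)
      (continuous_subtype_val.tendsto w₀) fun ε hε => ?_
    obtain ⟨b, hb, hab⟩ := happrox ε hε
    exact ⟨UnitSpace G, 𝓝 w₀, id, b, b w₀, by simp, hab w₀, hb.1.tendsto w₀,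
      Eventually.of_forall hab⟩
  · rw [Metric.tendsto_nhds]
    intro ε hε
    obtain ⟨b, hb, hab⟩ := happrox (ε / 2) (by positivity)
    filter_upwards [(Metric.tendsto_nhds.1 hb.2) (ε / 2) (by positivity)] with w hw
    simp only [Real.dist_eq, sub_zero, abs_norm] at hw ⊢
    calc ‖a w‖ = ‖(a w - b w) + b w‖ := by rw [sub_add_cancel]
      _ ≤ ‖a w - b w‖ + ‖b w‖ := norm_add_le _ _
      _ < ε := by linarith [hab w]

variable (B) in
/-- The C⋆-algebra `A = Γ₀(G⁰; B)` of the Fell bundle `B` over `G⁰`. -/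
def UnitAlg : Type (max u v) := ↥(unitSubalgebra B)

noncomputable instance : NonUnitalCStarAlgebra (UnitAlg B) :=
  haveI : IsClosed (unitSubalgebra B : Set (lp (UFib B) ∞)) := isClosed_unitSubalgebra
  inferInstanceAs (NonUnitalCStarAlgebra ↥(unitSubalgebra B))

noncomputable instance : PartialOrder (UnitAlg B) := CStarAlgebra.spectralOrder _
instance : StarOrderedRing (UnitAlg B) := CStarAlgebra.spectralOrderedRing _

/-- The value of `a ∈ A` at a unit. -/
def UnitAlg.val (a : UnitAlg B) (w : UnitSpace G) : UFib B w := (Subtype.val a : lp (UFib B) ∞) w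

theorem UnitAlg.ext {a b : UnitAlg B} (h : ∀ w, a.val w = b.val w) : a = b :=
  Subtype.ext (lp.ext (funext h))

theorem UnitAlg.norm_val_le (a : UnitAlg B) (w : UnitSpace G) : ‖a.val w‖ ≤ ‖a‖ :=
  lp.norm_apply_le_norm ENNReal.top_ne_zero (Subtype.val a : lp (UFib B) ∞) w

/-- Evaluation at a unit. -/
def UnitAlg.evalHom (w : UnitSpace G) : UnitAlg B →⋆ₙₐ[ℂ] UFib B w where
  toFun a := a.val w
  map_smul' _ _ := rfl
  map_zero' := rfl
  map_add' _ _ := rfl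
  map_mul' _ _ := rfl
  map_star' _ := rfl

theorem UnitAlg.continuous_val (a : UnitAlg B) :
    Continuous (fun w : UnitSpace G => (⟨w.1, a.val w⟩ : Tot B)) := a.2.1

/-- An element of `A` is positive as soon as all its values are. -/
theorem UnitAlg.nonneg_of_val (a : UnitAlg B) (h : ∀ w, ∃ c : UFib B w, a.val w = star c * c) :
    0 ≤ a := by
  have hsa : IsSelfAdjoint a := by
    refine UnitAlg.ext fun w => ?_
    obtain ⟨c, hc⟩ := h w
    change star (a.val w) = a.val w
    rw [hc, star_mul, star_star]
  have hneg : a⁻ = 0 := by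
    refine UnitAlg.ext fun w => ?_
    let _ : PartialOrder (UFib B w) := CStarAlgebra.spectralOrder _
    have _ : StarOrderedRing (UFib B w) := CStarAlgebra.spectralOrderedRing _
    have h1 : 0 ≤ a.val w := by
      obtain ⟨c, hc⟩ := h w
      rw [hc]; exact star_mul_self_nonneg c
    have hcont : Continuous (UnitAlg.evalHom (B := B) w) := by
      refine AddMonoidHomClass.continuous_of_bound (UnitAlg.evalHom (B := B) w) 1 fun a => ?_
      rw [one_mul]; exact a.norm_val_le w
    have h2 : UnitAlg.evalHom w (a⁻) = (UnitAlg.evalHom w a)⁻ := by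
      rw [CFC.negPart_def, CFC.negPart_def]
      exact NonUnitalStarAlgHomClass.map_cfcₙ (S := ℂ) (R := ℝ) (UnitAlg.evalHom (B := B) w) _ a
        (by fun_prop) (by simp) hcont
    change UnitAlg.evalHom w (a⁻) = UnitAlg.evalHom w 0
    rw [h2, map_zero]
    exact (CFC.negPart_eq_zero_iff _ (hsa.map (UnitAlg.evalHom w))).2 h1
  exact (CFC.negPart_eq_zero_iff a hsa).1 hneg

end Fell

section InnerProduct

variable {G : Type u} [TopologicalSpace G] [TopGroupoid G]
variable {B : G → Type v} [∀ x, NormedAddCommGroup (B x)] [∀ x, NormedSpace ℂ (B x)]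
  [TopologicalSpace (Tot B)] [FellBundle B]

theorem isMul_ginv_unit {y : G} {w : UnitSpace G} (h : sr y = w.1) : IsMul (ginv y) y w.1 :=
  ⟨sr_ginv y, by rw [ginv_gmul, h]⟩

open Classical in
/-- The integrand `y ↦ f(y)* g(y)` of the inner product; it is only defined for `s(y) = w`, and
extended by `0`. -/
noncomputable def ipField (f g : ∀ x, B x) (w : UnitSpace G) (y : G) : UFib B w :=
  if h : sr y = w.1 then bmul (isMul_ginv_unit h) (bstar rfl (f y)) (g y) else (0 : B w.1)

theorem ipField_pos (f g : ∀ x, B x) {w : UnitSpace G} {y : G} (h : sr y = w.1) :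
    ipField f g w y = bmul (isMul_ginv_unit h) (bstar rfl (f y)) (g y) := dif_pos h

theorem ipField_neg (f g : ∀ x, B x) {w : UnitSpace G} {y : G} (h : ¬ sr y = w.1) :
    ipField f g w y = 0 := dif_neg h

theorem bmul_bstar_congr {p x x' y y' z : G} (a : B p) (g : ∀ x, B x) (hx : x = ginv p)
    (hx' : x' = ginv p) (h : IsMul x y z) (h' : IsMul x' y' z) (e : y = y') :
    bmul h (bstar hx a) (g y) = bmul h' (bstar hx' a) (g y') := by
  subst e; subst hx; subst hx'; rfl

/-- The inner product integrand is positive. -/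
theorem ipField_self (f : ∀ x, B x) (w : UnitSpace G) (y : G) :
    ∃ c : UFib B w, ipField f f w y = star c * c := by
  by_cases h : sr y = w.1
  · obtain ⟨w, hw⟩ := w
    simp only at h
    subst h
    obtain ⟨c, hc⟩ := bstar_bmul_self_pos (B := B) y (f y)
    refine ⟨c, ?_⟩
    exact (ipField_pos f f (w := ⟨sr y, hw⟩) rfl).trans hc
  · exact ⟨0, by rw [ipField_neg f f h, mul_zero]⟩

theorem ipField_star (f g : ∀ x, B x) (w : UnitSpace G) (y : G) :
    star (ipField f g w y) = ipField g f w y := by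
  by_cases h : sr y = w.1
  · rw [ipField_pos f g h, ipField_pos g f h]
    refine (bstar_bmul (B := B) (isMul_ginv_unit h) (ginv_ginv y).symm rfl
      (ginv_unit w).symm (isMul_ginv_unit h) (bstar rfl (f y)) (g y)).trans ?_
    rw [bstar_bstar]
  · rw [ipField_neg f g h, ipField_neg g f h, star_zero]

/-- The right action `(f · a)(z) = f(z) a(s(z))` of `A` on `Γ_c(G; B)`. -/
noncomputable def Gc.act (f : Gc B) (a : UnitAlg B) : Gc B :=
  ⟨fun z => bmul (isMul_self_sr z) (f z) (a.val (srU z) : B (srU z).1), by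
    obtain ⟨f, hf, K, hK, hfK⟩ := f
    refine ⟨continuous_iff_continuousAt.2 fun z => ?_, K, hK, fun z hz =>
      (congrArg (fun t => bmul (isMul_self_sr z) t (a.val (srU z) : B (srU z).1)) (hfK z hz)).trans
        (LinearMap.map_zero₂ _ _)⟩
    have hsr : Continuous (srU : G → UnitSpace G) := continuous_sr.subtype_mk _
    exact tendsto_bmul (p := fun z : G => z) (q := fun z : G => (srU z).1)
      (a := f) (b := fun z => a.val (srU z)) (hf.tendsto z)
      ((a.continuous_val.comp hsr).tendsto z) _ (isMul_self_sr z)⟩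

theorem ipField_act (f g : Gc B) (a : UnitAlg B) (w : UnitSpace G) (y : G) :
    ipField f.1 (g.act a).1 w y = ipField f.1 g.1 w y * a.val w := by
  by_cases h : sr y = w.1
  · obtain ⟨w, hw⟩ := w
    simp only at h
    subst h
    rw [ipField_pos f.1 (g.act a).1 (w := ⟨sr y, hw⟩) rfl,
      ipField_pos f.1 g.1 (w := ⟨sr y, hw⟩) rfl]
    exact (bmul_assoc (B := B) _ _ _ _ _ _ _).symm
  · rw [ipField_neg f.1 _ h, ipField_neg f.1 _ h, zero_mul]

theorem ipField_add (f g h : ∀ x, B x) (w : UnitSpace G) (y : G) :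
    ipField f (g + h) w y = ipField f g w y + ipField f h w y := by
  by_cases hy : sr y = w.1
  · rw [ipField_pos _ _ hy, ipField_pos _ _ hy, ipField_pos _ _ hy, Pi.add_apply, map_add]; rfl
  · rw [ipField_neg _ _ hy, ipField_neg _ _ hy, ipField_neg _ _ hy, add_zero]

theorem ipField_smul (c : ℂ) (f g : ∀ x, B x) (w : UnitSpace G) (y : G) :
    ipField f (c • g) w y = c • ipField f g w y := by
  by_cases hy : sr y = w.1
  · rw [ipField_pos _ _ hy, ipField_pos _ _ hy, Pi.smul_apply, map_smul]; rfl
  · rw [ipField_neg _ _ hy, ipField_neg _ _ hy, smul_zero]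

variable [T2Space G] [LocallyCompactSpace G]
  [SecondCountableTopology G] [MeasurableSpace G] [BorelSpace G] (hs : HaarSystem G)

theorem ipField_ginv (f g : Gc B) (w : UnitSpace G) (y : G) :
    ipField f.1 g.1 w (ginv y) = convField f.adj.1 g.1 y w.1 := by
  by_cases h : rg y = w.1
  · have h1 : rg y = rg w.1 := by rw [h, w.2]
    have h2 : sr (ginv y) = w.1 := by rw [sr_ginv, h]
    have h3 : gmul (ginv y) w.1 = ginv y := by rw [← h2, gmul_sr_self]
    rw [ipField_pos _ _ h2]
    simp only [convField, dif_pos h1, Gc.adj]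
    exact bmul_bstar_congr (f.1 (ginv y)) g.1 _ _ _ _ h3.symm
  · have h1 : ¬ rg y = rg w.1 := by rwa [w.2]
    have h2 : ¬ sr (ginv y) = w.1 := by rwa [sr_ginv]
    rw [ipField_neg _ _ h2]
    simp only [convField, dif_neg h1]
    rfl

theorem rgU_val (w : UnitSpace G) : rgU w.1 = w := Subtype.ext w.2

/-- Inversion as a homeomorphism. -/
def ginvEquivH (G : Type u) [TopologicalSpace G] [TopGroupoid G] : G ≃ₜ G :=
  { toFun := ginv, invFun := ginv, left_inv := ginv_ginv, right_inv := ginv_ginv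
    continuous_toFun := continuous_ginv, continuous_invFun := continuous_ginv }

/-- Inversion as a measurable equivalence. -/
def ginvEquiv (G : Type u) [TopologicalSpace G] [TopGroupoid G] [MeasurableSpace G]
    [BorelSpace G] : G ≃ᵐ G :=
  Homeomorph.toMeasurableEquiv
    { toFun := ginv, invFun := ginv, left_inv := ginv_ginv, right_inv := ginv_ginv
      continuous_toFun := continuous_ginv, continuous_invFun := continuous_ginv }

theorem integrable_ipField (f g : Gc B) (w : UnitSpace G) :
    Integrable (ipField f.1 g.1 w) (hs.lamInv w) := by
  obtain ⟨K, hF⟩ := Gc.isCcField f.adj g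
  have h1 := hF.integrable hs w.1
  rw [rgU_val] at h1
  rw [HaarSystem.lamInv]
  refine (integrable_map_equiv (ginvEquiv G) _).2 ?_
  have e : (ipField f.1 g.1 w ∘ (ginvEquiv G)) = fun y => convField f.adj.1 g.1 y w.1 :=
    funext fun y => ipField_ginv f g w y
  rw [e]
  exact h1

theorem integral_ipField (f g : Gc B) (w : UnitSpace G) :
    ∫ y, ipField f.1 g.1 w y ∂(hs.lamInv w) = (f.adj.conv hs g) w.1 := by
  have e : ∫ y, ipField f.1 g.1 w y ∂(hs.lamInv w)
      = ∫ y, ipField f.1 g.1 w (ginv y) ∂(hs.lam w) :=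
    integral_map_equiv (ginvEquiv G) _
  rw [e]
  simp only [ipField_ginv, Gc.conv, rgU_val]
  rfl

/-- The `A`-valued inner product `⟨f, g⟩(w) = ∫ f(y)* g(y) dλ_w(y)` on `Γ_c(G; B)`. -/
noncomputable def Gc.ip (f g : Gc B) : UnitAlg B :=
  ⟨⟨fun w => ∫ y, ipField f.1 g.1 w y ∂(hs.lamInv w), by
      obtain ⟨C, -, hC⟩ := Gc.exists_bound (f.adj.conv hs g)
      refine memℓp_infty ⟨C, ?_⟩
      rintro _ ⟨w, rfl⟩
      simp only [integral_ipField]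
      exact hC w.1⟩, by
    obtain ⟨hc, K, hK, hK0⟩ := (f.adj.conv hs g).2
    refine ⟨?_, ?_⟩
    · simp only [integral_ipField]
      exact hc.comp continuous_subtype_val
    · have hcl : IsClosedEmbedding (Subtype.val : UnitSpace G → G) :=
        (isClosed_eq continuous_rg continuous_id).isClosedEmbedding_subtypeVal
      refine Tendsto.congr' ?_ tendsto_const_nhds
      filter_upwards [(hcl.isCompact_preimage hK).compl_mem_cocompact] with w hw
      simp only [integral_ipField]
      have := hK0 w.1 hw
      have h2 : (f.adj.conv hs g) w.1 = 0 := this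
      rw [h2]
      exact (norm_zero (E := B w.1)).symm⟩

theorem Gc.ip_val (f g : Gc B) (w : UnitSpace G) :
    (f.ip hs g).val w = ∫ y, ipField f.1 g.1 w y ∂(hs.lamInv w) := rfl

theorem Gc.ip_add (f g h : Gc B) : f.ip hs (g + h) = f.ip hs g + f.ip hs h := by
  refine UnitAlg.ext fun w => ?_
  change _ = (f.ip hs g).val w + (f.ip hs h).val w
  rw [Gc.ip_val, Gc.ip_val, Gc.ip_val,
    ← integral_add (integrable_ipField hs f g w) (integrable_ipField hs f h w)]
  exact integral_congr_ae (ae_of_all _ fun y => ipField_add _ _ _ _ _)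

theorem Gc.ip_smul (c : ℂ) (f g : Gc B) : f.ip hs (c • g) = c • f.ip hs g := by
  refine UnitAlg.ext fun w => ?_
  change _ = c • (f.ip hs g).val w
  rw [Gc.ip_val, Gc.ip_val, ← integral_smul]
  exact integral_congr_ae (ae_of_all _ fun y => ipField_smul _ _ _ _ _)

theorem Gc.ip_act (f g : Gc B) (a : UnitAlg B) : f.ip hs (g.act a) = f.ip hs g * a := by
  refine UnitAlg.ext fun w => ?_
  change _ = (f.ip hs g).val w * a.val w
  rw [Gc.ip_val, Gc.ip_val]
  have h := ((ContinuousLinearMap.mul ℂ (UFib B w)).flip (a.val w)).integral_comp_comm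
    (integrable_ipField hs f g w)
  rw [ContinuousLinearMap.flip_apply, ContinuousLinearMap.mul_apply'] at h
  rw [← h]
  exact integral_congr_ae (ae_of_all _ fun y => ipField_act _ _ _ _ _)

theorem Gc.star_ip (f g : Gc B) : star (f.ip hs g) = g.ip hs f := by
  refine UnitAlg.ext fun w => ?_
  change star ((f.ip hs g).val w) = _
  rw [Gc.ip_val, Gc.ip_val]
  have h := (starL' ℝ (A := UFib B w)).integral_comp_comm (μ := hs.lamInv w) (ipField f.1 g.1 w)
  simp only [starL'_apply] at h
  rw [← h]
  exact integral_congr_ae (ae_of_all _ fun y => ipField_star _ _ _ _)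

theorem Gc.ip_nonneg (f : Gc B) : 0 ≤ f.ip hs f := by
  refine UnitAlg.nonneg_of_val _ fun w => ?_
  let _ : PartialOrder (UFib B w) := CStarAlgebra.spectralOrder _
  have _ : StarOrderedRing (UFib B w) := CStarAlgebra.spectralOrderedRing _
  have h : 0 ≤ (f.ip hs f).val w := by
    rw [Gc.ip_val]
    refine integral_nonneg fun y => ?_
    obtain ⟨c, hc⟩ := ipField_self f.1 w y
    rw [hc]
    exact star_mul_self_nonneg c
  exact CStarAlgebra.nonneg_iff_eq_star_mul_self.1 h

theorem Gc.eq_zero_of_ip (f : Gc B) (h0 : f.ip hs f = 0) : f = 0 := by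
  refine Gc.ext fun y₀ => ?_
  set w : UnitSpace G := srU y₀ with hw
  let _ : PartialOrder (UFib B w) := CStarAlgebra.spectralOrder _
  have _ : StarOrderedRing (UFib B w) := CStarAlgebra.spectralOrderedRing _
  have hnn : ∀ y, 0 ≤ ipField f.1 f.1 w y := fun y => by
    obtain ⟨c, hc⟩ := ipField_self f.1 w y
    rw [hc]
    exact star_mul_self_nonneg c
  have hint : ∫ y, ipField f.1 f.1 w y ∂(hs.lamInv w) = 0 := by
    rw [← Gc.ip_val, h0]; rfl
  have hae : ipField f.1 f.1 w =ᵐ[hs.lamInv w] 0 := by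
    refine Integrable.ae_eq_zero_of_forall_setIntegral_eq_zero (integrable_ipField hs f f w) ?_
    intro s _ _
    refine le_antisymm ?_ (integral_nonneg hnn)
    rw [← hint]
    exact setIntegral_le_integral (integrable_ipField hs f f w) (ae_of_all _ hnn)
  obtain ⟨K, hF⟩ := Gc.isCcField f.adj f
  have hae' : ∀ᵐ y ∂(hs.lam w), convField f.adj.1 f.1 y w.1 = 0 := by
    have : ∀ᵐ y ∂(hs.lam w), ipField f.1 f.1 w (ginv y) = 0 :=
      ae_of_ae_map (ginvEquiv G).measurable.aemeasurable hae
    filter_upwards [this] with y hy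
    rw [← ipField_ginv]; exact hy
  have hr : rg (ginv y₀) = rg w.1 := by rw [rg_ginv, w.2]; rfl
  have hz : convField f.adj.1 f.1 (ginv y₀) w.1 = 0 := by
    by_contra hne
    have h1 := (hF.continuousOn w.1) (ginv y₀) hr
    have h2 : ∀ᶠ y in 𝓝[{y | rg y = rg w.1}] (ginv y₀), convField f.adj.1 f.1 y w.1 ≠ 0 :=
      h1.eventually_ne hne
    rw [eventually_nhdsWithin_iff] at h2
    have hsupp : ginv y₀ ∈ (hs.lam w).support := by
      rw [hs.support_eq]; exact hr.trans w.2
    have h3 := ((Measure.mem_support_iff_forall _).1 hsupp) _ h2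
    have h4 : ∀ᵐ y ∂(hs.lam w), ¬ (y ∈ {y | rg y = rg w.1} → convField f.adj.1 f.1 y w.1 ≠ 0) := by
      filter_upwards [hae', hs.ae_rg w] with y hy1 hy2 hcon
      exact hcon (hy2.trans w.2.symm) hy1
    rw [ae_iff] at h4
    simp only [not_not] at h4
    exact h3.ne' h4
  rw [← ipField_ginv, ginv_ginv] at hz
  have hsr : sr y₀ = w.1 := rfl
  rw [ipField_pos _ _ hsr] at hz
  have hn := norm_bstar_bmul (B := B) (isMul_ginv_unit hsr) rfl (f.1 y₀)
  have hz' : bmul (B := B) (isMul_ginv_unit hsr) (bstar rfl (f.1 y₀)) (f.1 y₀) = 0 := hz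
  rw [hz', norm_zero] at hn
  exact norm_eq_zero.1 (pow_eq_zero_iff two_ne_zero |>.1 hn.symm)

end InnerProduct

section HilbertModules

/-- (Right) pre-Hilbert modules over a C⋆-algebra `A`, with inner product `ip` (linear in the second
variable) and right action `act`. -/
class PreHilbertModule (A : Type*) (E : Type*) [NonUnitalCStarAlgebra A] [PartialOrder A]
    [AddCommGroup E] [Module ℂ E] where
  /-- the inner product -/
  ip : E → E → A
  /-- the right action -/
  act : E → A → E
  ip_add : ∀ x y z, ip x (y + z) = ip x y + ip x z
  ip_smul : ∀ (c : ℂ) x y, ip x (c • y) = c • ip x y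
  ip_act : ∀ x y a, ip x (act y a) = ip x y * a
  star_ip : ∀ x y, star (ip x y) = ip y x
  ip_nonneg : ∀ x, 0 ≤ ip x x
  ip_definite : ∀ x, ip x x = 0 → x = 0

/-- Pre-Hilbert modules, with the norm `‖x‖ = ‖⟨x, x⟩‖ ^ (1/2)`. A Hilbert module is one that is
complete. -/
class HilbertModule (A : Type*) (E : Type*) [NonUnitalCStarAlgebra A] [PartialOrder A]
    [NormedAddCommGroup E] [NormedSpace ℂ E] extends PreHilbertModule A E where
  norm_sq_eq : ∀ x : E, ‖x‖ ^ 2 = ‖ip x x‖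

open PreHilbertModule HilbertModule

section Pre

variable {A E : Type*} [NonUnitalCStarAlgebra A] [PartialOrder A]
    [AddCommGroup E] [Module ℂ E] [PreHilbertModule A E]

/-- The inner product as a sesquilinear map. -/
def ipL : E →ₗ⋆[ℂ] E →ₗ[ℂ] A where
  toFun x :=
    { toFun := fun y => ip x y
      map_add' := fun y z => ip_add x y z
      map_smul' := fun c y => ip_smul c x y }
  map_add' x y := by
    ext z
    change (ip (x + y) z : A) = ip x z + ip y z
    rw [← star_ip z (x + y), ip_add, star_add, star_ip, star_ip]
  map_smul' c x := by
    ext z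
    change (ip (c • x) z : A) = star c • ip x z
    rw [← star_ip z (c • x), ip_smul, star_smul, star_ip]

theorem ipL_apply (x y : E) : (ipL x y : A) = ip x y := rfl

theorem ip_add_left (x y z : E) : (ip (x + y) z : A) = ip x z + ip y z :=
  LinearMap.map_add₂ (ipL (A := A)) x y z

theorem ip_smul_left (c : ℂ) (x z : E) : (ip (c • x) z : A) = star c • ip x z :=
  LinearMap.map_smulₛₗ₂ (ipL (A := A)) c x z

theorem ip_act_left (x z : E) (a : A) : (ip (act x a) z : A) = star a * ip x z := by
  rw [← star_ip, ip_act, star_mul, star_ip]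

theorem ip_sub_right (x y z : E) : (ip x (y - z) : A) = ip x y - ip x z :=
  map_sub (ipL (A := A) x) y z

theorem ip_sub_left (x y z : E) : (ip (x - y) z : A) = ip x z - ip y z :=
  LinearMap.map_sub₂ (ipL (A := A)) x y z

variable [StarOrderedRing A]

/-- The Cauchy-Schwarz inequality in `A`. -/
theorem ip_cauchy_schwarz (x y : E) :
    star (ip x y : A) * ip x y ≤ ‖(ip x x : A)‖ • ip y y := by
  set N : ℝ := ‖(ip x x : A)‖ with hN
  set a : A := ip x y with ha
  rcases (norm_nonneg (ip x x : A)).eq_or_lt with h0 | h0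
  · have hx : x = 0 := ip_definite (A := A) x (norm_eq_zero.1 h0.symm)
    have : a = 0 := by
      rw [ha, hx]; exact LinearMap.map_zero₂ (ipL (A := A)) y
    rw [this, mul_zero]
    exact smul_nonneg (norm_nonneg _) (ip_nonneg y)
  have h1 : 0 ≤ (ip (act x a - (N : ℂ) • y) (act x a - (N : ℂ) • y) : A) := ip_nonneg _
  have h2 : (ip (act x a - (N : ℂ) • y) (act x a - (N : ℂ) • y) : A) =
      star a * ip x x * a - N • (star a * a) - N • (star a * a) + N • (N • ip y y) := by
    have h3 : (ip y x : A) = star a := (star_ip x y).symm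
    simp only [ip_sub_left, ip_sub_right, ip_act, ip_act_left, ip_smul, ip_smul_left, ← ha, h3,
      RCLike.star_def, Complex.conj_ofReal]
    simp only [Complex.coe_smul, smul_sub, sub_mul, smul_mul_assoc]
    abel
  have h4 : star a * ip x x * a ≤ N • (star a * a) :=
    CStarAlgebra.star_left_conjugate_le_norm_smul (star_ip x x)
  rw [h2] at h1
  have h5 : 0 ≤ N • (N • ip y y - star a * a) := by
    rw [smul_sub]
    calc (0 : A) ≤ _ := h1
      _ ≤ N • (star a * a) - N • (star a * a) - N • (star a * a) + N • (N • ip y y) := by gcongr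
      _ = _ := by abel
  have h6 := smul_nonneg (inv_nonneg.2 h0.le) h5
  rw [← hN, smul_smul, inv_mul_cancel₀ h0.ne', one_smul] at h6
  exact sub_nonneg.1 h6

theorem norm_ip_sq_le (x y : E) :
    ‖(ip x y : A)‖ ^ 2 ≤ ‖(ip x x : A)‖ * ‖(ip y y : A)‖ := by
  have h := CStarAlgebra.norm_le_norm_of_nonneg_of_le (star_mul_self_nonneg _)
    (ip_cauchy_schwarz (A := A) x y)
  rw [CStarRing.norm_star_mul_self, norm_smul, norm_norm] at h
  rwa [sq]

variable (A E) in
/-- The norm of a pre-Hilbert module. -/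
theorem PreHilbertModule.core :
    @NormedSpace.Core ℂ E _ _ _ ⟨fun x => √‖(ip x x : A)‖⟩ := by
  let _ : Norm E := ⟨fun x => √‖(ip x x : A)‖⟩
  have hdef : ∀ x : E, ‖x‖ = √‖(ip x x : A)‖ := fun _ => rfl
  refine { norm_nonneg := ?_, norm_smul := ?_, norm_triangle := ?_, norm_eq_zero_iff := ?_ }
  · exact fun x => Real.sqrt_nonneg _
  · intro c x
    rw [hdef, hdef, ip_smul, ip_smul_left, norm_smul, norm_smul, norm_star, ← mul_assoc,
      Real.sqrt_mul (by positivity), Real.sqrt_mul_self (norm_nonneg _)]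
  · intro x y
    rw [hdef, hdef, hdef]
    refine Real.sqrt_le_iff.2 ⟨by positivity, ?_⟩
    have h1 : ‖(ip x y : A)‖ ≤ √‖(ip x x : A)‖ * √‖(ip y y : A)‖ := by
      rw [← Real.sqrt_mul (norm_nonneg _)]
      exact Real.le_sqrt_of_sq_le (norm_ip_sq_le x y)
    have h2 : ‖(ip y x : A)‖ = ‖(ip x y : A)‖ := by rw [← star_ip x y, norm_star]
    calc ‖(ip (x + y) (x + y) : A)‖ = ‖(ip x x + ip y x : A) + (ip x y + ip y y)‖ := by
          rw [ip_add, ip_add_left, ip_add_left]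
      _ ≤ (‖(ip x x : A)‖ + ‖(ip y x : A)‖) + (‖(ip x y : A)‖ + ‖(ip y y : A)‖) :=
          (norm_add_le _ _).trans (add_le_add (norm_add_le _ _) (norm_add_le _ _))
      _ ≤ (√‖(ip x x : A)‖ + √‖(ip y y : A)‖) ^ 2 := by
          rw [add_sq, Real.sq_sqrt (norm_nonneg _), Real.sq_sqrt (norm_nonneg _), h2]
          linarith
  · intro x
    rw [hdef, Real.sqrt_eq_zero (norm_nonneg _), norm_eq_zero]
    refine ⟨ip_definite x, ?_⟩
    rintro rfl
    exact map_zero (ipL (A := A) (0 : E))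

end Pre

section Normed

variable {A E : Type*} [NonUnitalCStarAlgebra A] [PartialOrder A] [StarOrderedRing A]
    [NormedAddCommGroup E] [NormedSpace ℂ E] [HilbertModule A E]

theorem norm_ip_le (x y : E) : ‖(ip x y : A)‖ ≤ ‖x‖ * ‖y‖ := by
  have h := norm_ip_sq_le (A := A) x y
  rw [← norm_sq_eq, ← norm_sq_eq, ← mul_pow] at h
  exact (pow_le_pow_iff_left₀ (norm_nonneg _) (by positivity) two_ne_zero).1 h

theorem continuous_ip : Continuous fun p : E × E => (ip p.1 p.2 : A) := by
  have h : Continuous fun p : E × E =>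
      (LinearMap.mkContinuous₂ (ipL (A := A) (E := E)) 1
        fun x y => by rw [one_mul]; exact norm_ip_le x y) p.1 p.2 := by fun_prop
  exact h

theorem norm_act_le (x : E) (a : A) : ‖act x a‖ ≤ ‖a‖ * ‖x‖ := by
  refine (pow_le_pow_iff_left₀ (norm_nonneg _) (by positivity) two_ne_zero).1 ?_
  rw [norm_sq_eq (A := A), ip_act, ip_act_left, mul_pow, norm_sq_eq (A := A) x]
  calc ‖star a * (ip x x : A) * a‖ ≤ ‖star a‖ * ‖(ip x x : A)‖ * ‖a‖ :=
        (norm_mul_le _ _).trans (by gcongr; exact norm_mul_le _ _)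
    _ = ‖a‖ ^ 2 * ‖(ip x x : A)‖ := by rw [norm_star]; ring

theorem ext_ip {x y : E} (h : ∀ z : E, (ip z x : A) = ip z y) : x = y := by
  rw [← sub_eq_zero]
  refine ip_definite (A := A) _ ?_
  rw [ip_sub_right, h, sub_self]

variable (E) in
/-- The action of a fixed `a ∈ A` as a bounded linear map. -/
noncomputable def actL (a : A) : E →L[ℂ] E :=
  LinearMap.mkContinuous
    { toFun := fun x => act x a
      map_add' := fun x y => ext_ip (A := A) fun z => by
        rw [ip_act, ip_add, ip_add, ip_act, ip_act, add_mul]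
      map_smul' := fun c x => ext_ip (A := A) fun z => by
        rw [ip_act, ip_smul, RingHom.id_apply, ip_smul, ip_act, smul_mul_assoc] }
    ‖a‖ fun x => norm_act_le x a

open UniformSpace

variable (A E) in
/-- The extension of the inner product to the completion. -/
noncomputable def ipCompl : Completion E → Completion E → A := Function.curry
  ((Completion.isDenseInducing_coe.prodMap Completion.isDenseInducing_coe).extend
    fun p : E × E => (ip p.1 p.2 : A))

theorem ipCompl_coe (x y : E) : ipCompl A E x y = ip x y :=
  (Completion.isDenseInducing_coe.prodMap Completion.isDenseInducing_coe).extend_eq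
    (continuous_ip (A := A) (E := E)) (x, y)

theorem continuous_ipCompl :
    Continuous fun p : Completion E × Completion E => ipCompl A E p.1 p.2 := by
  let φ : E →+ E →+ A :=
    { toFun := fun x => (ipL (A := A) x).toAddMonoidHom
      map_zero' := by ext y; exact LinearMap.map_zero₂ (ipL (A := A)) y
      map_add' := fun x x' => by ext y; exact ip_add_left x x' y }
  have h : Continuous fun p : E × E => φ p.1 p.2 := continuous_ip
  exact (Completion.isDenseInducing_toCompl E).extend_Z_bilin
    (Completion.isDenseInducing_toCompl E) h

theorem continuous_ipCompl' {Ω : Type*} [TopologicalSpace Ω] {f g : Ω → Completion E}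
    (hf : Continuous f) (hg : Continuous g) : Continuous fun ω => ipCompl A E (f ω) (g ω) :=
  continuous_ipCompl.comp (hf.prodMk hg)

theorem norm_sq_ipCompl (x : Completion E) : ‖x‖ ^ 2 = ‖ipCompl A E x x‖ := by
  induction x using Completion.induction_on with
  | hp => exact isClosed_eq (by fun_prop) (continuous_ipCompl' continuous_id continuous_id).norm
  | ih x => rw [ipCompl_coe, Completion.norm_coe, norm_sq_eq (A := A)]

theorem actL_apply (a : A) (x : E) : actL E a x = act x a := rfl

theorem ipCompl_act (x y : Completion E) (a : A) :
    ipCompl A E x ((actL E a).completion y) = ipCompl A E x y * a := by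
  induction x, y using Completion.induction_on₂ with
  | hp =>
    have h : Continuous ((actL E a).completion) := (actL E a).completion.continuous
    exact isClosed_eq (continuous_ipCompl' continuous_fst (h.comp continuous_snd))
      ((continuous_ipCompl' continuous_fst continuous_snd).mul continuous_const)
  | ih x y =>
    rw [ContinuousLinearMap.completion_apply_coe, actL_apply, ipCompl_coe, ipCompl_coe, ip_act]

theorem ipCompl_smul (c : ℂ) (x y : Completion E) :
    ipCompl A E x (c • y) = c • ipCompl A E x y := by
  induction x, y using Completion.induction_on₂ with
  | hp =>
    have h : Continuous fun y : Completion E => c • y := continuous_const_smul c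
    have h2 : Continuous fun a : A => c • a := continuous_const_smul c
    exact isClosed_eq (continuous_ipCompl' continuous_fst (h.comp continuous_snd))
      (h2.comp (continuous_ipCompl' continuous_fst continuous_snd))
  | ih x y => rw [← Completion.coe_smul, ipCompl_coe, ipCompl_coe, ip_smul]

/-- The completion of a pre-Hilbert module is a Hilbert module. -/
noncomputable instance : HilbertModule A (Completion E) where
  ip := ipCompl A E
  act x a := (actL E a).completion x
  ip_add x y z := by
    induction x, y, z using Completion.induction_on₃ with
    | hp =>
      refine isClosed_eq (continuous_ipCompl' ?_ ?_)
        ((continuous_ipCompl' ?_ ?_).add (continuous_ipCompl' ?_ ?_)) <;> fun_prop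
    | ih x y z => rw [← Completion.coe_add, ipCompl_coe, ipCompl_coe, ipCompl_coe, ip_add]
  ip_smul c x y := ipCompl_smul c x y
  ip_act x y a := ipCompl_act x y a
  star_ip x y := by
    induction x, y using Completion.induction_on₂ with
    | hp =>
      refine isClosed_eq (continuous_ipCompl' ?_ ?_).star
        (continuous_ipCompl' ?_ ?_) <;> fun_prop
    | ih x y => rw [ipCompl_coe, ipCompl_coe, star_ip]
  ip_nonneg x := by
    induction x using Completion.induction_on with
    | hp =>
      exact CStarAlgebra.isClosed_nonneg.preimage (continuous_ipCompl' continuous_id continuous_id)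
    | ih x => rw [ipCompl_coe]; exact ip_nonneg x
  ip_definite x h := by
    have := norm_sq_ipCompl (A := A) x
    rw [h, norm_zero] at this
    exact norm_eq_zero.1 (pow_eq_zero_iff two_ne_zero |>.1 this)
  norm_sq_eq := norm_sq_ipCompl

theorem ip_coe (x y : E) : (ip (x : Completion E) (y : Completion E) : A) = ip x y :=
  ipCompl_coe x y

end Normed

end HilbertModules

open PreHilbertModule HilbertModule
section Adjointable

variable (A E : Type*) [NonUnitalCStarAlgebra A] [PartialOrder A] [StarOrderedRing A]
    [NormedAddCommGroup E] [NormedSpace ℂ E] [HilbertModule A E]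

/-- The algebra of adjointable operators, inside the bounded operators on `E`. -/
def adjointable : Subalgebra ℂ (E →L[ℂ] E) where
  carrier := {T | ∃ S : E →L[ℂ] E, ∀ x y, (ip (T x) y : A) = ip x (S y)}
  mul_mem' := by
    rintro T T' ⟨S, hS⟩ ⟨S', hS'⟩
    exact ⟨S' * S, fun x y => by
      rw [mul_apply_eq_comp, hS, hS', mul_apply_eq_comp]⟩
  add_mem' := by
    rintro T T' ⟨S, hS⟩ ⟨S', hS'⟩
    exact ⟨S + S', fun x y => by
      rw [_root_.add_apply, _root_.add_apply, ip_add, ip_add_left, hS,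
        hS']⟩
  algebraMap_mem' c := ⟨star c • ContinuousLinearMap.id ℂ E, fun x y => by
    rw [Algebra.algebraMap_eq_smul_one, _root_.smul_apply,
      _root_.smul_apply, one_apply_eq_self, ContinuousLinearMap.id_apply,
      ip_smul, ip_smul_left]⟩

/-- The C⋆-algebra `L(E)` of adjointable operators on the Hilbert module `E`, with the operator
norm. -/
def Adjointable : Type _ := ↥(adjointable A E)

noncomputable instance : NormedRing (Adjointable A E) :=
  inferInstanceAs (NormedRing ↥(adjointable A E))

noncomputable instance : NormedAlgebra ℂ (Adjointable A E) :=
  inferInstanceAs (NormedAlgebra ℂ ↥(adjointable A E))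

variable {A E}

instance : CoeFun (Adjointable A E) fun _ => E → E := ⟨fun T => T.1⟩

theorem Adjointable.ext {S T : Adjointable A E} (h : ∀ x, S x = T x) : S = T :=
  Subtype.ext (ContinuousLinearMap.ext h)

theorem Adjointable.norm_def (T : Adjointable A E) : ‖T‖ = ‖T.1‖ := rfl

theorem Adjointable.norm_apply_le (T : Adjointable A E) (x : E) : ‖T x‖ ≤ ‖T‖ * ‖x‖ :=
  T.1.le_opNorm x

theorem Adjointable.mul_apply (S T : Adjointable A E) (x : E) : (S * T) x = S (T x) := rfl
theorem Adjointable.one_apply (x : E) : (1 : Adjointable A E) x = x := rfl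
theorem Adjointable.add_apply (S T : Adjointable A E) (x : E) : (S + T) x = S x + T x := rfl
theorem Adjointable.smul_apply (c : ℂ) (T : Adjointable A E) (x : E) : (c • T) x = c • T x := rfl

/-- The adjoint. -/
noncomputable instance : Star (Adjointable A E) where
  star T := ⟨T.2.choose, T.1, fun x y => by
    rw [← star_ip, ← T.2.choose_spec, star_ip]⟩

theorem Adjointable.ip_star (T : Adjointable A E) (x y : E) :
    (ip (T x) y : A) = ip x ((star T) y) := T.2.choose_spec x y

theorem Adjointable.star_ip (T : Adjointable A E) (x y : E) :
    (ip ((star T) x) y : A) = ip x (T y) := by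
  rw [← PreHilbertModule.star_ip, ← T.ip_star, PreHilbertModule.star_ip]

theorem Adjointable.eq_star {S T : Adjointable A E}
    (h : ∀ x y : E, (ip (T x) y : A) = ip x (S y)) : star T = S :=
  Adjointable.ext fun y => ext_ip (A := A) fun x => by rw [← h, T.ip_star]

noncomputable instance : StarRing (Adjointable A E) where
  star_involutive T := Adjointable.eq_star T.star_ip
  star_mul S T := Adjointable.eq_star fun x y => by
    rw [Adjointable.mul_apply, Adjointable.mul_apply, S.ip_star, T.ip_star]
  star_add S T := Adjointable.eq_star fun x y => by
    rw [Adjointable.add_apply, Adjointable.add_apply, ip_add, ip_add_left, S.ip_star, T.ip_star]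

instance : StarModule ℂ (Adjointable A E) where
  star_smul c T := Adjointable.eq_star fun x y => by
    rw [Adjointable.smul_apply, Adjointable.smul_apply, ip_smul, ip_smul_left, T.ip_star]

instance : CStarRing (Adjointable A E) where
  norm_mul_self_le T := by
    have h : ‖T‖ ≤ √‖star T * T‖ := by
      refine ContinuousLinearMap.opNorm_le_bound _ (Real.sqrt_nonneg _) fun x => ?_
      refine (pow_le_pow_iff_left₀ (norm_nonneg _) (by positivity) two_ne_zero).1 ?_
      rw [mul_pow, Real.sq_sqrt (norm_nonneg _), norm_sq_eq (A := A)]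
      change ‖(ip (T x) (T x) : A)‖ ≤ _
      rw [T.ip_star, ← Adjointable.mul_apply]
      calc ‖(ip x ((star T * T) x) : A)‖ ≤ ‖x‖ * ‖(star T * T) x‖ := norm_ip_le _ _
        _ ≤ ‖x‖ * (‖star T * T‖ * ‖x‖) := by
            gcongr; exact Adjointable.norm_apply_le _ _
        _ = ‖star T * T‖ * ‖x‖ ^ 2 := by ring
    have h2 := pow_le_pow_left₀ (norm_nonneg _) h 2
    rwa [Real.sq_sqrt (norm_nonneg _), sq] at h2

instance [CompleteSpace E] : CompleteSpace (Adjointable A E) := by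
  refine Metric.complete_of_cauchySeq_tendsto fun T hT => ?_
  have hn : ∀ R S : Adjointable A E, dist (R.1) (S.1) = dist R S := fun R S => rfl
  have hs : ∀ R S : Adjointable A E, dist (star R) (star S) = dist R S := fun R S => by
    rw [dist_eq_norm, dist_eq_norm, ← star_sub, norm_star]
  have h1 : CauchySeq fun n => (T n).1 := by
    rw [Metric.cauchySeq_iff] at hT ⊢; simpa only [hn] using hT
  have h2 : CauchySeq fun n => (star (T n)).1 := by
    rw [Metric.cauchySeq_iff] at hT ⊢; simpa only [hn, hs] using hT
  obtain ⟨R, hR⟩ := cauchySeq_tendsto_of_complete h1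
  obtain ⟨S, hS⟩ := cauchySeq_tendsto_of_complete h2
  have hRS : ∀ x y, (ip (R x) y : A) = ip x (S y) := fun x y => by
    have e1 : Tendsto (fun n => (T n).1 x) atTop (𝓝 (R x)) :=
      ((ContinuousLinearMap.apply ℂ E x).continuous.tendsto R).comp hR
    have e2 : Tendsto (fun n => (star (T n)).1 y) atTop (𝓝 (S y)) :=
      ((ContinuousLinearMap.apply ℂ E y).continuous.tendsto S).comp hS
    have e3 : Tendsto (fun n => (ip ((T n).1 x) y : A)) atTop (𝓝 (ip (R x) y)) :=
      ((continuous_ip (A := A) (E := E)).tendsto (R x, y)).comp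
        (e1.prodMk_nhds tendsto_const_nhds)
    have e4 : Tendsto (fun n => (ip x ((star (T n)).1 y) : A)) atTop (𝓝 (ip x (S y))) :=
      ((continuous_ip (A := A) (E := E)).tendsto (x, S y)).comp
        (tendsto_const_nhds.prodMk_nhds e2)
    refine tendsto_nhds_unique e3 (e4.congr fun n => ?_)
    exact ((T n).ip_star x y).symm
  let R' : Adjointable A E := ⟨R, (⟨S, hRS⟩ : ∃ S : E →L[ℂ] E, ∀ x y, (ip (R x) y : A) = ip x (S y))⟩
  refine ⟨R', Metric.tendsto_nhds.2 fun ε hε => ?_⟩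
  exact (Metric.tendsto_nhds.1 hR) ε hε

noncomputable instance [CompleteSpace E] : CStarAlgebra (Adjointable A E) where

end Adjointable

section Positivity

theorem exists_jordan {M : Type*} [NonUnitalCStarAlgebra M] (T : M) (hT : IsSelfAdjoint T) :
    ∃ Q R : M, T = star Q * Q - star R * R ∧ (star R * R) * (star Q * Q) = 0 := by
  let _ : PartialOrder M := CStarAlgebra.spectralOrder _
  have _ : StarOrderedRing M := CStarAlgebra.spectralOrderedRing _
  obtain ⟨Q, hQ⟩ := CStarAlgebra.nonneg_iff_eq_star_mul_self.1 (CFC.posPart_nonneg T)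
  obtain ⟨R, hR⟩ := CStarAlgebra.nonneg_iff_eq_star_mul_self.1 (CFC.negPart_nonneg T)
  refine ⟨Q, R, ?_, ?_⟩
  · rw [← hQ, ← hR, CFC.posPart_sub_negPart T hT]
  · rw [← hQ, ← hR, CFC.negPart_mul_posPart]

variable {A : Type*} [NonUnitalCStarAlgebra A] [PartialOrder A] [StarOrderedRing A]

/-- A self-adjoint matrix over a C⋆-algebra is positive if `∑ cᵢ* Tᵢⱼ cⱼ ≥ 0` for all `c`. -/
theorem cstarMatrix_eq_star_mul {n : ℕ} (T : CStarMatrix (Fin n) (Fin n) A)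
    (hT : IsSelfAdjoint T) (h : ∀ c : Fin n → A, 0 ≤ ∑ i, ∑ j, star (c i) * T i j * c j) :
    ∃ S : CStarMatrix (Fin n) (Fin n) A, T = star S * S := by
  obtain ⟨Q, S, hQS, hQS0⟩ := exists_jordan T hT
  set N := star S * S with hS
  have hNsa : star N = N := (IsSelfAdjoint.star_mul_self S).star_eq
  have hNT : N * T * N = -(N * N * N) := by
    rw [hQS, mul_sub, hQS0, zero_sub, neg_mul]
  have hdiag : ∀ k, 0 ≤ (N * T * N) k k := fun k => by
    have := h fun i => N i k
    convert this using 1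
    rw [CStarMatrix.mul_apply]
    simp_rw [CStarMatrix.mul_apply, Finset.sum_mul]
    rw [Finset.sum_comm]
    refine Finset.sum_congr rfl fun i _ => Finset.sum_congr rfl fun j _ => ?_
    rw [← CStarMatrix.star_apply, hNsa]
  have hSN : S * N = 0 := by
    refine CStarMatrix.ext fun l k => ?_
    have e : N * N * N = star (S * N) * (S * N) := by
      rw [star_mul, hNsa, hS]
      simp only [mul_assoc]
    have h1 : (N * N * N) k k = ∑ l, star ((S * N) l k) * (S * N) l k := by
      rw [e, CStarMatrix.mul_apply]
      refine Finset.sum_congr rfl fun l _ => ?_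
      rw [CStarMatrix.star_apply]
    have h2 := hdiag k
    rw [hNT, CStarMatrix.neg_apply, neg_nonneg, h1] at h2
    have h3 : ∑ l, star ((S * N) l k) * (S * N) l k = 0 :=
      le_antisymm h2 (Finset.sum_nonneg fun l _ => star_mul_self_nonneg _)
    have h4 := (Finset.sum_eq_zero_iff_of_nonneg fun l _ => star_mul_self_nonneg _).1 h3 l
      (Finset.mem_univ l)
    exact (CStarRing.star_mul_self_eq_zero_iff _).1 h4
  have hNN : star N * N = 0 := by
    rw [hNsa]
    calc N * N = star S * (S * N) := mul_assoc (star S) S N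
      _ = 0 := by rw [hSN, mul_zero]
  have hNz : N = 0 := (CStarRing.star_mul_self_eq_zero_iff _).1 hNN
  exact ⟨Q, by rw [hQS, hNz, sub_zero]⟩

end Positivity

open scoped TensorProduct
open UniformSpace
section Induced

variable {A : Type*} [NonUnitalCStarAlgebra A] [PartialOrder A] [StarOrderedRing A]
    {E : Type*} [NormedAddCommGroup E] [NormedSpace ℂ E] [HilbertModule A E]
    {H : Type*} [NormedAddCommGroup H] [InnerProductSpace ℂ H] [CompleteSpace H]
    (π : A →⋆ₙₐ[ℂ] (H →L[ℂ] H))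

/-- The functional `y ⊗ k ↦ ⟨h, π(⟨x, y⟩) k⟩`. -/
noncomputable def indFunctional (x : E) (h : H) : E ⊗[ℂ] H →ₗ[ℂ] ℂ :=
  TensorProduct.lift (LinearMap.mk₂ ℂ (fun (y : E) (k : H) => inner ℂ h (π (ip x y) k))
    (fun y y' k => by rw [ip_add, map_add, _root_.add_apply, inner_add_right])
    (fun c y k => by rw [ip_smul, map_smul, _root_.smul_apply, inner_smul_right, smul_eq_mul])
    (fun y k k' => by rw [map_add, inner_add_right])
    (fun c y k => by rw [map_smul, inner_smul_right, smul_eq_mul]))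

theorem indFunctional_tmul (x y : E) (h k : H) :
    indFunctional π x h (y ⊗ₜ k) = inner ℂ h (π (ip x y) k) := rfl

variable (E) in
/-- The sesquilinear form `⟨x ⊗ h, y ⊗ k⟩ = ⟨h, π(⟨x, y⟩) k⟩` on the algebraic tensor product,
conjugate linear in the first variable. -/
noncomputable def indForm : E ⊗[ℂ] H →ₗ⋆[ℂ] E ⊗[ℂ] H →ₗ[ℂ] ℂ :=
  TensorProduct.lift (LinearMap.mk₂'ₛₗ (starRingEnd ℂ) (starRingEnd ℂ) (indFunctional π)
    (fun x x' h => TensorProduct.ext' fun y k => by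
      rw [LinearMap.add_apply, indFunctional_tmul, indFunctional_tmul, indFunctional_tmul,
        ip_add_left, map_add, _root_.add_apply, inner_add_right])
    (fun c x h => TensorProduct.ext' fun y k => by
      rw [LinearMap.smul_apply, indFunctional_tmul, indFunctional_tmul,
        ip_smul_left, map_smul, _root_.smul_apply, inner_smul_right]; rfl)
    (fun x h h' => TensorProduct.ext' fun y k => by
      rw [LinearMap.add_apply, indFunctional_tmul, indFunctional_tmul, indFunctional_tmul,
        inner_add_left])
    (fun c x h => TensorProduct.ext' fun y k => by
      rw [LinearMap.smul_apply, indFunctional_tmul, indFunctional_tmul, inner_smul_left]; rfl))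

theorem indForm_tmul (x y : E) (h k : H) :
    indForm E π (x ⊗ₜ h) (y ⊗ₜ k) = inner ℂ h (π (ip x y) k) := rfl

theorem conj_indForm (ξ η : E ⊗[ℂ] H) : starRingEnd ℂ (indForm E π η ξ) = indForm E π ξ η := by
  induction ξ with
  | zero => simp
  | add ξ ξ' h h' => rw [map_add, map_add, map_add, LinearMap.add_apply, h, h']
  | tmul x h =>
    induction η with
    | zero => simp
    | add η η' h h' => rw [map_add, map_add, LinearMap.add_apply, map_add, h, h']
    | tmul y k =>
      rw [indForm_tmul, indForm_tmul, inner_conj_symm, ← PreHilbertModule.star_ip x y, map_star,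
        ContinuousLinearMap.star_eq_adjoint, ContinuousLinearMap.adjoint_inner_left]

theorem exists_sum_tmul (ξ : E ⊗[ℂ] H) :
    ∃ (n : ℕ) (x : Fin n → E) (h : Fin n → H), ξ = ∑ i, x i ⊗ₜ[ℂ] h i := by
  obtain ⟨S, hS⟩ := TensorProduct.exists_finset ξ
  refine ⟨S.card, fun i => (S.equivFin.symm i).1.1, fun i => (S.equivFin.symm i).1.2, ?_⟩
  rw [hS, ← Finset.sum_coe_sort, ← S.equivFin.symm.sum_comp]

theorem indForm_nonneg (ξ : E ⊗[ℂ] H) : 0 ≤ (indForm E π ξ ξ).re := by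
  obtain ⟨n, x, h, rfl⟩ := exists_sum_tmul ξ
  let T : CStarMatrix (Fin n) (Fin n) A := CStarMatrix.ofMatrix fun i j => ip (x i) (x j)
  have hT : ∀ i j, T i j = ip (x i) (x j) := fun i j => rfl
  have hTsa : IsSelfAdjoint T := CStarMatrix.ext fun i j => by
    rw [CStarMatrix.star_apply, hT, hT, PreHilbertModule.star_ip]
  obtain ⟨S, hS⟩ := cstarMatrix_eq_star_mul T hTsa fun c => by
    have h1 : ∑ i, ∑ j, star (c i) * T i j * c j =
        (ip (∑ i, act (x i) (c i)) (∑ j, act (x j) (c j)) : A) := by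
      simp only [← ipL_apply (A := A), map_sum, LinearMap.sum_apply]
      rw [Finset.sum_comm]
      refine Finset.sum_congr rfl fun j _ => Finset.sum_congr rfl fun i _ => ?_
      rw [ipL_apply, ip_act, ip_act_left, hT, mul_assoc]
    rw [h1]
    exact ip_nonneg _
  have h2 : indForm E π (∑ i, x i ⊗ₜ[ℂ] h i) (∑ i, x i ⊗ₜ[ℂ] h i) =
      ∑ k, inner ℂ (∑ i, π (S k i) (h i)) (∑ j, π (S k j) (h j)) := by
    have h3 : ∀ i j, inner ℂ (h i) (π (ip (x i) (x j)) (h j)) =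
        ∑ k, inner ℂ (π (S k i) (h i)) (π (S k j) (h j)) := fun i j => by
      rw [← hT, hS, CStarMatrix.mul_apply, map_sum, _root_.sum_apply, inner_sum]
      refine Finset.sum_congr rfl fun k _ => ?_
      rw [CStarMatrix.star_apply, map_mul, map_star, mul_apply_eq_comp,
        ContinuousLinearMap.star_eq_adjoint, ContinuousLinearMap.adjoint_inner_right]
    have h4 : ∀ k, inner ℂ (∑ i, π (S k i) (h i)) (∑ j, π (S k j) (h j)) =
        ∑ j, ∑ i, inner ℂ (π (S k i) (h i)) (π (S k j) (h j)) := fun k => by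
      rw [inner_sum]
      exact Finset.sum_congr rfl fun j _ => sum_inner _ _ _
    simp only [map_sum, LinearMap.sum_apply, indForm_tmul]
    rw [Finset.sum_congr rfl fun k _ => h4 k]
    refine (Finset.sum_congr rfl fun j _ => ?_).trans Finset.sum_comm
    exact (Finset.sum_congr rfl fun i _ => h3 i j).trans Finset.sum_comm
  rw [h2, Complex.re_sum]
  exact Finset.sum_nonneg fun k _ => inner_self_nonneg (𝕜 := ℂ)

set_option linter.unusedVariables false in
variable (E) in
/-- The algebraic tensor product of `E` and `H`, with the semi-inner product given by `π`. -/
@[nolint unusedArguments]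
def PreInd (π : A →⋆ₙₐ[ℂ] (H →L[ℂ] H)) : Type _ := E ⊗[ℂ] H

noncomputable instance : AddCommGroup (PreInd E π) := inferInstanceAs (AddCommGroup (E ⊗[ℂ] H))
noncomputable instance : Module ℂ (PreInd E π) := inferInstanceAs (Module ℂ (E ⊗[ℂ] H))

variable (E) in
/-- The semi-inner product on the tensor product. -/
@[reducible] noncomputable def preIndCore : PreInnerProductSpace.Core ℂ (PreInd E π) where
  inner ξ η := indForm E π ξ η
  conj_inner_symm ξ η := conj_indForm π ξ η
  re_inner_nonneg ξ := indForm_nonneg π ξ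
  add_left ξ η ζ := LinearMap.map_add₂ (indForm E π) ξ η ζ
  smul_left ξ η c := LinearMap.map_smulₛₗ₂ (indForm E π) c ξ η

noncomputable instance : SeminormedAddCommGroup (PreInd E π) :=
  InnerProductSpace.Core.toSeminormedAddCommGroup (c := preIndCore E π)

noncomputable instance : InnerProductSpace ℂ (PreInd E π) :=
  InnerProductSpace.ofCore (preIndCore E π)

theorem PreInd.inner_def (ξ η : PreInd E π) : inner ℂ ξ η = indForm E π ξ η := rfl

variable (E) in
/-- The Hilbert space `E ⊗_π H` of the induced representation: the completion of the algebraic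
tensor product (after division by the vectors of length `0`). -/
abbrev IndSpace : Type _ := Completion (PreInd E π)

/-- The operator `T ⊗ 1` on the algebraic tensor product. -/
noncomputable def tensorOne (T : Adjointable A E) : PreInd E π →ₗ[ℂ] PreInd E π :=
  TensorProduct.map (T.1 : E →ₗ[ℂ] E) (LinearMap.id : H →ₗ[ℂ] H)

theorem tensorOne_tmul (T : Adjointable A E) (x : E) (h : H) :
    tensorOne π T (x ⊗ₜ[ℂ] h : E ⊗[ℂ] H) = (T x ⊗ₜ[ℂ] h : E ⊗[ℂ] H) := rfl

theorem tensorOne_mul (S T : Adjointable A E) (ξ : PreInd E π) :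
    tensorOne π (S * T) ξ = tensorOne π S (tensorOne π T ξ) := by
  have h : tensorOne π (S * T) = tensorOne π S ∘ₗ tensorOne π T :=
    TensorProduct.ext' fun x h => rfl
  rw [h]; rfl

theorem tensorOne_add (S T : Adjointable A E) (ξ : PreInd E π) :
    tensorOne π (S + T) ξ = tensorOne π S ξ + tensorOne π T ξ := by
  have h : tensorOne π (S + T) = tensorOne π S + tensorOne π T :=
    TensorProduct.ext' fun x h => TensorProduct.add_tmul (S x) (T x) h
  rw [h]; rfl

theorem tensorOne_smul (c : ℂ) (T : Adjointable A E) (ξ : PreInd E π) :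
    tensorOne π (c • T) ξ = c • tensorOne π T ξ := by
  have h : tensorOne π (c • T) = c • tensorOne π T :=
    TensorProduct.ext' fun x h => (TensorProduct.smul_tmul' c (T x) h).symm
  rw [h]; rfl

theorem tensorOne_one (ξ : PreInd E π) : tensorOne π 1 ξ = ξ := by
  have h : tensorOne π 1 = (LinearMap.id : PreInd E π →ₗ[ℂ] PreInd E π) :=
    TensorProduct.ext' fun x h => rfl
  rw [h]; rfl

theorem inner_tensorOne (T : Adjointable A E) (ξ η : PreInd E π) :
    inner ℂ (tensorOne π T ξ) η = inner ℂ ξ (tensorOne π (star T) η) := by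
  have h : (indForm E π).comp (tensorOne π T) =
      (LinearMap.lcomp ℂ ℂ (tensorOne π (star T))).comp (indForm E π) :=
    TensorProduct.ext' fun x h => TensorProduct.ext' fun y k => by
      change inner ℂ h (π (ip (T x) y) k) = inner ℂ h (π (ip x ((star T) y)) k)
      rw [T.ip_star]
  exact LinearMap.congr_fun (LinearMap.congr_fun h ξ) η

theorem norm_tensorOne_le [CompleteSpace E] (T : Adjointable A E) (ξ : PreInd E π) :
    ‖tensorOne π T ξ‖ ≤ ‖T‖ * ‖ξ‖ := by
  let _ : PartialOrder (Adjointable A E) := CStarAlgebra.spectralOrder _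
  have _ : StarOrderedRing (Adjointable A E) := CStarAlgebra.spectralOrderedRing _
  have h1 := CStarAlgebra.star_mul_le_algebraMap_norm_sq (a := T)
  obtain ⟨S, hS⟩ := CStarAlgebra.nonneg_iff_eq_star_mul_self.1 (sub_nonneg.2 h1)
  refine (pow_le_pow_iff_left₀ (norm_nonneg _) (by positivity) two_ne_zero).1 ?_
  have h2 : (‖T‖ ^ 2 : ℂ) • (1 : Adjointable A E) = star S * S + star T * T := by
    rw [← hS, sub_add_cancel, Algebra.algebraMap_eq_smul_one]
    norm_cast
  have h3 : inner ℂ ξ (tensorOne π ((‖T‖ ^ 2 : ℂ) • (1 : Adjointable A E)) ξ) =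
      inner ℂ (tensorOne π S ξ) (tensorOne π S ξ) +
        inner ℂ (tensorOne π T ξ) (tensorOne π T ξ) := by
    rw [h2, tensorOne_add, inner_add_right, tensorOne_mul, tensorOne_mul, inner_tensorOne,
      inner_tensorOne]
  rw [tensorOne_smul, tensorOne_one, inner_smul_right, inner_self_eq_norm_sq_to_K,
    inner_self_eq_norm_sq_to_K, inner_self_eq_norm_sq_to_K] at h3
  have h4 : ‖T‖ ^ 2 * ‖ξ‖ ^ 2 = ‖tensorOne π S ξ‖ ^ 2 + ‖tensorOne π T ξ‖ ^ 2 := by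
    simp only [RCLike.ofReal_eq_complex_ofReal] at h3
    exact_mod_cast h3
  rw [mul_pow, h4]
  exact le_add_of_nonneg_left (sq_nonneg _)

variable [CompleteSpace E]

/-- `T ⊗ 1` as a bounded operator. -/
noncomputable def tensorOneL (T : Adjointable A E) : PreInd E π →L[ℂ] PreInd E π :=
  (tensorOne π T).mkContinuous ‖T‖ (norm_tensorOne_le π T)

theorem tensorOneL_apply (T : Adjointable A E) (ξ : PreInd E π) :
    tensorOneL π T ξ = tensorOne π T ξ := rfl

theorem IndSpace.clm_ext {S T : IndSpace E π →L[ℂ] IndSpace E π}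
    (h : ∀ ξ : PreInd E π, S ξ = T ξ) : S = T := by
  ext ξ
  induction ξ using Completion.induction_on with
  | hp => exact isClosed_eq S.continuous T.continuous
  | ih ξ => exact h ξ

/-- The representation `T ↦ T ⊗ 1` of `L(E)` on `E ⊗_π H`. -/
noncomputable def indHom : Adjointable A E →⋆ₙₐ[ℂ] (IndSpace E π →L[ℂ] IndSpace E π) where
  toFun T := (tensorOneL π T).completion
  map_smul' c T := IndSpace.clm_ext π fun ξ => by
    rw [MonoidHom.id_apply, _root_.smul_apply, ContinuousLinearMap.completion_apply_coe,
      ContinuousLinearMap.completion_apply_coe, tensorOneL_apply, tensorOneL_apply,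
      tensorOne_smul, Completion.coe_smul]
  map_zero' := IndSpace.clm_ext π fun ξ => by
    have h := tensorOne_smul π 0 (0 : Adjointable A E) ξ
    rw [zero_smul, zero_smul] at h
    rw [ContinuousLinearMap.completion_apply_coe, tensorOneL_apply, h]; rfl
  map_add' S T := IndSpace.clm_ext π fun ξ => by
    rw [_root_.add_apply, ContinuousLinearMap.completion_apply_coe,
      ContinuousLinearMap.completion_apply_coe, ContinuousLinearMap.completion_apply_coe,
      tensorOneL_apply, tensorOneL_apply, tensorOneL_apply, tensorOne_add, Completion.coe_add]
  map_mul' S T := IndSpace.clm_ext π fun ξ => by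
    rw [mul_apply_eq_comp, ContinuousLinearMap.completion_apply_coe,
      ContinuousLinearMap.completion_apply_coe, ContinuousLinearMap.completion_apply_coe,
      tensorOneL_apply, tensorOneL_apply, tensorOneL_apply, tensorOne_mul]
  map_star' T := by
    rw [ContinuousLinearMap.star_eq_adjoint]
    refine (ContinuousLinearMap.eq_adjoint_iff _ _).2 fun ξ η => ?_
    induction ξ, η using Completion.induction_on₂ with
    | hp =>
      refine isClosed_eq (Completion.Continuous.inner ?_ continuous_snd)
        (Completion.Continuous.inner continuous_fst ?_)
      · exact (ContinuousLinearMap.continuous _).comp continuous_fst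
      · exact (ContinuousLinearMap.continuous _).comp continuous_snd
    | ih ξ η =>
      rw [ContinuousLinearMap.completion_apply_coe, ContinuousLinearMap.completion_apply_coe,
        tensorOneL_apply, tensorOneL_apply, Completion.inner_coe, Completion.inner_coe,
        inner_tensorOne, star_star]

theorem indHom_coe (T : Adjointable A E) (ξ : PreInd E π) :
    indHom π T (ξ : IndSpace E π) = (tensorOne π T ξ : IndSpace E π) :=
  ContinuousLinearMap.completion_apply_coe _ _

end Induced

section Main

variable {G : Type u} [TopologicalSpace G] [TopGroupoid G] [T2Space G] [LocallyCompactSpace G]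
  [SecondCountableTopology G] [MeasurableSpace G] [BorelSpace G] (hs : HaarSystem G)
  (B : G → Type v) [∀ x, NormedAddCommGroup (B x)] [∀ x, NormedSpace ℂ (B x)]
  [TopologicalSpace (Tot B)] [FellBundle B]

section ModuleX

set_option linter.unusedVariables false in
/-- `Γ_c(G; B)` as a pre-Hilbert `A`-module. -/
@[nolint unusedArguments]
def PreX (hs : HaarSystem G) (B : G → Type v) [∀ x, NormedAddCommGroup (B x)]
    [∀ x, NormedSpace ℂ (B x)] [TopologicalSpace (Tot B)] [FellBundle B] : Type (max u v) := Gc B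

noncomputable instance : AddCommGroup (PreX hs B) := inferInstanceAs (AddCommGroup (Gc B))
noncomputable instance : Module ℂ (PreX hs B) := inferInstanceAs (Module ℂ (Gc B))

noncomputable instance : PreHilbertModule (UnitAlg B) (PreX hs B) where
  ip f g := Gc.ip hs f g
  act f a := Gc.act f a
  ip_add f g h := Gc.ip_add hs f g h
  ip_smul c f g := Gc.ip_smul hs c f g
  ip_act f g a := Gc.ip_act hs f g a
  star_ip f g := Gc.star_ip hs f g
  ip_nonneg f := Gc.ip_nonneg hs f
  ip_definite f h := Gc.eq_zero_of_ip hs f h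

/-- The norm `‖f‖ = ‖⟨f, f⟩‖ ^ (1/2)`. -/
noncomputable instance : Norm (PreX hs B) := ⟨fun f => √‖(ip f f : UnitAlg B)‖⟩

noncomputable instance : NormedAddCommGroup (PreX hs B) :=
  NormedAddCommGroup.ofCore (PreHilbertModule.core (UnitAlg B) (PreX hs B))

noncomputable instance : NormedSpace ℂ (PreX hs B) :=
  NormedSpace.ofCore (PreHilbertModule.core (UnitAlg B) (PreX hs B))

noncomputable instance : HilbertModule (UnitAlg B) (PreX hs B) where
  norm_sq_eq _ := Real.sq_sqrt (norm_nonneg _)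

/-- The Hilbert `A`-module `X`, the completion of `Γ_c(G; B)`. -/
abbrev ModX : Type (max u v) := UniformSpace.Completion (PreX hs B)

variable {B}

/-- The canonical image of `f ∈ Γ_c(G; B)` in `X`. -/
noncomputable def Gc.toX (f : Gc B) : ModX hs B :=
  UniformSpace.Completion.coe' (α := PreX hs B) f

end ModuleX

section FullAlgebra

variable {B}

/-- The `I`-norm. -/
noncomputable def iNorm (f : Gc B) : ℝ≥0∞ :=
  ⨆ w : UnitSpace G, max (∫⁻ x, ‖f x‖ₑ ∂(hs.lam w)) (∫⁻ x, ‖f x‖ₑ ∂(hs.lamInv w))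

theorem iNorm_lt_top (f : Gc B) : iNorm hs f < ∞ := by
  obtain ⟨C, hC0, hC⟩ := f.exists_bound
  obtain ⟨K, hK, hfK⟩ := f.2.2
  obtain ⟨D, hD, hD'⟩ := hs.exists_bound K hK
  obtain ⟨D₁, hD₁, hD₁'⟩ := hs.exists_bound (ginv ⁻¹' K)
    ((ginvEquivH G).isCompact_preimage.2 hK)
  have h1 : ∀ x, ‖f x‖ₑ ≤ K.indicator (fun _ => ENNReal.ofReal C) x := fun x => by
    by_cases hx : x ∈ K
    · rw [Set.indicator_of_mem hx, ← ofReal_norm]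
      exact ENNReal.ofReal_le_ofReal (hC x)
    · have : f x = 0 := hfK x hx
      rw [this, enorm_zero]; exact zero_le
  have h2 : ∀ μ : Measure G, ∫⁻ x, ‖f x‖ₑ ∂μ ≤ ENNReal.ofReal C * μ K := fun μ =>
    (lintegral_mono h1).trans (lintegral_indicator_const_le _ _)
  refine lt_of_le_of_lt (iSup_le fun w => max_le_max ((h2 _).trans (mul_le_mul_right (hD' w) _))
    ((h2 _).trans (mul_le_mul_right ?_ _))) (max_lt (ENNReal.mul_lt_top ENNReal.ofReal_lt_top hD)
      (ENNReal.mul_lt_top ENNReal.ofReal_lt_top hD₁))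
  rw [HaarSystem.lamInv, Measure.map_apply continuous_ginv.measurable hK.measurableSet]
  exact hD₁' w

variable (B) in
/-- The `I`-norm decreasing ⋆-representations of `Γ_c(G; B)` on Hilbert spaces. -/
structure Rep where
  /-- the space -/
  H : Type (max u v)
  [group : NormedAddCommGroup H]
  [space : InnerProductSpace ℂ H]
  [complete : CompleteSpace H]
  /-- the representation -/
  L : Gc B →ₗ[ℂ] (H →L[ℂ] H)
  map_conv : ∀ f g, L (f.conv hs g) = L f * L g
  map_adj : ∀ f, L f.adj = star (L f)
  bound : ∀ f, ‖L f‖ₑ ≤ iNorm hs f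

attribute [instance] Rep.group Rep.space Rep.complete

variable (B) in
/-- The product of the operator algebras of all representations. -/
def RepProd : Type _ := ↥(lp (fun L : Rep hs B => L.H →L[ℂ] L.H) ∞)

noncomputable instance : NonUnitalCStarAlgebra (RepProd hs B) :=
  inferInstanceAs (NonUnitalCStarAlgebra ↥(lp (fun L : Rep hs B => L.H →L[ℂ] L.H) ∞))

theorem Rep.norm_le (L : Rep hs B) (f : Gc B) : ‖L.L f‖ ≤ (iNorm hs f).toReal := by
  rw [← toReal_enorm]
  exact ENNReal.toReal_mono (iNorm_lt_top hs f).ne (L.bound f)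

variable (B) in
/-- The family `(L f)` of all representations, as a linear map. Its norm is the universal norm
`sup ‖L f‖`. -/
noncomputable def univRep : Gc B →ₗ[ℂ] RepProd hs B where
  toFun f := ⟨fun L => L.L f, memℓp_infty ⟨(iNorm hs f).toReal, by
    rintro _ ⟨L, rfl⟩; exact L.norm_le hs f⟩⟩
  map_add' f g := lp.ext (funext fun L => map_add L.L f g)
  map_smul' c f := lp.ext (funext fun L => map_smul L.L c f)

theorem univRep_mul (f g : Gc B) : univRep hs B f * univRep hs B g = univRep hs B (f.conv hs g) :=
  lp.ext (funext fun L => (L.map_conv f g).symm)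

theorem univRep_star (f : Gc B) : star (univRep hs B f) = univRep hs B f.adj :=
  lp.ext (funext fun L => (L.map_adj f).symm)

variable (B) in
/-- The image of `Γ_c(G; B)` under all representations. -/
noncomputable def univImage : NonUnitalStarSubalgebra ℂ (RepProd hs B) where
  carrier := Set.range (univRep hs B)
  zero_mem' := ⟨0, map_zero _⟩
  add_mem' := by rintro _ _ ⟨f, rfl⟩ ⟨g, rfl⟩; exact ⟨f + g, map_add _ _ _⟩
  smul_mem' := by rintro c _ ⟨f, rfl⟩; exact ⟨c • f, map_smul _ _ _⟩
  mul_mem' := by rintro _ _ ⟨f, rfl⟩ ⟨g, rfl⟩; exact ⟨_, (univRep_mul hs f g).symm⟩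
  star_mem' := by rintro _ ⟨f, rfl⟩; exact ⟨_, (univRep_star hs f).symm⟩

variable (B) in
/-- The C⋆-algebra `C⋆(G; B)` of the Fell bundle: the completion of `Γ_c(G; B)` in the universal
norm. -/
def FullCstar : Type _ := ↥(univImage hs B).topologicalClosure

noncomputable instance : NonUnitalCStarAlgebra (FullCstar hs B) :=
  haveI : IsClosed ((univImage hs B).topologicalClosure : Set (RepProd hs B)) :=
    NonUnitalStarSubalgebra.isClosed_topologicalClosure _
  inferInstanceAs (NonUnitalCStarAlgebra ↥(univImage hs B).topologicalClosure)

/-- The canonical image of `f ∈ Γ_c(G; B)` in `C⋆(G; B)`. -/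
noncomputable def Gc.toFull (f : Gc B) : FullCstar hs B :=
  ⟨univRep hs B f, NonUnitalStarSubalgebra.le_topologicalClosure _ ⟨f, rfl⟩⟩

end FullAlgebra

section Reduced

variable {B}

variable (B) in
/-- A representation of `A` on a Hilbert space. -/
structure UnitRep where
  /-- the space -/
  H : Type (max u v)
  [group : NormedAddCommGroup H]
  [space : InnerProductSpace ℂ H]
  [complete : CompleteSpace H]
  /-- the representation -/
  hom : UnitAlg B →⋆ₙₐ[ℂ] (H →L[ℂ] H)

attribute [instance] UnitRep.group UnitRep.space UnitRep.complete

variable {hs}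
variable (V : FullCstar hs B →⋆ₙₐ[ℂ] Adjointable (UnitAlg B) (ModX hs B))

/-- The representation `Ind π` of `C⋆(G; B)` on `X ⊗_π H`, given by `Ind π (a) = V(a) ⊗ 1`. -/
noncomputable def inducedRep (π : UnitRep B) :
    FullCstar hs B →⋆ₙₐ[ℂ] (IndSpace (ModX hs B) π.hom →L[ℂ] IndSpace (ModX hs B) π.hom) :=
  (indHom π.hom).comp V

/-- The reduced norm `‖a‖ᵣ`, the supremum of `‖Ind π (a)‖` over all representations `π` of `A`. -/
noncomputable def reducedNorm (a : FullCstar hs B) : ℝ := ⨆ π : UnitRep B, ‖inducedRep V π a‖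

theorem norm_inducedRep_le (a : FullCstar hs B) (π : UnitRep B) : ‖inducedRep V π a‖ ≤ ‖a‖ :=
  NonUnitalStarAlgHom.norm_apply_le (inducedRep V π) a

theorem reducedNorm_eq_zero_iff (a : FullCstar hs B) :
    reducedNorm V a = 0 ↔ ∀ π, inducedRep V π a = 0 := by
  refine ⟨fun h π => ?_, fun h => ?_⟩
  · have hb : BddAbove (Set.range fun π : UnitRep B => ‖inducedRep V π a‖) :=
      ⟨‖a‖, by rintro _ ⟨π, rfl⟩; exact norm_inducedRep_le V a π⟩
    have h1 := le_ciSup hb π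
    change ‖inducedRep V π a‖ ≤ reducedNorm V a at h1
    rw [h] at h1
    exact norm_le_zero_iff.1 h1
  · have h1 : ∀ π : UnitRep B, ‖inducedRep V π a‖ = 0 := fun π => by rw [h π, norm_zero]
    rw [reducedNorm]
    simp only [h1]
    exact Real.iSup_const_zero

/-- The reduced ideal `{a | ‖a‖ᵣ = 0}`. -/
def reducedIdeal : Submodule ℂ (FullCstar hs B) where
  carrier := {a | reducedNorm V a = 0}
  zero_mem' := (reducedNorm_eq_zero_iff V _).2 fun π => map_zero _
  add_mem' {a b} ha hb := (reducedNorm_eq_zero_iff V _).2 fun π => by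
    rw [map_add, (reducedNorm_eq_zero_iff V a).1 ha, (reducedNorm_eq_zero_iff V b).1 hb, add_zero]
  smul_mem' c a ha := (reducedNorm_eq_zero_iff V _).2 fun π => by
    rw [map_smul, (reducedNorm_eq_zero_iff V a).1 ha, smul_zero]

theorem mem_reducedIdeal {a : FullCstar hs B} : a ∈ reducedIdeal V ↔ reducedNorm V a = 0 := Iff.rfl

theorem mul_mem_reducedIdeal_left (a : FullCstar hs B) {b : FullCstar hs B}
    (hb : b ∈ reducedIdeal V) : a * b ∈ reducedIdeal V :=
  (reducedNorm_eq_zero_iff V _).2 fun π => by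
    rw [map_mul, (reducedNorm_eq_zero_iff V b).1 hb, mul_zero]

theorem mul_mem_reducedIdeal_right {a : FullCstar hs B} (ha : a ∈ reducedIdeal V)
    (b : FullCstar hs B) : a * b ∈ reducedIdeal V :=
  (reducedNorm_eq_zero_iff V _).2 fun π => by
    rw [map_mul, (reducedNorm_eq_zero_iff V a).1 ha, zero_mul]

theorem star_mem_reducedIdeal {a : FullCstar hs B} (ha : a ∈ reducedIdeal V) :
    star a ∈ reducedIdeal V :=
  (reducedNorm_eq_zero_iff V _).2 fun π => by
    rw [map_star, (reducedNorm_eq_zero_iff V a).1 ha, star_zero]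

/-- The reduced C⋆-algebra `C⋆ᵣ(G; B)`, the quotient of `C⋆(G; B)` by the reduced ideal. -/
def ReducedCstar : Type _ := FullCstar hs B ⧸ reducedIdeal V

noncomputable instance : AddCommGroup (ReducedCstar V) :=
  inferInstanceAs (AddCommGroup (FullCstar hs B ⧸ reducedIdeal V))
noncomputable instance : Module ℂ (ReducedCstar V) :=
  inferInstanceAs (Module ℂ (FullCstar hs B ⧸ reducedIdeal V))

/-- The quotient map. -/
noncomputable def toReduced : FullCstar hs B →ₗ[ℂ] ReducedCstar V := (reducedIdeal V).mkQ

theorem toReduced_surjective : Function.Surjective (toReduced V) := (reducedIdeal V).mkQ_surjective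

theorem toReduced_eq_iff {a b : FullCstar hs B} :
    toReduced V a = toReduced V b ↔ a - b ∈ reducedIdeal V := Submodule.Quotient.eq _

noncomputable instance : Mul (ReducedCstar V) where
  mul x y := Quotient.map₂ (· * ·) (fun a a' ha b b' hb => by
    have ha' : a - a' ∈ reducedIdeal V := (Submodule.quotientRel_def _).1 ha
    have hb' : b - b' ∈ reducedIdeal V := (Submodule.quotientRel_def _).1 hb
    refine (Submodule.quotientRel_def _).2 ?_
    have e : a * b - a' * b' = (a - a') * b + a' * (b - b') := by rw [sub_mul, mul_sub]; abel
    change a * b - a' * b' ∈ _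
    rw [e]
    exact add_mem (mul_mem_reducedIdeal_right V ha' b) (mul_mem_reducedIdeal_left V a' hb')) x y

noncomputable instance : Star (ReducedCstar V) where
  star x := Quotient.map star (fun a a' ha => by
    have ha' : a - a' ∈ reducedIdeal V := (Submodule.quotientRel_def _).1 ha
    refine (Submodule.quotientRel_def _).2 ?_
    rw [← star_sub]
    exact star_mem_reducedIdeal V ha') x

theorem toReduced_mul (a b : FullCstar hs B) :
    toReduced V (a * b) = toReduced V a * toReduced V b := rfl

theorem toReduced_star (a : FullCstar hs B) : toReduced V (star a) = star (toReduced V a) := rfl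

noncomputable instance : NonUnitalRing (ReducedCstar V) where
  left_distrib x y z := by
    obtain ⟨a, rfl⟩ := toReduced_surjective V x
    obtain ⟨b, rfl⟩ := toReduced_surjective V y
    obtain ⟨c, rfl⟩ := toReduced_surjective V z
    simp only [← toReduced_mul, ← map_add, mul_add]
  right_distrib x y z := by
    obtain ⟨a, rfl⟩ := toReduced_surjective V x
    obtain ⟨b, rfl⟩ := toReduced_surjective V y
    obtain ⟨c, rfl⟩ := toReduced_surjective V z
    simp only [← toReduced_mul, ← map_add, add_mul]
  zero_mul x := by
    obtain ⟨a, rfl⟩ := toReduced_surjective V x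
    rw [← map_zero (toReduced V), ← toReduced_mul, zero_mul]
  mul_zero x := by
    obtain ⟨a, rfl⟩ := toReduced_surjective V x
    rw [← map_zero (toReduced V), ← toReduced_mul, mul_zero]
  mul_assoc x y z := by
    obtain ⟨a, rfl⟩ := toReduced_surjective V x
    obtain ⟨b, rfl⟩ := toReduced_surjective V y
    obtain ⟨c, rfl⟩ := toReduced_surjective V z
    simp only [← toReduced_mul, mul_assoc]

noncomputable instance : StarRing (ReducedCstar V) where
  star_involutive x := by
    obtain ⟨a, rfl⟩ := toReduced_surjective V x
    rw [← toReduced_star, ← toReduced_star, star_star]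
  star_mul x y := by
    obtain ⟨a, rfl⟩ := toReduced_surjective V x
    obtain ⟨b, rfl⟩ := toReduced_surjective V y
    simp only [← toReduced_mul, ← toReduced_star, star_mul]
  star_add x y := by
    obtain ⟨a, rfl⟩ := toReduced_surjective V x
    obtain ⟨b, rfl⟩ := toReduced_surjective V y
    simp only [← toReduced_star, ← map_add, star_add]

end Reduced

end Main

end FellBundles

/-!
The algebra `Γ_c(G; B)` acts on `X` by convolution. The proof rests on two facts: this action is
dominated by the `I`-norm, and the induced representations `T ↦ T ⊗ 1` on the spaces `X ⊗_π H`
together compute the norm of an adjointable operator `T`.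

*Convolution operators.* Left invariance of the Haar system and Fubini's theorem make `Γ_c(G; B)` a
⋆-algebra (`Gc.conv_assoc`, `Gc.adj_conv`), on which the `I`-norm is submultiplicative
(`iNorm_conv_le`). Since `⟨φ, ψ⟩` is the restriction of `φ* * ψ` to the units, convolution by `f*` is
the adjoint of convolution by `f` (`Gc.ip_conv`). A direct estimate gives `‖f * φ‖ ≤ C ‖f‖_I` with
`C` depending on `φ`. Iterating the Cauchy-Schwarz inequality for the powers of `f* * f`, as in the
proof that positive functionals on Banach ⋆-algebras yield bounded representations, replaces `C` by
`‖φ‖` (`Gc.norm_conv_toPreX_le`). Hence `f` acts on `X` as an adjointable operator `convX f` of norm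
at most `‖f‖_I`, and every representation `π` of `A` yields an `I`-norm decreasing representation
`f ↦ convX f ⊗ 1` of `Γ_c(G; B)`.

*Induced representations.* The positive elements of a C⋆-algebra form a closed cone, so by the
Hahn-Banach theorem there are enough positive functionals for the GNS representations to separate
points (`exists_gns_ne_zero`). If `T ⊗ 1 = 0` for all `π`, then `π(⟨T x, T x⟩) = 0` for all `π` and
`x`, so `T = 0`. The family of all `T ↦ T ⊗ 1` is thus an injective, hence isometric
⋆-homomorphism `indFamily` of `L(X)` into a product of operator algebras, and its range is closed.

*Conclusion.* The representations `f ↦ convX f ⊗ 1` are among those that define `C⋆(G; B)`, so they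
extend to it; by density their product takes values in the closed range of `indFamily`. Composing
with the inverse of `indFamily` gives `V`. The isometry of `indFamily` says `‖V(a)‖ = ‖a‖ᵣ`, from
which the statements on the kernel and the reduced algebra follow.
-/

namespace FellBundles

universe u v

set_option linter.unusedSectionVars false

/-! ### Positive functionals and separating representations of C⋆-algebras -/

section Separation

open scoped ComplexOrder

variable {A : Type*} [NonUnitalCStarAlgebra A] [PartialOrder A] [StarOrderedRing A]

/-- Hahn-Banach separation of `-b` from the closed cone of positive elements. -/
theorem exists_positive_functional {b : A} (hb : 0 ≤ b) (hb0 : b ≠ 0) :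
    ∃ f : A →ₚ[ℂ] ℂ, f b ≠ 0 := by
  have hnb : -b ∉ {a : A | 0 ≤ a} := fun h =>
    hb0 (le_antisymm (neg_nonneg.1 h) hb)
  obtain ⟨f, u, hf, hu⟩ := RCLike.geometric_hahn_banach_closed_point (𝕜 := ℂ)
    (convex_Ici (𝕜 := ℝ) (0 : A)) CStarAlgebra.isClosed_nonneg hnb
  have hu0 : 0 < u := by simpa using hf 0 le_rfl
  have hneg : ∀ a : A, 0 ≤ a → (f a).re ≤ 0 := by
    intro a ha
    by_contra! hpos
    -- a large multiple of `a` would violate the bound `u`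
    have h1 := hf ((u / (f a).re : ℝ) • a) (smul_nonneg (by positivity) ha)
    rw [← Complex.coe_smul, map_smul, smul_eq_mul, RCLike.re_to_complex, Complex.re_ofReal_mul,
      div_mul_cancel₀ _ hpos.ne'] at h1
    exact lt_irrefl _ h1
  -- on self-adjoint elements `F` is `-2 Re f`, hence positive on the cone
  let F : A →ₗ[ℂ] ℂ :=
    { toFun := fun a => -(f a + star (f (star a)))
      map_add' := fun a a' => by simp only [star_add, map_add]; ring
      map_smul' := fun c a => by
        simp only [star_smul, map_smul, smul_eq_mul, star_mul', star_star, RingHom.id_apply]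
        ring }
  have hF : ∀ a : A, IsSelfAdjoint a → F a = ((-2 * (f a).re : ℝ) : ℂ) := by
    intro a ha
    change -(f a + star (f (star a))) = _
    rw [ha.star_eq]
    refine Complex.ext ?_ ?_
    · simp; ring
    · simp
  refine ⟨PositiveLinearMap.mk₀ F fun a ha => ?_, ?_⟩
  · rw [hF a ha.isSelfAdjoint]
    have := hneg a ha
    exact_mod_cast (by linarith : 0 ≤ -2 * (f a).re)
  · change F b ≠ 0
    rw [hF b hb.isSelfAdjoint]
    have h2 : u < -(f b).re := by simpa using hu
    have h3 : -2 * (f b).re ≠ 0 := fun h => by linarith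
    exact_mod_cast h3

/-- The GNS representations of a C⋆-algebra separate its points: if `f` is a positive functional
with `f ((a a*)²) ≠ 0`, then `π_f(a)` does not annihilate the vector given by `a*`. -/
theorem exists_gns_ne_zero {a : A} (ha : a ≠ 0) :
    ∃ f : A →ₚ[ℂ] ℂ, f.gnsNonUnitalStarAlgHom a ≠ 0 := by
  have h1 : star (a * star a) * (a * star a) ≠ 0 := by
    rw [Ne, CStarRing.star_mul_self_eq_zero_iff, CStarRing.mul_star_self_eq_zero_iff]
    exact ha
  obtain ⟨f, hf⟩ := exists_positive_functional (star_mul_self_nonneg (a * star a)) h1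
  refine ⟨f, fun h => hf ?_⟩
  have h2 : (f.toPreGNS (a * star a) : f.GNS) = 0 := by
    have := congrArg (fun T : f.GNS →L[ℂ] f.GNS => T (f.toPreGNS (star a) : f.GNS)) h
    simpa using this
  have h3 := f.preGNS_norm_sq (f.toPreGNS (a * star a))
  rw [← UniformSpace.Completion.norm_coe, h2] at h3
  simpa using h3.symm

end Separation

/-! ### The norm of an adjointable operator in terms of induced representations -/

section InducedNorm

open UniformSpace PreHilbertModule

variable {A : Type*} [NonUnitalCStarAlgebra A] [PartialOrder A] [StarOrderedRing A]
    {E : Type*} [NormedAddCommGroup E] [NormedSpace ℂ E] [HilbertModule A E] [CompleteSpace E]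
    {H : Type*} [NormedAddCommGroup H] [InnerProductSpace ℂ H] [CompleteSpace H]

/-- If `T ⊗ 1` vanishes on `E ⊗_π H`, then `π` kills all the inner products `⟨T x, T x⟩`. -/
theorem map_ip_eq_zero_of_indHom (π : A →⋆ₙₐ[ℂ] (H →L[ℂ] H)) {T : Adjointable A E}
    (hT : indHom π T = 0) (x : E) : π (ip (T x) (T x)) = 0 := by
  refine ContinuousLinearMap.ext fun h => ?_
  have key : ∀ h : H, inner ℂ h (π (ip (T x) (T x)) h) = 0 := fun h => by
    have h1 : ((tensorOne π T (TensorProduct.tmul ℂ x h) : PreInd E π) : IndSpace E π) = 0 := by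
      refine (indHom_coe π T (TensorProduct.tmul ℂ x h)).symm.trans ?_
      rw [hT]; rfl
    have h2 : inner ℂ (tensorOne π T (TensorProduct.tmul ℂ x h))
        (tensorOne π T (TensorProduct.tmul ℂ x h)) = (0 : ℂ) := by
      rw [← Completion.inner_coe, h1, inner_zero_left]
    exact h2
  have h0 : (π (ip (T x) (T x)) : H →ₗ[ℂ] H) = 0 := by
    rw [← inner_map_self_eq_zero]
    intro y
    have := congrArg (starRingEnd ℂ) (key y)
    rwa [inner_conj_symm, map_zero] at this
  exact LinearMap.congr_fun h0 h

end InducedNorm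

section UnitReps

open UniformSpace PreHilbertModule

variable {G : Type u} [TopologicalSpace G] [TopGroupoid G]
  {B : G → Type v} [∀ x, NormedAddCommGroup (B x)] [∀ x, NormedSpace ℂ (B x)]
  [TopologicalSpace (Tot B)] [FellBundle B]
  {E : Type (max u v)} [NormedAddCommGroup E] [NormedSpace ℂ E] [HilbertModule (UnitAlg B) E]
  [CompleteSpace E]

variable (B E) in
/-- The product of the operator algebras of the Hilbert spaces `E ⊗_π H`, where `π` runs over all
representations of `A`. -/
abbrev IndProd : Type _ :=
  ↥(lp (fun π : UnitRep B => IndSpace E π.hom →L[ℂ] IndSpace E π.hom) ∞)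

variable (B E) in
/-- The family `(T ⊗ 1)` indexed by all representations of `A`. -/
noncomputable def indFamily : Adjointable (UnitAlg B) E →⋆ₙₐ[ℂ] IndProd B E where
  toFun T := ⟨fun π => indHom π.hom T, memℓp_infty ⟨‖T‖, by
    rintro _ ⟨π, rfl⟩; exact NonUnitalStarAlgHom.norm_apply_le (indHom π.hom) T⟩⟩
  map_smul' c T := lp.ext (funext fun π => map_smul (indHom π.hom) c T)
  map_zero' := lp.ext (funext fun π => map_zero (indHom π.hom))
  map_add' S T := lp.ext (funext fun π => map_add (indHom π.hom) S T)
  map_mul' S T := lp.ext (funext fun π => map_mul (indHom π.hom) S T)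
  map_star' T := lp.ext (funext fun π => map_star (indHom π.hom) T)

theorem indFamily_apply (T : Adjointable (UnitAlg B) E) (π : UnitRep B) :
    indFamily B E T π = indHom π.hom T := rfl

theorem indFamily_injective : Function.Injective (indFamily B E) := by
  rw [injective_iff_map_eq_zero]
  intro T hT
  refine Adjointable.ext fun x => ?_
  refine ip_definite (A := UnitAlg B) (T x) ?_
  by_contra hne
  obtain ⟨f, hf⟩ := exists_gns_ne_zero hne
  let π : UnitRep B := { H := f.GNS, hom := f.gnsNonUnitalStarAlgHom }
  refine hf (map_ip_eq_zero_of_indHom π.hom (T := T) ?_ x)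
  rw [← indFamily_apply T π, hT]
  rfl

/-- An injective ⋆-homomorphism of C⋆-algebras is isometric. -/
theorem norm_indFamily (T : Adjointable (UnitAlg B) E) : ‖indFamily B E T‖ = ‖T‖ :=
  NonUnitalStarAlgHom.norm_map (indFamily B E) indFamily_injective T

theorem norm_eq_iSup_indHom (T : Adjointable (UnitAlg B) E) :
    ‖T‖ = ⨆ π : UnitRep B, ‖indHom π.hom T‖ := by
  rw [← norm_indFamily, lp.norm_eq_ciSup]
  rfl

theorem isClosed_range_indFamily : IsClosed (Set.range (indFamily B E)) :=
  (AddMonoidHomClass.isometry_of_norm (indFamily B E) norm_indFamily).isClosedEmbedding.isClosed_range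

end UnitReps

/-! ### Translation of integrals over a Haar system -/

open TopGroupoid UscBanachBundle FellBundle

section Translation

variable {G : Type u} [TopologicalSpace G] [TopGroupoid G]

theorem ginv_gmul_gmul {x y : G} (h : sr x = rg y) : gmul (ginv x) (gmul x y) = y := by
  rw [← gmul_assoc _ _ _ (sr_ginv x) h, ginv_gmul, h, rg_gmul_self]

theorem ginv_gmul_rev {x y : G} (h : sr x = rg y) :
    ginv (gmul x y) = gmul (ginv y) (ginv x) := by
  have h1 : sr (ginv y) = rg (ginv x) := by rw [sr_ginv, rg_ginv, h]
  have h2 : sr (gmul x y) = rg (gmul (ginv y) (ginv x)) := by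
    rw [sr_gmul _ _ h, rg_gmul _ _ h1, rg_ginv]
  -- `(xy)(y⁻¹x⁻¹)` is the unit `r(xy)`
  have h3 : gmul (gmul x y) (gmul (ginv y) (ginv x)) = rg (gmul x y) := by
    rw [gmul_assoc x y _ h (by rw [rg_gmul _ _ h1, rg_ginv]),
      ← gmul_assoc y (ginv y) (ginv x) (by rw [rg_ginv]) h1, gmul_ginv, ← h,
      ← rg_ginv x, rg_gmul_self, gmul_ginv, rg_gmul _ _ h]
  have h4 := ginv_gmul_gmul h2
  rw [h3, ← sr_ginv (gmul x y), gmul_sr_self] at h4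
  exact h4

theorem rgU_ginv (x : G) : rgU (ginv x) = srU x := Subtype.ext (rg_ginv x)

open Classical in
/-- Left translation `(x, y) ↦ xy`, extended to pairs that are not composable by `(x, y) ↦ y` so as
to be a measurable map on all of `G × G`. -/
noncomputable def translate (p : G × G) : G :=
  if sr p.1 = rg p.2 then gmul p.1 p.2 else p.2

theorem translate_pos {x y : G} (h : sr x = rg y) : translate (x, y) = gmul x y := if_pos h

variable [T2Space G] [SecondCountableTopology G] [MeasurableSpace G] [BorelSpace G]

theorem measurable_translate : Measurable (translate : G × G → G) := by
  classical
  have hcl : IsClosed {p : G × G | sr p.1 = rg p.2} :=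
    isClosed_eq (continuous_sr.comp continuous_fst) (continuous_rg.comp continuous_snd)
  exact ContinuousOn.measurable_piecewise (s := {p : G × G | sr p.1 = rg p.2})
    continuousOn_gmul continuous_snd.continuousOn hcl.measurableSet

theorem measurable_translate_right (x : G) : Measurable fun y => translate (x, y) :=
  measurable_translate.comp measurable_prodMk_left

variable [LocallyCompactSpace G] (hs : HaarSystem G)

/-- Left invariance of the Haar system, as an identity of measures. -/
theorem HaarSystem.map_translate (x : G) :
    (hs.lam (srU x)).map (fun y => translate (x, y)) = hs.lam (rgU x) := by
  refine Measure.ext fun E hE => ?_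
  rw [Measure.map_apply (measurable_translate_right x) hE, ← hs.left_invariant x E hE]
  refine measure_congr ?_
  filter_upwards [hs.ae_rg (srU x)] with y hy
  have h : sr x = rg y := hy.symm
  refine propext ⟨fun h1 => ⟨hy, ?_⟩, fun h1 => ?_⟩
  · have h2 : translate (x, y) ∈ E := h1
    rwa [translate_pos h] at h2
  · change translate (x, y) ∈ E
    rw [translate_pos h]; exact h1.2

theorem HaarSystem.integral_translate {E : Type*} [NormedAddCommGroup E] [NormedSpace ℝ E] (x : G)
    {F : G → E} (hF : AEStronglyMeasurable F (hs.lam (rgU x))) :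
    ∫ y, F (translate (x, y)) ∂(hs.lam (srU x)) = ∫ y, F y ∂(hs.lam (rgU x)) := by
  rw [← hs.map_translate x] at hF ⊢
  exact (integral_map (measurable_translate_right x).aemeasurable hF).symm

theorem HaarSystem.lintegral_translate (x : G) {F : G → ℝ≥0∞} (hF : Measurable F) :
    ∫⁻ y, F (translate (x, y)) ∂(hs.lam (srU x)) = ∫⁻ y, F y ∂(hs.lam (rgU x)) := by
  rw [← hs.map_translate x, lintegral_map hF (measurable_translate_right x)]

end Translation

/-! ### Multiplication and involution of fibres -/

section FibreMaps

variable {G : Type u} [TopologicalSpace G] [TopGroupoid G]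
variable {B : G → Type v} [∀ x, NormedAddCommGroup (B x)] [∀ x, NormedSpace ℂ (B x)]
  [TopologicalSpace (Tot B)] [FellBundle B]

/-- Multiplication of fibres as a bounded bilinear map. -/
noncomputable def bmulL {x y z : G} (h : IsMul x y z) : B x →L[ℂ] B y →L[ℂ] B z :=
  LinearMap.mkContinuous₂ (bmul h) 1 fun a b => by rw [one_mul]; exact norm_bmul_le h a b

theorem bmulL_apply {x y z : G} (h : IsMul x y z) (a : B x) (b : B y) :
    bmulL h a b = bmul h a b := rfl

theorem norm_bstar {x y : G} (h : y = ginv x) (a : B x) : ‖bstar h a‖ = ‖a‖ := by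
  -- `‖a‖² = ‖a* a‖ ≤ ‖a*‖ ‖a‖`
  have key : ∀ {x y : G} (h : y = ginv x) (a : B x), ‖a‖ ≤ ‖bstar h a‖ := by
    rintro x _ rfl a
    have h1 := norm_bmul_le (isMul_ginv_self x) (bstar rfl a) a
    rw [norm_bstar_bmul_self, sq] at h1
    rcases (norm_nonneg a).eq_or_lt with h0 | h0
    · rw [← h0]; exact norm_nonneg _
    · exact le_of_mul_le_mul_right h1 h0
  refine le_antisymm ?_ (key h a)
  have h' : x = ginv y := by rw [h, ginv_ginv]
  calc ‖bstar h a‖ ≤ ‖bstar h' (bstar h a)‖ := key h' _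
    _ = ‖a‖ := by rw [bstar_bstar]

/-- The involution of fibres as a bounded real-linear map. -/
noncomputable def bstarL {x y : G} (h : y = ginv x) : B x →L[ℝ] B y :=
  AddMonoidHom.toRealLinearMap (bstar h : B x →ₗ⋆[ℂ] B y).toAddMonoidHom
    (AddMonoidHomClass.continuous_of_bound (bstar h : B x →ₗ⋆[ℂ] B y).toAddMonoidHom 1
      fun a => by rw [one_mul]; exact (norm_bstar h a).le)

theorem bstarL_apply {x y : G} (h : y = ginv x) (a : B x) : bstarL h a = bstar h a := rfl

theorem convField_pos (f g : ∀ x, B x) {y z : G} (h : rg y = rg z) :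
    convField f g y z = bmul (isMul_ginv_gmul h) (f y) (g (gmul (ginv y) z)) := dif_pos h

theorem convField_neg (f g : ∀ x, B x) {y z : G} (h : ¬ rg y = rg z) :
    convField f g y z = 0 := dif_neg h

theorem convField_add_right (f g g' : ∀ x, B x) (y z : G) :
    convField f (g + g') y z = convField f g y z + convField f g' y z := by
  by_cases h : rg y = rg z
  · rw [convField_pos _ _ h, convField_pos _ _ h, convField_pos _ _ h, Pi.add_apply, map_add]
  · rw [convField_neg _ _ h, convField_neg _ _ h, convField_neg _ _ h, add_zero]

theorem convField_smul_right (c : ℂ) (f g : ∀ x, B x) (y z : G) :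
    convField f (c • g) y z = c • convField f g y z := by
  by_cases h : rg y = rg z
  · rw [convField_pos _ _ h, convField_pos _ _ h, Pi.smul_apply, map_smul]
  · rw [convField_neg _ _ h, convField_neg _ _ h, smul_zero]

theorem convField_add_left (f f' g : ∀ x, B x) (y z : G) :
    convField (f + f') g y z = convField f g y z + convField f' g y z := by
  by_cases h : rg y = rg z
  · rw [convField_pos _ _ h, convField_pos _ _ h, convField_pos _ _ h, Pi.add_apply,
      LinearMap.map_add₂]
  · rw [convField_neg _ _ h, convField_neg _ _ h, convField_neg _ _ h, add_zero]

theorem convField_smul_left (c : ℂ) (f g : ∀ x, B x) (y z : G) :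
    convField (c • f) g y z = c • convField f g y z := by
  by_cases h : rg y = rg z
  · rw [convField_pos _ _ h, convField_pos _ _ h, Pi.smul_apply, LinearMap.map_smul₂]
  · rw [convField_neg _ _ h, convField_neg _ _ h, smul_zero]

/-- The integrand of an iterated convolution product, translated to the source of `x`. -/
theorem convField_convField (f g h : ∀ x, B x) {x y z : G} (hx : rg x = rg z) (hy : sr x = rg y) :
    convField (convField f g x) h (gmul x y) z =
      bmul (isMul_ginv_gmul hx) (f x) (convField g h y (gmul (ginv x) z)) := by
  have h1 : sr (ginv x) = rg z := by rw [sr_ginv, hx]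
  have h2 : rg (gmul x y) = rg x := rg_gmul _ _ hy
  have h3 : rg y = rg (gmul (ginv x) z) := by rw [rg_gmul _ _ h1, rg_ginv, hy]
  rw [convField_pos _ _ (h2.trans hx), convField_pos _ _ h2.symm, convField_pos _ _ h3]
  have e1 : gmul (ginv x) (gmul x y) = y := ginv_gmul_gmul hy
  have e2 : gmul (ginv (gmul x y)) z = gmul (ginv y) (gmul (ginv x) z) := by
    rw [ginv_gmul_rev hy, gmul_assoc _ _ _ (by rw [sr_ginv, rg_ginv, hy]) h1]
  have m1 : IsMul x y (gmul x y) := ⟨hy, rfl⟩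
  have m2 : IsMul (gmul x y) (gmul (ginv y) (gmul (ginv x) z)) z := by
    rw [← e2]; exact isMul_ginv_gmul (h2.trans hx)
  rw [← bmul_assoc m1 m2 (isMul_ginv_gmul h3) (isMul_ginv_gmul hx),
    bmul_congr (isMul_ginv_gmul h2.symm) m1 (f x) g e1,
    bmul_congr (isMul_ginv_gmul (h2.trans hx)) m2 _ h e2]

theorem bmul_bstar_bstar_congr {p p' q q' x x' y y' z : G} (f g : ∀ x, B x) (hx : x = ginv p)
    (hx' : x' = ginv p') (hy : y = ginv q) (hy' : y' = ginv q') (h : IsMul x y z)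
    (h' : IsMul x' y' z) (ep : p = p') (eq : q = q') :
    bmul h (bstar hx (f p)) (bstar hy (g q)) = bmul h' (bstar hx' (f p')) (bstar hy' (g q')) := by
  subst ep; subst eq; subst hx; subst hx'; subst hy; subst hy'; rfl

theorem Gc.adj_apply (f : Gc B) (x : G) :
    f.adj x = bstar (ginv_ginv x).symm (f (ginv x)) := rfl

theorem Gc.adj_adj (f : Gc B) : f.adj.adj = f := by
  refine Gc.ext fun x => ?_
  rw [Gc.adj_apply, Gc.adj_apply]
  have : ∀ (y : G) (h₁ : ginv x = ginv y) (h₂ : x = ginv (ginv x)) (e : y = x),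
      bstar h₂ (bstar h₁ (f y)) = f x := by
    rintro y h₁ h₂ rfl
    exact bstar_bstar h₁ h₂ (f y)
  exact this _ _ _ (ginv_ginv x)

/-- The integrand of `(f * g)*`, translated to the source of `z`. -/
theorem bstar_convField (f g : Gc B) {y z : G} (h : sr z = rg y) :
    bstar (ginv_ginv z).symm (convField f.1 g.1 y (ginv z)) =
      convField g.adj.1 f.adj.1 (gmul z y) z := by
  have h1 : rg y = rg (ginv z) := by rw [rg_ginv, h]
  have h2 : rg (gmul z y) = rg z := rg_gmul _ _ h
  have h3 : ginv (gmul z y) = gmul (ginv y) (ginv z) := ginv_gmul_rev h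
  have h4 : gmul (ginv (gmul z y)) z = ginv y := by
    rw [h3, gmul_assoc _ _ _ (by rw [sr_ginv, rg_ginv, h]) (sr_ginv z), ginv_gmul, h,
      ← sr_ginv y, gmul_sr_self]
  have m : IsMul (gmul z y) (ginv y) z := by rw [← h4]; exact isMul_ginv_gmul h2
  rw [convField_pos _ _ h1, convField_pos _ _ h2,
    bstar_bmul _ (rfl : ginv y = ginv y)
      (show gmul z y = ginv (gmul (ginv y) (ginv z)) by rw [← h3, ginv_ginv]) _ m]
  exact bmul_bstar_bstar_congr g.1 f.1 _ _ _ _ _ _ h3.symm (by rw [h4, ginv_ginv])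

end FibreMaps

/-! ### The ⋆-algebra of compactly supported sections -/

section Convolution

variable {G : Type u} [TopologicalSpace G] [TopGroupoid G] [T2Space G] [LocallyCompactSpace G]
  [SecondCountableTopology G] [MeasurableSpace G] [BorelSpace G] (hs : HaarSystem G)
  {B : G → Type v} [∀ x, NormedAddCommGroup (B x)] [∀ x, NormedSpace ℂ (B x)]
  [TopologicalSpace (Tot B)] [FellBundle B]

theorem Gc.conv_apply (f g : Gc B) (z : G) :
    f.conv hs g z = ∫ y, convField f.1 g.1 y z ∂(hs.lam (rgU z)) := rfl

theorem integrable_convField (f g : Gc B) (z : G) :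
    Integrable (fun y => convField f.1 g.1 y z) (hs.lam (rgU z)) := by
  obtain ⟨K, hF⟩ := Gc.isCcField f g
  exact hF.integrable hs z

theorem Gc.conv_add (f g g' : Gc B) : f.conv hs (g + g') = f.conv hs g + f.conv hs g' := by
  refine Gc.ext fun z => ?_
  rw [Gc.add_apply, Gc.conv_apply, Gc.conv_apply, Gc.conv_apply,
    ← integral_add (integrable_convField hs f g z) (integrable_convField hs f g' z)]
  exact integral_congr_ae (ae_of_all _ fun y => convField_add_right _ _ _ _ _)

theorem Gc.conv_smul (c : ℂ) (f g : Gc B) : f.conv hs (c • g) = c • f.conv hs g := by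
  refine Gc.ext fun z => ?_
  rw [Gc.smul_apply, Gc.conv_apply, Gc.conv_apply, ← integral_smul]
  exact integral_congr_ae (ae_of_all _ fun y => convField_smul_right _ _ _ _ _)

theorem Gc.add_conv (f f' g : Gc B) : (f + f').conv hs g = f.conv hs g + f'.conv hs g := by
  refine Gc.ext fun z => ?_
  rw [Gc.add_apply, Gc.conv_apply, Gc.conv_apply, Gc.conv_apply,
    ← integral_add (integrable_convField hs f g z) (integrable_convField hs f' g z)]
  exact integral_congr_ae (ae_of_all _ fun y => convField_add_left _ _ _ _ _)

theorem Gc.smul_conv (c : ℂ) (f g : Gc B) : (c • f).conv hs g = c • f.conv hs g := by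
  refine Gc.ext fun z => ?_
  rw [Gc.smul_apply, Gc.conv_apply, Gc.conv_apply, ← integral_smul]
  exact integral_congr_ae (ae_of_all _ fun y => convField_smul_left _ _ _ _ _)

theorem Gc.adj_conv (f g : Gc B) : (f.conv hs g).adj = g.adj.conv hs f.adj := by
  refine Gc.ext fun z => ?_
  have hc := fun z => UscBanachBundle.complete (B := B) z
  have h1 : (f.conv hs g).adj z =
      ∫ y, bstarL (ginv_ginv z).symm (convField f.1 g.1 y (ginv z)) ∂(hs.lam (srU z)) := by
    rw [Gc.adj_apply, Gc.conv_apply, ← bstarL_apply, ← ContinuousLinearMap.integral_comp_comm _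
      (integrable_convField hs f g (ginv z)), rgU_ginv]
  rw [h1, Gc.conv_apply,
    ← hs.integral_translate z (integrable_convField hs g.adj f.adj z).aestronglyMeasurable]
  refine integral_congr_ae ?_
  filter_upwards [hs.ae_rg (srU z)] with y hy
  have h : sr z = rg y := hy.symm
  rw [translate_pos h, bstarL_apply, bstar_convField f g h]

/-- The integrand of `(f * g) * h` is integrable on the product space: it is continuous with compact
support on the closed set where it is given by a product. -/
theorem integrable_convField_convField (f g h : Gc B) (z : G) :
    Integrable (fun p : G × G => convField (convField f.1 g.1 p.1) h.1 p.2 z)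
      ((hs.lam (rgU z)).prod (hs.lam (rgU z))) := by
  have hfin := hs.isFiniteMeasureOnCompacts (rgU z)
  obtain ⟨f, hf, K, hK, hfK⟩ := f
  obtain ⟨g, hg, L, hL, hgL⟩ := g
  obtain ⟨h, hh, -⟩ := h
  set S : Set (G × G) := {p | rg p.1 = rg z ∧ rg p.2 = rg z} with hS
  have hScl : IsClosed S :=
    (isClosed_eq (continuous_rg.comp continuous_fst) continuous_const).inter
      (isClosed_eq (continuous_rg.comp continuous_snd) continuous_const)
  set M : Set G := (fun p : G × G => gmul p.1 p.2) '' ((K ×ˢ L) ∩ {p | sr p.1 = rg p.2}) with hM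
  have hMc : IsCompact M := by
    refine IsCompact.image_of_continuousOn ((hK.prod hL).inter_right ?_)
      (continuousOn_gmul.mono Set.inter_subset_right)
    exact isClosed_eq (continuous_sr.comp continuous_fst) (continuous_rg.comp continuous_snd)
  have hcont : ContinuousOn (fun p : G × G => convField (convField f g p.1) h p.2 z) S := by
    rw [continuousOn_iff_continuous_domRestrict, continuous_iff_continuousAt]
    rintro ⟨⟨x₀, y₀⟩, h₀⟩
    rw [ContinuousAt, ← tendsto_fibre (B := B)]
    have h12 : ∀ ω : S, rg ω.1.1 = rg ω.1.2 := fun ω => ω.2.1.trans ω.2.2.symm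
    have hm1 : ∀ ω : S, IsMul ω.1.1 (gmul (ginv ω.1.1) ω.1.2) ω.1.2 := fun ω =>
      isMul_ginv_gmul (h12 ω)
    have hm2 : ∀ ω : S, IsMul ω.1.2 (gmul (ginv ω.1.2) z) z := fun ω => isMul_ginv_gmul ω.2.2
    have e : ∀ ω : S, S.domRestrict (fun p : G × G => convField (convField f g p.1) h p.2 z) ω =
        bmul (hm2 ω) (bmul (hm1 ω) (f ω.1.1) (g (gmul (ginv ω.1.1) ω.1.2)))
          (h (gmul (ginv ω.1.2) z)) := fun ω => by
      rw [Set.domRestrict_apply, convField_pos _ _ ω.2.2, convField_pos _ _ (h12 ω)]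
    simp only [e]
    have c1 : Continuous fun ω : S => gmul (ginv ω.1.1) ω.1.2 :=
      continuousOn_gmul.comp_continuous
        (f := fun ω : S => (ginv ω.1.1, ω.1.2))
        ((continuous_ginv.comp (continuous_fst.comp continuous_subtype_val)).prodMk
          (continuous_snd.comp continuous_subtype_val))
        (fun ω => by simp [sr_ginv, h12 ω])
    have c2 : Continuous fun ω : S => gmul (ginv ω.1.2) z :=
      continuousOn_gmul.comp_continuous
        (f := fun ω : S => (ginv ω.1.2, z))
        ((continuous_ginv.comp (continuous_snd.comp continuous_subtype_val)).prodMk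
          continuous_const)
        (fun ω => by simp [sr_ginv, ω.2.2])
    refine tendsto_bmul (p := fun ω : S => ω.1.2) (q := fun ω : S => gmul (ginv ω.1.2) z)
      (m := fun _ => z) ?_ ((hh.comp c2).tendsto _) _ _
    exact tendsto_bmul (p := fun ω : S => ω.1.1) (q := fun ω : S => gmul (ginv ω.1.1) ω.1.2)
      (m := fun ω : S => ω.1.2)
      ((hf.comp (continuous_fst.comp continuous_subtype_val)).tendsto _)
      ((hg.comp c1).tendsto _) _ _
  have hcomp : IsCompact ((K ×ˢ M) ∩ S) := (hK.prod hMc).inter_right hScl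
  have h1 : IntegrableOn (fun p : G × G => convField (convField f g p.1) h p.2 z) ((K ×ˢ M) ∩ S)
      ((hs.lam (rgU z)).prod (hs.lam (rgU z))) :=
    (hcont.mono Set.inter_subset_right).integrableOn_compact hcomp
  refine (integrableOn_iff_integrable_of_support_subset ?_).1 h1
  rintro ⟨x, y⟩ hp
  simp only [Function.mem_support] at hp
  have hy : rg y = rg z := by
    by_contra hne; exact hp (convField_neg _ _ hne)
  have hxy : rg x = rg y := by
    by_contra hne
    refine hp ?_
    rw [convField_pos _ _ hy, convField_neg _ _ hne, LinearMap.map_zero₂]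
  rw [convField_pos _ _ hy, convField_pos _ _ hxy] at hp
  have hx : x ∈ K := by
    by_contra hne
    exact hp (by rw [hfK x hne, LinearMap.map_zero₂, LinearMap.map_zero₂])
  have hxy' : gmul (ginv x) y ∈ L := by
    by_contra hne
    exact hp (by rw [hgL _ hne, map_zero, LinearMap.map_zero₂])
  have hm := isMul_ginv_gmul hxy
  exact ⟨⟨hx, ⟨(x, gmul (ginv x) y), ⟨⟨hx, hxy'⟩, hm.1⟩, hm.2⟩⟩, hxy.trans hy, hy⟩

theorem Gc.conv_assoc (f g h : Gc B) : (f.conv hs g).conv hs h = f.conv hs (g.conv hs h) := by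
  refine Gc.ext fun z => ?_
  have hc := fun z => UscBanachBundle.complete (B := B) z
  have hfin := hs.isFiniteMeasureOnCompacts (rgU z)
  have hint := integrable_convField_convField hs f g h z
  set μ := hs.lam (rgU z) with hμ
  have hl : (f.conv hs g).conv hs h z =
      ∫ y, ∫ x, convField (convField f.1 g.1 x) h.1 y z ∂μ ∂μ := by
    rw [Gc.conv_apply]
    refine integral_congr_ae ?_
    filter_upwards [hs.ae_rg (rgU z)] with y hy
    have hy : rg y = rg z := hy
    have hyU : rgU y = rgU z := Subtype.ext hy
    simp only [convField_pos _ _ hy]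
    have h1 := ((bmulL (isMul_ginv_gmul hy)).flip (h.1 (gmul (ginv y) z))).integral_comp_comm
      (integrable_convField hs f g y)
    rw [hyU, ← hμ] at h1
    refine Eq.trans ?_ h1.symm
    rw [ContinuousLinearMap.flip_apply, bmulL_apply]
    have h2 : (f.conv hs g).1 y = ∫ x, convField f.1 g.1 x y ∂μ := by
      rw [hμ, ← hyU]; rfl
    rw [h2]
  have hr : f.conv hs (g.conv hs h) z =
      ∫ x, ∫ y, convField (convField f.1 g.1 x) h.1 y z ∂μ ∂μ := by
    rw [Gc.conv_apply]
    refine integral_congr_ae ?_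
    filter_upwards [hs.ae_rg (rgU z), hint.prod_right_ae] with x hx hx'
    have hx : rg x = rg z := hx
    have hxU : rgU x = rgU z := Subtype.ext hx
    have hxU' : rgU (gmul (ginv x) z) = srU x :=
      Subtype.ext (by change rg _ = sr x; rw [rg_gmul _ _ (by rw [sr_ginv, hx]), rg_ginv])
    have h1 := (bmulL (isMul_ginv_gmul hx) (f.1 x)).integral_comp_comm
      (integrable_convField hs g h (gmul (ginv x) z))
    rw [convField_pos _ _ hx]
    refine Eq.trans h1.symm ?_
    rw [hμ, ← hxU] at hx' ⊢
    rw [← hs.integral_translate x hx'.aestronglyMeasurable, hxU']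
    refine integral_congr_ae ?_
    filter_upwards [hs.ae_rg (srU x)] with y hy
    have hy : sr x = rg y := hy.symm
    rw [translate_pos hy, convField_convField f.1 g.1 h.1 hx hy, bmulL_apply]
  rw [hl, hr]
  exact (integral_integral_swap hint).symm

end Convolution

/-! ### Estimates by the `I`-norm -/

section INorm

variable {G : Type u} [TopologicalSpace G] [TopGroupoid G] [T2Space G] [LocallyCompactSpace G]
  [SecondCountableTopology G] [MeasurableSpace G] [BorelSpace G] (hs : HaarSystem G)
  {B : G → Type v} [∀ x, NormedAddCommGroup (B x)] [∀ x, NormedSpace ℂ (B x)]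
  [TopologicalSpace (Tot B)] [FellBundle B]

theorem Gc.measurable_enorm (f : Gc B) : Measurable fun x => ‖f x‖ₑ := by
  have h1 : UpperSemicontinuous fun x => ‖f x‖ :=
    UpperSemicontinuous.comp (usc_norm (B := B)) f.2.1
  have h2 : (fun x => ‖f x‖ₑ) = fun x => ENNReal.ofReal ‖f x‖ :=
    funext fun x => (ofReal_norm (f x)).symm
  rw [h2]
  exact h1.measurable.ennreal_ofReal

theorem enorm_adj_ginv (f : Gc B) (x : G) : ‖f.adj (ginv x)‖ₑ = ‖f x‖ₑ := by
  have h : ∀ (y : G) (h : ginv x = ginv y) (e : y = x), ‖bstar h (f y)‖ₑ = ‖f x‖ₑ := by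
    rintro y h rfl
    rw [← ofReal_norm, ← ofReal_norm, norm_bstar]
  exact h _ _ (ginv_ginv x)

theorem lintegral_lamInv (f : Gc B) (w : UnitSpace G) :
    ∫⁻ x, ‖f x‖ₑ ∂(hs.lamInv w) = ∫⁻ x, ‖f.adj x‖ₑ ∂(hs.lam w) := by
  rw [HaarSystem.lamInv, lintegral_map f.measurable_enorm continuous_ginv.measurable]
  refine lintegral_congr fun x => ?_
  rw [← enorm_adj_ginv f (ginv x), ginv_ginv]

theorem lintegral_le_iNorm (f : Gc B) (w : UnitSpace G) :
    ∫⁻ x, ‖f x‖ₑ ∂(hs.lam w) ≤ iNorm hs f :=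
  (le_max_left _ _).trans (le_iSup (fun w : UnitSpace G =>
    max (∫⁻ x, ‖f x‖ₑ ∂(hs.lam w)) (∫⁻ x, ‖f x‖ₑ ∂(hs.lamInv w))) w)

theorem lintegral_lamInv_le_iNorm (f : Gc B) (w : UnitSpace G) :
    ∫⁻ x, ‖f x‖ₑ ∂(hs.lamInv w) ≤ iNorm hs f :=
  (le_max_right _ _).trans (le_iSup (fun w : UnitSpace G =>
    max (∫⁻ x, ‖f x‖ₑ ∂(hs.lam w)) (∫⁻ x, ‖f x‖ₑ ∂(hs.lamInv w))) w)

theorem iNorm_adj (f : Gc B) : iNorm hs f.adj = iNorm hs f := by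
  simp only [iNorm, lintegral_lamInv, Gc.adj_adj]
  exact iSup_congr fun w => max_comm _ _

theorem enorm_convField_le (f g : Gc B) {y z : G} (h : rg y = rg z) :
    ‖convField f.1 g.1 y z‖ₑ ≤ ‖f y‖ₑ * ‖g (translate (ginv y, z))‖ₑ := by
  rw [convField_pos _ _ h, translate_pos (by rw [sr_ginv, h]), ← ofReal_norm, ← ofReal_norm,
    ← ofReal_norm, ← ENNReal.ofReal_mul (norm_nonneg _)]
  exact ENNReal.ofReal_le_ofReal (norm_bmul_le _ _ _)

theorem enorm_conv_le (f g : Gc B) (z : G) : ‖f.conv hs g z‖ₑ ≤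
    ∫⁻ y, ‖f y‖ₑ * ‖g (translate (ginv y, z))‖ₑ ∂(hs.lam (rgU z)) := by
  rw [Gc.conv_apply]
  refine (enorm_integral_le_lintegral_enorm _).trans (lintegral_mono_ae ?_)
  filter_upwards [hs.ae_rg (rgU z)] with y hy
  exact enorm_convField_le f g hy

theorem lintegral_conv_le (f g : Gc B) (w : UnitSpace G) :
    ∫⁻ z, ‖f.conv hs g z‖ₑ ∂(hs.lam w) ≤ iNorm hs f * iNorm hs g := by
  have hfin := hs.isFiniteMeasureOnCompacts w
  have hmeas : Measurable fun p : G × G => ‖f p.2‖ₑ * ‖g (translate (ginv p.2, p.1))‖ₑ :=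
    (f.measurable_enorm.comp measurable_snd).mul (g.measurable_enorm.comp
      (measurable_translate.comp
        ((continuous_ginv.measurable.comp measurable_snd).prodMk measurable_fst)))
  calc ∫⁻ z, ‖f.conv hs g z‖ₑ ∂(hs.lam w)
      ≤ ∫⁻ z, ∫⁻ y, ‖f y‖ₑ * ‖g (translate (ginv y, z))‖ₑ ∂(hs.lam w) ∂(hs.lam w) := by
        refine lintegral_mono_ae ?_
        filter_upwards [hs.ae_rg w] with z hz
        have hz : rgU z = w := Subtype.ext hz
        rw [← hz]
        exact enorm_conv_le hs f g z
    _ = ∫⁻ y, ∫⁻ z, ‖f y‖ₑ * ‖g (translate (ginv y, z))‖ₑ ∂(hs.lam w) ∂(hs.lam w) :=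
        lintegral_lintegral_swap hmeas.aemeasurable
    _ ≤ ∫⁻ y, ‖f y‖ₑ * iNorm hs g ∂(hs.lam w) := by
        refine lintegral_mono_ae ?_
        filter_upwards [hs.ae_rg w] with y hy
        have hy : srU (ginv y) = w := Subtype.ext ((sr_ginv y).trans hy)
        have h1 : Measurable fun z => ‖g (translate (ginv y, z))‖ₑ :=
          g.measurable_enorm.comp (measurable_translate_right _)
        have h2 := hs.lintegral_translate (ginv y) g.measurable_enorm
        rw [lintegral_const_mul _ h1, ← hy, h2]
        gcongr
        exact lintegral_le_iNorm hs g _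
    _ = (∫⁻ y, ‖f y‖ₑ ∂(hs.lam w)) * iNorm hs g := lintegral_mul_const _ f.measurable_enorm
    _ ≤ iNorm hs f * iNorm hs g := by
        gcongr
        exact lintegral_le_iNorm hs f w

/-- The `I`-norm is submultiplicative. -/
theorem iNorm_conv_le (f g : Gc B) : iNorm hs (f.conv hs g) ≤ iNorm hs f * iNorm hs g := by
  refine iSup_le fun w => max_le (lintegral_conv_le hs f g w) ?_
  rw [lintegral_lamInv, Gc.adj_conv]
  refine (lintegral_conv_le hs g.adj f.adj w).trans ?_
  rw [iNorm_adj, iNorm_adj, mul_comm]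

theorem toReal_iNorm_conv_le (f g : Gc B) :
    (iNorm hs (f.conv hs g)).toReal ≤ (iNorm hs f).toReal * (iNorm hs g).toReal := by
  rw [← ENNReal.toReal_mul]
  exact ENNReal.toReal_mono (ENNReal.mul_lt_top (iNorm_lt_top hs f) (iNorm_lt_top hs g)).ne
    (iNorm_conv_le hs f g)

theorem norm_conv_apply_le (f g : Gc B) {D : ℝ} (hD0 : 0 ≤ D) (hD : ∀ x, ‖g x‖ ≤ D) (z : G) :
    ‖f.conv hs g z‖ ≤ (iNorm hs f).toReal * D := by
  have h1 : ‖f.conv hs g z‖ₑ ≤ iNorm hs f * ENNReal.ofReal D := by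
    refine (enorm_conv_le hs f g z).trans ?_
    calc _ ≤ ∫⁻ y, ‖f y‖ₑ * ENNReal.ofReal D ∂(hs.lam (rgU z)) := by
          refine lintegral_mono fun y => ?_
          rw [← ofReal_norm (g _)]
          gcongr
          exact hD _
      _ = (∫⁻ y, ‖f y‖ₑ ∂(hs.lam (rgU z))) * ENNReal.ofReal D :=
          lintegral_mul_const _ f.measurable_enorm
      _ ≤ _ := by gcongr; exact lintegral_le_iNorm hs f _
  have h2 := ENNReal.toReal_mono
    (ENNReal.mul_lt_top (iNorm_lt_top hs f) ENNReal.ofReal_lt_top).ne h1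
  rwa [toReal_enorm, ENNReal.toReal_mul, ENNReal.toReal_ofReal hD0] at h2

theorem norm_ipField_self_le (f : Gc B) (w : UnitSpace G) (y : G) :
    ‖ipField f.1 f.1 w y‖ ≤ ‖f y‖ * ‖f y‖ := by
  by_cases h : sr y = w.1
  · rw [ipField_pos _ _ h]
    refine (norm_bmul_le (isMul_ginv_unit h) _ _).trans ?_
    rw [norm_bstar]
  · rw [ipField_neg _ _ h, norm_zero]
    positivity

theorem UnitAlg.norm_le {a : UnitAlg B} {C : ℝ} (hC : 0 ≤ C) (h : ∀ w, ‖a.val w‖ ≤ C) : ‖a‖ ≤ C :=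
  lp.norm_le_of_forall_le (f := (Subtype.val a : lp (UFib B) ∞)) hC h

theorem Gc.norm_ip_self_le (f : Gc B) {C : ℝ} (hC0 : 0 ≤ C) (hC : ∀ x, ‖f x‖ ≤ C) :
    ‖f.ip hs f‖ ≤ C * (iNorm hs f).toReal := by
  refine UnitAlg.norm_le (by positivity) fun w => ?_
  have h1 : ‖(f.ip hs f).val w‖ₑ ≤ ENNReal.ofReal C * iNorm hs f := by
    rw [Gc.ip_val]
    refine (enorm_integral_le_lintegral_enorm _).trans ?_
    calc _ ≤ ∫⁻ y, ENNReal.ofReal C * ‖f y‖ₑ ∂(hs.lamInv w) := by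
          refine lintegral_mono fun y => ?_
          rw [← ofReal_norm, ← ofReal_norm, ← ENNReal.ofReal_mul hC0]
          refine ENNReal.ofReal_le_ofReal ((norm_ipField_self_le f w y).trans ?_)
          gcongr
          exact hC y
      _ = ENNReal.ofReal C * ∫⁻ y, ‖f y‖ₑ ∂(hs.lamInv w) :=
          lintegral_const_mul _ f.measurable_enorm
      _ ≤ _ := by gcongr; exact lintegral_lamInv_le_iNorm hs f w
  have h2 := ENNReal.toReal_mono
    (ENNReal.mul_lt_top ENNReal.ofReal_lt_top (iNorm_lt_top hs f)).ne h1
  rwa [toReal_enorm, ENNReal.toReal_mul, ENNReal.toReal_ofReal hC0] at h2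

/-- A crude bound for `‖f * φ‖` in `X`, with a constant that depends on `φ`. -/
theorem exists_norm_ip_conv_le (φ : Gc B) : ∃ C : ℝ, 0 ≤ C ∧ ∀ f : Gc B,
    ‖(f.conv hs φ).ip hs (f.conv hs φ)‖ ≤ (C * (iNorm hs f).toReal) ^ 2 := by
  obtain ⟨D, hD0, hD⟩ := φ.exists_bound
  refine ⟨√(D * (iNorm hs φ).toReal), Real.sqrt_nonneg _, fun f => ?_⟩
  rw [mul_pow, Real.sq_sqrt (by positivity)]
  have hN : 0 ≤ (iNorm hs f).toReal := ENNReal.toReal_nonneg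
  refine (Gc.norm_ip_self_le hs (f.conv hs φ) (mul_nonneg hN hD0)
    (norm_conv_apply_le hs f φ hD0 hD)).trans ?_
  calc _ ≤ (iNorm hs f).toReal * D * ((iNorm hs f).toReal * (iNorm hs φ).toReal) := by
        gcongr; exact toReal_iNorm_conv_le hs f φ
    _ = _ := by ring

end INorm

/-! ### Boundedness of convolution on the Hilbert module -/

section ModuleX

variable {G : Type u} [TopologicalSpace G] [TopGroupoid G] [T2Space G] [LocallyCompactSpace G]
  [SecondCountableTopology G] [MeasurableSpace G] [BorelSpace G] (hs : HaarSystem G)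
  {B : G → Type v} [∀ x, NormedAddCommGroup (B x)] [∀ x, NormedSpace ℂ (B x)]
  [TopologicalSpace (Tot B)] [FellBundle B]

theorem Gc.ip_eq_conv_val (f g : Gc B) (w : UnitSpace G) :
    (f.ip hs g).val w = (f.adj.conv hs g) w.1 := integral_ipField hs f g w

/-- Convolution by `f*` is the formal adjoint of convolution by `f`. -/
theorem Gc.ip_conv (f φ ψ : Gc B) : (f.conv hs φ).ip hs ψ = φ.ip hs (f.adj.conv hs ψ) := by
  refine UnitAlg.ext fun w => ?_
  rw [Gc.ip_eq_conv_val, Gc.ip_eq_conv_val, Gc.adj_conv, Gc.conv_assoc]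

/-- An element of `Γ_c(G; B)` as a vector of the pre-Hilbert module. -/
def Gc.toPreX (f : Gc B) : PreX hs B := f

theorem Gc.norm_toPreX_sq (f : Gc B) : ‖f.toPreX hs‖ ^ 2 = ‖f.ip hs f‖ :=
  HilbertModule.norm_sq_eq (A := UnitAlg B) (f.toPreX hs)

theorem Gc.norm_ip_le (f g : Gc B) : ‖f.ip hs g‖ ≤ ‖f.toPreX hs‖ * ‖g.toPreX hs‖ :=
  FellBundles.norm_ip_le (A := UnitAlg B) (f.toPreX hs) (g.toPreX hs)

/-- If `a n ≤ C * M ^ 2ⁿ` and `a n ^ 2 ≤ p * a (n + 1)`, then iteration of the latter inequality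
gives `(a 0 / p) ^ 2ⁿ ≤ (C / p) * M ^ 2ⁿ`, and the constant disappears as `n → ∞`. -/
theorem le_mul_of_sq_le {a : ℕ → ℝ} {p C M : ℝ} (ha : ∀ n, 0 ≤ a n) (hp : 0 ≤ p) (hM : 0 ≤ M)
    (h : ∀ n, a n ^ 2 ≤ p * a (n + 1)) (hC : ∀ n, a n ≤ C * M ^ 2 ^ n) : a 0 ≤ p * M := by
  rcases hM.eq_or_lt with rfl | hM
  · simpa using hC 0
  rcases hp.eq_or_lt with rfl | hp
  · have h0 := h 0
    rw [zero_mul] at h0 ⊢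
    exact (pow_eq_zero_iff two_ne_zero |>.1 (le_antisymm h0 (sq_nonneg _))).le
  have key : ∀ n, (a 0 / p) ^ 2 ^ n ≤ a n / p := by
    intro n
    induction n with
    | zero => simp
    | succ n ih =>
      have h0 : 0 ≤ a 0 / p := div_nonneg (ha 0) hp.le
      calc (a 0 / p) ^ 2 ^ (n + 1) = ((a 0 / p) ^ 2 ^ n) ^ 2 := by rw [← pow_mul, pow_succ]
        _ ≤ (a n / p) ^ 2 := by gcongr
        _ = a n ^ 2 / (p * p) := by rw [div_pow, sq p]
        _ ≤ p * a (n + 1) / (p * p) := by gcongr; exact h n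
        _ = a (n + 1) / p := by field_simp
  by_contra! hcon
  have hr : 1 < a 0 / p / M := by
    rw [div_div, one_lt_div (by positivity)]; exact hcon
  obtain ⟨n, hn⟩ := pow_unbounded_of_one_lt (C / p) hr
  have h1 : (a 0 / p / M) ^ n ≤ (a 0 / p / M) ^ 2 ^ n :=
    pow_le_pow_right₀ hr.le Nat.lt_two_pow_self.le
  have h2 : (a 0 / p / M) ^ 2 ^ n ≤ C / p := by
    rw [div_pow, div_le_iff₀ (by positivity)]
    calc _ ≤ a n / p := key n
      _ ≤ C * M ^ 2 ^ n / p := by gcongr; exact hC n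
      _ = _ := by ring
  linarith

/-- Convolution by `f` on `X` is bounded by the `I`-norm of `f`. For `g = f* * f` and its iterated
squares `gₙ`, the crude bound `‖gₙ * φ‖ ≤ C ‖g‖_I ^ 2ⁿ` improves to `‖g * φ‖ ≤ ‖φ‖ ‖g‖_I`. -/
theorem Gc.norm_conv_toPreX_le (f φ : Gc B) :
    ‖(f.conv hs φ).toPreX hs‖ ≤ (iNorm hs f).toReal * ‖φ.toPreX hs‖ := by
  obtain ⟨C, hC0, hC⟩ := exists_norm_ip_conv_le hs φ
  let g : ℕ → Gc B := fun n => Nat.rec (f.adj.conv hs f) (fun _ k => k.conv hs k) n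
  have hg0 : g 0 = f.adj.conv hs f := rfl
  have hgs : ∀ n, g (n + 1) = (g n).conv hs (g n) := fun n => rfl
  have hadj : ∀ n, (g n).adj = g n := by
    intro n
    induction n with
    | zero => rw [hg0, Gc.adj_conv, Gc.adj_adj]
    | succ n ih => rw [hgs, Gc.adj_conv, ih]
  set N : ℝ := (iNorm hs f).toReal with hN
  have hN0 : 0 ≤ N := ENNReal.toReal_nonneg
  have hgN : ∀ n, (iNorm hs (g n)).toReal ≤ (N ^ 2) ^ 2 ^ n := by
    intro n
    induction n with
    | zero =>
      rw [hg0, pow_zero, pow_one]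
      refine (toReal_iNorm_conv_le hs _ _).trans ?_
      rw [iNorm_adj, sq]
    | succ n ih =>
      rw [hgs]
      refine (toReal_iNorm_conv_le hs _ _).trans ?_
      rw [pow_succ 2 n, pow_mul, sq ((N ^ 2) ^ 2 ^ n)]
      gcongr
  have h1 : ‖((g 0).conv hs φ).toPreX hs‖ ≤ ‖φ.toPreX hs‖ * N ^ 2 := by
    refine le_mul_of_sq_le (a := fun n => ‖((g n).conv hs φ).toPreX hs‖) (C := C)
      (fun n => norm_nonneg _) (norm_nonneg _) (by positivity) (fun n => ?_) fun n => ?_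
    · rw [Gc.norm_toPreX_sq, Gc.ip_conv, hadj, ← Gc.conv_assoc, ← hgs]
      exact Gc.norm_ip_le hs _ _
    · refine (pow_le_pow_iff_left₀ (norm_nonneg _) (by positivity) two_ne_zero).1 ?_
      rw [Gc.norm_toPreX_sq]
      refine (hC (g n)).trans ?_
      gcongr
      exact hgN n
  refine (pow_le_pow_iff_left₀ (norm_nonneg _) (by positivity) two_ne_zero).1 ?_
  rw [Gc.norm_toPreX_sq, Gc.ip_conv, ← Gc.conv_assoc, ← hg0]
  refine (Gc.norm_ip_le hs _ _).trans ?_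
  calc _ ≤ ‖φ.toPreX hs‖ * (‖φ.toPreX hs‖ * N ^ 2) := by gcongr
    _ = _ := by ring

end ModuleX

/-! ### Extension of adjointable operators to completions -/

open UniformSpace PreHilbertModule
open scoped CStarAlgebra

section Completion

variable {A E : Type*} [NonUnitalCStarAlgebra A] [PartialOrder A] [StarOrderedRing A]
    [NormedAddCommGroup E] [NormedSpace ℂ E] [HilbertModule A E]

theorem ip_completion {S T : E →L[ℂ] E} (h : ∀ x y, (ip (S x) y : A) = ip x (T y))
    (x y : Completion E) : (ip (S.completion x) y : A) = ip x (T.completion y) := by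
  induction x, y using Completion.induction_on₂ with
  | hp =>
    exact isClosed_eq
      (continuous_ipCompl' (S.completion.continuous.comp continuous_fst) continuous_snd)
      (continuous_ipCompl' continuous_fst (T.completion.continuous.comp continuous_snd))
  | ih x y =>
    rw [ContinuousLinearMap.completion_apply_coe, ContinuousLinearMap.completion_apply_coe, ip_coe,
      ip_coe, h]

/-- The extension to the completion of an operator on a pre-Hilbert module that has an adjoint. -/
noncomputable def Adjointable.ofPre (S T : E →L[ℂ] E) (h : ∀ x y, (ip (S x) y : A) = ip x (T y)) :
    Adjointable A (Completion E) :=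
  ⟨S.completion, T.completion, ip_completion h⟩

theorem Adjointable.ofPre_coe {S T : E →L[ℂ] E} (h : ∀ x y, (ip (S x) y : A) = ip x (T y))
    (x : E) : Adjointable.ofPre S T h (x : Completion E) = (S x : Completion E) :=
  ContinuousLinearMap.completion_apply_coe _ _

theorem Adjointable.star_ofPre {S T : E →L[ℂ] E} (h : ∀ x y, (ip (S x) y : A) = ip x (T y))
    (h' : ∀ x y, (ip (T x) y : A) = ip x (S y)) :
    star (Adjointable.ofPre S T h) = Adjointable.ofPre T S h' :=
  Adjointable.eq_star (ip_completion h)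

theorem Adjointable.norm_ofPre_le {S T : E →L[ℂ] E} (h : ∀ x y, (ip (S x) y : A) = ip x (T y)) :
    ‖Adjointable.ofPre S T h‖ ≤ ‖S‖ := by
  refine ContinuousLinearMap.opNorm_le_bound _ (norm_nonneg _) fun x => ?_
  change ‖S.completion x‖ ≤ _
  induction x using Completion.induction_on with
  | hp => exact isClosed_le S.completion.continuous.norm (continuous_const.mul continuous_norm)
  | ih x =>
    rw [ContinuousLinearMap.completion_apply_coe, Completion.norm_coe, Completion.norm_coe]
    exact S.le_opNorm x

/-- Adjointable operators on a completion are determined by their values on the dense subspace. -/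
theorem Adjointable.ext_coe {S T : Adjointable A (Completion E)}
    (h : ∀ x : E, S (x : Completion E) = T (x : Completion E)) : S = T := by
  refine Adjointable.ext fun x => ?_
  induction x using Completion.induction_on with
  | hp => exact isClosed_eq S.1.continuous T.1.continuous
  | ih x => exact h x

end Completion

section IndHom

variable {A : Type*} [NonUnitalCStarAlgebra A] [PartialOrder A] [StarOrderedRing A]
    {E : Type*} [NormedAddCommGroup E] [NormedSpace ℂ E] [HilbertModule A E] [CompleteSpace E]
    {H : Type*} [NormedAddCommGroup H] [InnerProductSpace ℂ H] [CompleteSpace H]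
    (π : A →⋆ₙₐ[ℂ] (H →L[ℂ] H))

/-- The homomorphism `T ↦ T ⊗ 1` as a linear map. -/
noncomputable def indHomL : Adjointable A E →ₗ[ℂ] (IndSpace E π →L[ℂ] IndSpace E π) where
  toFun T := indHom π T
  map_add' S T := map_add (indHom π) S T
  map_smul' c T := map_smul (indHom π) c T

theorem indHomL_mul (S T : Adjointable A E) : indHomL π (S * T) = indHomL π S * indHomL π T :=
  map_mul (indHom π) S T

theorem indHomL_star (T : Adjointable A E) : indHomL π (star T) = star (indHomL π T) :=
  map_star (indHom π) T

theorem norm_indHomL_le (T : Adjointable A E) : ‖indHomL π T‖ ≤ ‖T‖ :=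
  NonUnitalStarAlgHom.norm_apply_le (indHom π) T

end IndHom

/-! ### The homomorphism into the adjointable operators -/

section Lift

variable {M N P : Type*} [NonUnitalNonAssocSemiring M] [DistribMulAction ℂ M] [Star M]
  [NonUnitalNonAssocSemiring N] [DistribMulAction ℂ N] [Star N]
  [NonUnitalNonAssocSemiring P] [DistribMulAction ℂ P] [Star P]

/-- A map `s` whose composition with an injective ⋆-homomorphism `ψ` is a ⋆-homomorphism `φ` is
itself a ⋆-homomorphism. -/
def liftInjective (φ : M →⋆ₙₐ[ℂ] P) (ψ : N →⋆ₙₐ[ℂ] P) (hψ : Function.Injective ψ) (s : M → N)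
    (hs : ∀ a, ψ (s a) = φ a) : M →⋆ₙₐ[ℂ] N where
  toFun := s
  map_smul' c a := hψ (by rw [hs, map_smul, map_smul, hs]; rfl)
  map_zero' := hψ (by rw [hs, map_zero, map_zero])
  map_add' a b := hψ (by rw [hs, map_add, map_add, hs, hs])
  map_mul' a b := hψ (by rw [hs, map_mul, map_mul, hs, hs])
  map_star' a := hψ (by rw [hs, map_star, map_star, hs])

end Lift

section RegularRepresentation

variable {G : Type u} [TopologicalSpace G] [TopGroupoid G] [T2Space G] [LocallyCompactSpace G]
  [SecondCountableTopology G] [MeasurableSpace G] [BorelSpace G] (hs : HaarSystem G)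
  {B : G → Type v} [∀ x, NormedAddCommGroup (B x)] [∀ x, NormedSpace ℂ (B x)]
  [TopologicalSpace (Tot B)] [FellBundle B]

/-- Convolution by `f` on the pre-Hilbert module `Γ_c(G; B)`. -/
noncomputable def convPreX (f : Gc B) : PreX hs B →L[ℂ] PreX hs B :=
  LinearMap.mkContinuous
    { toFun := fun φ => (Gc.conv hs f φ).toPreX hs
      map_add' := fun φ ψ => Gc.conv_add hs f φ ψ
      map_smul' := fun c φ => Gc.conv_smul hs c f φ }
    (iNorm hs f).toReal fun φ => Gc.norm_conv_toPreX_le hs f φ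

theorem ip_convPreX (f : Gc B) (φ ψ : PreX hs B) :
    (ip (convPreX hs f φ) ψ : UnitAlg B) = ip φ (convPreX hs f.adj ψ) :=
  Gc.ip_conv hs f φ ψ

/-- Convolution by `f` as an adjointable operator on `X`. -/
noncomputable def convX (f : Gc B) : Adjointable (UnitAlg B) (ModX hs B) :=
  Adjointable.ofPre (convPreX hs f) (convPreX hs f.adj) (ip_convPreX hs f)

theorem convX_toX (f φ : Gc B) : convX hs f (φ.toX hs) = (f.conv hs φ).toX hs :=
  Adjointable.ofPre_coe (ip_convPreX hs f) (φ.toPreX hs)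

theorem Adjointable.ext_toX {S T : Adjointable (UnitAlg B) (ModX hs B)}
    (h : ∀ φ : Gc B, S (φ.toX hs) = T (φ.toX hs)) : S = T :=
  Adjointable.ext_coe h

theorem Gc.toX_add (f g : Gc B) : (f + g).toX hs = f.toX hs + g.toX hs :=
  Completion.coe_add (α := PreX hs B) f g

theorem Gc.toX_smul (c : ℂ) (f : Gc B) : (c • f).toX hs = c • f.toX hs :=
  Completion.coe_smul (X := PreX hs B) c f

theorem convX_add (f g : Gc B) : convX hs (f + g) = convX hs f + convX hs g :=
  Adjointable.ext_toX hs fun φ => by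
    rw [Adjointable.add_apply, convX_toX, convX_toX, convX_toX, Gc.add_conv, Gc.toX_add]

theorem convX_smul (c : ℂ) (f : Gc B) : convX hs (c • f) = c • convX hs f :=
  Adjointable.ext_toX hs fun φ => by
    rw [Adjointable.smul_apply, convX_toX, convX_toX, Gc.smul_conv, Gc.toX_smul]

theorem convX_conv (f g : Gc B) : convX hs (f.conv hs g) = convX hs f * convX hs g :=
  Adjointable.ext_toX hs fun φ => by
    rw [Adjointable.mul_apply, convX_toX, convX_toX, convX_toX, Gc.conv_assoc]

theorem convX_adj (f : Gc B) : convX hs f.adj = star (convX hs f) := by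
  have h : ∀ φ ψ : PreX hs B,
      (ip (convPreX hs f.adj φ) ψ : UnitAlg B) = ip φ (convPreX hs f ψ) := fun φ ψ => by
    rw [ip_convPreX, Gc.adj_adj]
  rw [convX, convX, Adjointable.star_ofPre (ip_convPreX hs f) h]
  congr 1
  rw [Gc.adj_adj]

theorem norm_convX_le (f : Gc B) : ‖convX hs f‖ ≤ (iNorm hs f).toReal :=
  (Adjointable.norm_ofPre_le _).trans
    (LinearMap.mkContinuous_norm_le _ ENNReal.toReal_nonneg _)

variable (B) in
/-- The representation of `Γ_c(G; B)` on `X` by convolution. -/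
noncomputable def convXL : Gc B →ₗ[ℂ] Adjointable (UnitAlg B) (ModX hs B) where
  toFun f := convX hs f
  map_add' := convX_add hs
  map_smul' := convX_smul hs

theorem convXL_apply (f : Gc B) : convXL hs B f = convX hs f := rfl

/-- A representation `π` of `A` induces an `I`-norm decreasing representation of `Γ_c(G; B)`. -/
noncomputable def UnitRep.rep (π : UnitRep B) : Rep hs B where
  H := IndSpace (ModX hs B) π.hom
  L := indHomL π.hom ∘ₗ convXL hs B
  map_conv f g := by
    rw [LinearMap.comp_apply, LinearMap.comp_apply, LinearMap.comp_apply, convXL_apply,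
      convXL_apply, convXL_apply, convX_conv, indHomL_mul]
  map_adj f := by
    rw [LinearMap.comp_apply, LinearMap.comp_apply, convXL_apply,
      convXL_apply, convX_adj, indHomL_star]
  bound f := by
    rw [← ENNReal.ofReal_toReal (iNorm_lt_top hs f).ne, ← ofReal_norm]
    exact ENNReal.ofReal_le_ofReal ((norm_indHomL_le π.hom _).trans (norm_convX_le hs f))

/-- The value of an element of `C⋆(G; B)` in a representation of `Γ_c(G; B)`. -/
def FullCstar.coord (a : FullCstar hs B) (L : Rep hs B) : L.H →L[ℂ] L.H :=
  (Subtype.val (Subtype.val a : RepProd hs B) : ∀ L : Rep hs B, L.H →L[ℂ] L.H) L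

variable (B) in
/-- The representation of `C⋆(G; B)` on the product of all the spaces `X ⊗_π H`. -/
noncomputable def inducedFamily : FullCstar hs B →⋆ₙₐ[ℂ] IndProd B (ModX hs B) where
  toFun a := ⟨fun π => FullCstar.coord hs a (π.rep hs), memℓp_infty ⟨‖a‖, by
    rintro _ ⟨π, rfl⟩
    exact lp.norm_apply_le_norm ENNReal.top_ne_zero
      (Subtype.val a : lp (fun L : Rep hs B => L.H →L[ℂ] L.H) ∞) (π.rep hs)⟩⟩
  map_smul' c a := rfl
  map_zero' := rfl
  map_add' a b := rfl
  map_mul' a b := rfl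
  map_star' a := rfl

theorem inducedFamily_toFull (f : Gc B) :
    inducedFamily hs B (f.toFull hs) = indFamily B (ModX hs B) (convX hs f) := rfl

theorem denseRange_toFull : DenseRange fun f : Gc B => f.toFull hs := by
  intro a
  refine (Topology.IsInducing.subtypeVal.closure_eq_preimage_closure_image
    (Set.range fun f : Gc B => f.toFull hs)).ge ?_
  have h : (Subtype.val '' Set.range fun f : Gc B => f.toFull hs) =
      (univImage hs B : Set (RepProd hs B)) := (Set.range_comp _ _).symm
  have ha : a.1 ∈ closure (univImage hs B : Set (RepProd hs B)) := a.2
  exact h ▸ ha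

theorem inducedFamily_mem_range (a : FullCstar hs B) :
    inducedFamily hs B a ∈ Set.range (indFamily B (ModX hs B)) := by
  refine (denseRange_toFull hs).induction_on
    (p := fun a => inducedFamily hs B a ∈ Set.range (indFamily B (ModX hs B))) a ?_ fun f => ?_
  · exact isClosed_range_indFamily.preimage
      (map_continuous (inducedFamily hs B))
  · exact ⟨convX hs f, (inducedFamily_toFull hs f).symm⟩

variable (B) in
/-- The homomorphism `V : C⋆(G; B) → L(X)`. The family of all induced representations maps `C⋆(G; B)`
into the range of the embedding `T ↦ (T ⊗ 1)` of `L(X)`, whose inverse is applied. -/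
noncomputable def regularRep : FullCstar hs B →⋆ₙₐ[ℂ] Adjointable (UnitAlg B) (ModX hs B) :=
  liftInjective (inducedFamily hs B) (indFamily B (ModX hs B)) indFamily_injective
    (fun a => (inducedFamily_mem_range hs a).choose)
    fun a => (inducedFamily_mem_range hs a).choose_spec

theorem indFamily_regularRep (a : FullCstar hs B) :
    indFamily B (ModX hs B) (regularRep hs B a) = inducedFamily hs B a :=
  (inducedFamily_mem_range hs a).choose_spec

theorem regularRep_toFull (f : Gc B) : regularRep hs B (f.toFull hs) = convX hs f :=
  indFamily_injective ((indFamily_regularRep hs _).trans (inducedFamily_toFull hs f))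

theorem eq_regularRep {V : FullCstar hs B →⋆ₙₐ[ℂ] Adjointable (UnitAlg B) (ModX hs B)}
    (hV : ∀ f φ : Gc B, V (f.toFull hs) (φ.toX hs) = (f.conv hs φ).toX hs) :
    V = regularRep hs B := by
  refine DFunLike.coe_injective ?_
  refine (denseRange_toFull hs).equalizer (map_continuous V) (map_continuous (regularRep hs B))
    (funext fun f => Adjointable.ext_toX hs fun φ => ?_)
  change V (f.toFull hs) (φ.toX hs) = regularRep hs B (f.toFull hs) (φ.toX hs)
  rw [hV, regularRep_toFull, convX_toX]

end RegularRepresentation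

/-! ### The reduced norm -/

section ReducedNorm

variable {G : Type u} [TopologicalSpace G] [TopGroupoid G] [T2Space G] [LocallyCompactSpace G]
  [SecondCountableTopology G] [MeasurableSpace G] [BorelSpace G] {hs : HaarSystem G}
  {B : G → Type v} [∀ x, NormedAddCommGroup (B x)] [∀ x, NormedSpace ℂ (B x)]
  [TopologicalSpace (Tot B)] [FellBundle B]
  (V : FullCstar hs B →⋆ₙₐ[ℂ] Adjointable (UnitAlg B) (ModX hs B))

theorem norm_eq_reducedNorm (a : FullCstar hs B) : ‖V a‖ = reducedNorm V a :=
  norm_eq_iSup_indHom (V a)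

theorem map_eq_zero_iff_mem_reducedIdeal (a : FullCstar hs B) :
    V a = 0 ↔ a ∈ reducedIdeal V := by
  rw [mem_reducedIdeal, ← norm_eq_reducedNorm, norm_eq_zero]

/-- The factorization of a homomorphism through the quotient by its reduced ideal. -/
noncomputable def reducedLift : ReducedCstar V →⋆ₙₐ[ℂ] Adjointable (UnitAlg B) (ModX hs B) :=
  let φ : ReducedCstar V →ₗ[ℂ] Adjointable (UnitAlg B) (ModX hs B) :=
    (reducedIdeal V).liftQ (V : FullCstar hs B →ₗ[ℂ] Adjointable (UnitAlg B) (ModX hs B))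
      fun a ha => (map_eq_zero_iff_mem_reducedIdeal V a).2 ha
  have hφ : ∀ a, φ (toReduced V a) = V a := fun a => rfl
  { toFun := φ
    map_smul' := map_smul φ
    map_zero' := map_zero φ
    map_add' := map_add φ
    map_mul' := fun x y => by
      obtain ⟨a, rfl⟩ := toReduced_surjective V x
      obtain ⟨b, rfl⟩ := toReduced_surjective V y
      rw [← toReduced_mul, hφ, hφ, hφ, map_mul]
    map_star' := fun x => by
      obtain ⟨a, rfl⟩ := toReduced_surjective V x
      rw [← toReduced_star, hφ, hφ, map_star] }

theorem reducedLift_toReduced (a : FullCstar hs B) : reducedLift V (toReduced V a) = V a := rfl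

theorem reducedLift_injective : Function.Injective (reducedLift V) := by
  intro x y hxy
  obtain ⟨a, rfl⟩ := toReduced_surjective V x
  obtain ⟨b, rfl⟩ := toReduced_surjective V y
  rw [reducedLift_toReduced, reducedLift_toReduced] at hxy
  rw [toReduced_eq_iff, ← map_eq_zero_iff_mem_reducedIdeal, map_sub, hxy, sub_self]

end ReducedNorm

end FellBundles

theorem lemma4p2 {G : Type*} [TopologicalSpace G] [FellBundles.TopGroupoid G] [T2Space G]
    [LocallyCompactSpace G] [SecondCountableTopology G] [MeasurableSpace G] [BorelSpace G]
    (hs : FellBundles.HaarSystem G)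
    (B : G → Type*) [∀ x, NormedAddCommGroup (B x)] [∀ x, NormedSpace ℂ (B x)]
    [TopologicalSpace (FellBundles.Tot B)] [FellBundles.FellBundle B]
    (hsep : FellBundles.IsSeparableBundle B) :
    ∃ V : FellBundles.FullCstar hs B →⋆ₙₐ[ℂ]
        FellBundles.Adjointable (FellBundles.UnitAlg B) (FellBundles.ModX hs B),
      -- `V` is the homomorphism that extends `V(f) φ = f * φ`, and it is unique
      (∀ f φ : FellBundles.Gc B, V (f.toFull hs) (φ.toX hs) = (f.conv hs φ).toX hs) ∧
      (∀ V' : FellBundles.FullCstar hs B →⋆ₙₐ[ℂ]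
          FellBundles.Adjointable (FellBundles.UnitAlg B) (FellBundles.ModX hs B),
        (∀ f φ : FellBundles.Gc B, V' (f.toFull hs) (φ.toX hs) = (f.conv hs φ).toX hs) →
          V' = V) ∧
      -- the kernel of `V` is the reduced ideal
      (∀ a, V a = 0 ↔ a ∈ FellBundles.reducedIdeal V) ∧
      -- `V` factors through an injection of the reduced algebra
      (∃ Vr : FellBundles.ReducedCstar V →⋆ₙₐ[ℂ]
          FellBundles.Adjointable (FellBundles.UnitAlg B) (FellBundles.ModX hs B),
        Function.Injective Vr ∧ ∀ a, Vr (FellBundles.toReduced V a) = V a) ∧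
      -- the norm of `V a` is the reduced norm
      (∀ a, ‖V a‖ = FellBundles.reducedNorm V a) :=
  ⟨FellBundles.regularRep hs B,
    fun f φ => by rw [FellBundles.regularRep_toFull, FellBundles.convX_toX],
    fun _ h => FellBundles.eq_regularRep hs h,
    FellBundles.map_eq_zero_iff_mem_reducedIdeal _,
    ⟨FellBundles.reducedLift _, FellBundles.reducedLift_injective _,
      FellBundles.reducedLift_toReduced _⟩,
    FellBundles.norm_eq_reducedNorm _⟩
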